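/- Let $X\subset\mathbb R^n$ be a bounded open set with Lipschitz boundary and let $s\in\mathbb N=\{0,1,2,\dots\}$. For $k\in\mathbb N$ let $\mathcal C_{\mathrm b}^{k}(X,\mathbb R^n)$ be the space of maps with continuous bounded derivatives up to order $k$ on $X$, with norm $\|f\|_{\mathcal C_{\mathrm b}^k}=\max_{j\le k}\sup_{x\in X}\|\mathrm D^jf(x)\|$, and let $\mathcal H^k(X)$ be the Sobolev--Hilbert space of (real or complex) functions whose weak derivatives up to order $k$ lie in $L^2(X)$, with inner product $\langle h_1,h_2\rangle=\sum_{|\alpha|\le k}\int_X \mathrm D^\alpha h_1\overline{\mathrm D^\alpha h_2}$; for vector-valued $v$, $\|v\|_{\mathcal H^k}^2=\sum_{|\alpha|\le k}\int_X\|\mathrm D^\alpha v\|^2$. Let $\mathcal F\subseteq \mathcal C_{\mathrm b}^{s+1}(X,\mathbb R^n)$ be a family of maps $f:X\to X$ such that $\inf_{x\in X}|\det \mathrm Df(x)|>0$ for every $f\in\mathcal F$; if $s=0$, suppose also that $\mathrm Df$ is uniformly continuous on $X$ for every $f\in\mathcal F$ (for $s\ge 1$ this is automatic). Then for every $f\in\mathcal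 F$ the Koopman operator $K_f: g\mapsto g\circ f$ is a well-defined bounded linear operator from $\mathcal H^{s+1}(X)$ to $\mathcal H^s(X)$, and the map $$M:\mathcal F\to\mathcal L(\mathcal H^{s+1}(X),\mathcal H^s(X)),\qquad f\mapsto K_f,$$ is continuous, where $\mathcal F$ carries the topology of $\mathcal C_{\mathrm b}^{s+1}$ and $\mathcal L(\mathcal H^{s+1}(X),\mathcal H^s(X))$ that of the operator norm. Moreover, the following first-order bounds hold: for every $f\in\mathcal F$ there are constants $C$ and $\delta>0$ such that, for every $\tilde f$ with $f+\tilde f\in\mathcal F$ and $\|\tilde f\|_{\mathcal C_{\mathrm b}^{s+1}}<\delta$, $$\|K_{f+\tilde f}-K_f\|_{\mathcal H^{s+1}\to\mathcal H^s}\le C\,\|\tilde f\|_{\mathcal C_{\mathrm b}^{s}},$$ and, if $s>n/2$, there are also $C$ and $\delta>0$ such that for all such $\tilde f$ $$\|K_{f+\tilde f}-K_f\|_{\mathcal H^{s+1}\to\mathcal H^s}\le C\,\|\tilde f\|_{\mathcal H^{s}}.$$ -/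

import Mathlib

open MeasureTheory Set
open scoped ContDiff

namespace Koopmanizing

noncomputable section

/-- The multi-indices `α` in `n` variables of degree `|α| = α₁ + ⋯ + αₙ ≤ s`
(every entry of such an `α` is at most `s`). -/
abbrev MultiIndex (n s : ℕ) : Type :=
  {α : Fin n → Fin (s + 1) // ∑ i, (α i : ℕ) ≤ s}

/-- The underlying tuple of natural numbers of a multi-index. -/
def MultiIndex.toFun {n s : ℕ} (α : MultiIndex n s) : Fin n → ℕ := fun i => (α.1 i : ℕ)

/-- The multi-index `(0, …, 0)`. -/
def MultiIndex.zero (n s : ℕ) : MultiIndex n s := ⟨fun _ => 0, by simp⟩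

/-- The classical partial derivative `∂^|α| φ / ∂x₁^α₁ ⋯ ∂xₙ^αₙ`: the derivative of order `|α|`
evaluated at the list of coordinate vectors in which `eᵢ` occurs `αᵢ` times. -/
def partialDeriv {n : ℕ} {G : Type*} [NormedAddCommGroup G] [NormedSpace ℝ G]
    (α : Fin n → ℕ) (φ : EuclideanSpace ℝ (Fin n) → G) (x : EuclideanSpace ℝ (Fin n)) : G :=
  iteratedFDeriv ℝ (∑ i, α i) φ x
    (fun k => EuclideanSpace.single (finSigmaFinEquiv.symm k).1 (1 : ℝ))

/-- `w` is the weak derivative `D^α h` on `X`: for all smooth `φ` compactly supported in `X`,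
`∫_X φ w = (-1)^|α| ∫_X (∂^α φ) h`. -/
def IsWeakDeriv {n : ℕ} {𝕜 : Type*} [RCLike 𝕜] (X : Set (EuclideanSpace ℝ (Fin n)))
    (α : Fin n → ℕ) (h w : EuclideanSpace ℝ (Fin n) → 𝕜) : Prop :=
  ∀ φ : EuclideanSpace ℝ (Fin n) → ℝ, ContDiff ℝ ∞ φ → HasCompactSupport φ → tsupport φ ⊆ X →
    ∫ x in X, φ x • w x = (-1 : ℝ) ^ (∑ i, α i) • ∫ x in X, partialDeriv α φ x • h x

section WeakDeriv

variable {n : ℕ} {𝕜 : Type*} [RCLike 𝕜] {X : Set (EuclideanSpace ℝ (Fin n))}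

theorem continuous_partialDeriv {φ : EuclideanSpace ℝ (Fin n) → ℝ} (hφ : ContDiff ℝ ∞ φ)
    (α : Fin n → ℕ) : Continuous (partialDeriv α φ) := by
  have h := hφ.continuous_iteratedFDeriv (m := ∑ i, α i) (by exact_mod_cast le_top)
  unfold partialDeriv
  fun_prop

theorem hasCompactSupport_partialDeriv {φ : EuclideanSpace ℝ (Fin n) → ℝ}
    (hφ : HasCompactSupport φ) (α : Fin n → ℕ) : HasCompactSupport (partialDeriv α φ) := by
  refine (hφ.iteratedFDeriv (𝕜 := ℝ) (∑ i, α i)).mono' ?_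
  intro x hx
  apply subset_tsupport
  intro h0
  apply hx
  simp [partialDeriv, h0]

theorem integrable_test_smul {φ : EuclideanSpace ℝ (Fin n) → ℝ} (hφ : Continuous φ)
    (hc : HasCompactSupport φ) (u : Lp 𝕜 2 (volume.restrict X)) :
    Integrable (fun x => φ x • u x) (volume.restrict X) := by
  have h1 : MemLp φ 2 (volume.restrict X) :=
    (hφ.memLp_of_hasCompactSupport (μ := volume) hc).restrict X
  exact memLp_one_iff_integrable.1 ((Lp.memLp u).smul h1)

theorem integral_test_add {φ : EuclideanSpace ℝ (Fin n) → ℝ} (hφ : Continuous φ)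
    (hc : HasCompactSupport φ) (u v : Lp 𝕜 2 (volume.restrict X)) :
    ∫ x in X, φ x • (u + v) x = (∫ x in X, φ x • u x) + ∫ x in X, φ x • v x := by
  rw [← integral_add (integrable_test_smul hφ hc u) (integrable_test_smul hφ hc v)]
  refine integral_congr_ae ?_
  filter_upwards [Lp.coeFn_add u v] with x hx
  rw [hx, Pi.add_apply, smul_add]

theorem integral_test_smul {φ : EuclideanSpace ℝ (Fin n) → ℝ} (c : 𝕜)
    (u : Lp 𝕜 2 (volume.restrict X)) :
    ∫ x in X, φ x • (c • u) x = c • ∫ x in X, φ x • u x := by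
  rw [← integral_smul]
  refine integral_congr_ae ?_
  filter_upwards [Lp.coeFn_smul c u] with x hx
  rw [hx, Pi.smul_apply, smul_comm]

end WeakDeriv

/-- The Sobolev-Hilbert space `H^s(X)` as a subspace of an `ℓ²`-sum of `L²` spaces. A function `h ∈ L²(X)` whose weak derivatives up to degree
`s` exist in `L²(X)` is stored with these derivatives, as the family `(D^α h)_{|α| ≤ s}` in the
`ℓ²`-sum of copies of `L²(X)`, so that the inner product is
`⟪h₁, h₂⟫ = ∑_{|α| ≤ s} ∫_X D^α h₁ · conj (D^α h₂)` up to the order of the arguments.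
The component of index `0` is `h` itself, and it determines the family (see `sobolev_ext`). -/
def sobolevSubmodule (𝕜 : Type*) [RCLike 𝕜] {n : ℕ} (s : ℕ) (X : Set (EuclideanSpace ℝ (Fin n))) :
    Submodule 𝕜 (PiLp 2 (fun _ : MultiIndex n s => Lp 𝕜 2 (volume.restrict X))) where
  carrier := {u | ∀ α : MultiIndex n s, IsWeakDeriv X α.toFun (u (MultiIndex.zero n s)) (u α)}
  zero_mem' := by
    intro α φ _ _ _
    have e : ∀ ψ : EuclideanSpace ℝ (Fin n) → ℝ,
        ∫ x in X, ψ x • (0 : Lp 𝕜 2 (volume.restrict X)) x = 0 := by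
      intro ψ
      have := integral_test_smul (X := X) (φ := ψ) (0 : 𝕜) 0
      rwa [zero_smul, zero_smul] at this
    simp only [PiLp.zero_apply]
    rw [e, e, smul_zero]
  add_mem' := by
    intro u v hu hv α φ h1 h2 h3
    simp only [PiLp.add_apply]
    rw [integral_test_add h1.continuous h2, integral_test_add (continuous_partialDeriv h1 _)
      (hasCompactSupport_partialDeriv h2 _), hu α φ h1 h2 h3, hv α φ h1 h2 h3, smul_add]
  smul_mem' := by
    intro c u hu α φ h1 h2 h3
    simp only [PiLp.smul_apply]
    rw [integral_test_smul, integral_test_smul, hu α φ h1 h2 h3, smul_comm]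

/-- The Sobolev-Hilbert space `H^s(X)`, with the inner product described above. -/
def Sobolev (𝕜 : Type*) [RCLike 𝕜] {n : ℕ} (s : ℕ) (X : Set (EuclideanSpace ℝ (Fin n))) : Type _ :=
  sobolevSubmodule 𝕜 s X

instance {𝕜 : Type*} [RCLike 𝕜] {n s : ℕ} {X : Set (EuclideanSpace ℝ (Fin n))} :
    NormedAddCommGroup (Sobolev 𝕜 s X) :=
  inferInstanceAs (NormedAddCommGroup (sobolevSubmodule 𝕜 s X))

instance {𝕜 : Type*} [RCLike 𝕜] {n s : ℕ} {X : Set (EuclideanSpace ℝ (Fin n))} :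
    InnerProductSpace 𝕜 (Sobolev 𝕜 s X) :=
  inferInstanceAs (InnerProductSpace 𝕜 (sobolevSubmodule 𝕜 s X))

/-- The function (almost everywhere class) underlying an element of `H^s(X)`. -/
def sobolevFn {𝕜 : Type*} [RCLike 𝕜] {n s : ℕ} {X : Set (EuclideanSpace ℝ (Fin n))}
    (u : Sobolev 𝕜 s X) : Lp 𝕜 2 (volume.restrict X) :=
  u.1 (MultiIndex.zero n s)

/-- On an open set, an element of `H^s(X)` is determined by its underlying function. -/
theorem sobolev_ext {𝕜 : Type*} [RCLike 𝕜] {n s : ℕ} {X : Set (EuclideanSpace ℝ (Fin n))}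
    (hX : IsOpen X) {u v : Sobolev 𝕜 s X} (h : sobolevFn u = sobolevFn v) : u = v := by
  have hw : (u - v).1 (MultiIndex.zero n s) = 0 := by
    change u.1 _ - v.1 _ = 0
    exact sub_eq_zero.2 h
  suffices H : u - v = 0 from sub_eq_zero.1 H
  generalize u - v = w at hw
  apply Subtype.ext
  ext1 α
  change w.1 α = 0
  rw [Lp.eq_zero_iff_ae_eq_zero]
  have key := hX.ae_eq_zero_of_integral_contDiff_smul_eq_zero (f := w.1 α)
    (μ := volume.restrict X)
    (((Lp.memLp (w.1 α)).locallyIntegrable (by norm_num)).locallyIntegrableOn X)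
    (fun φ h1 h2 h3 => by
      rw [w.2 α φ h1 h2 h3, hw]
      have := integral_test_smul (X := X) (φ := partialDeriv α.toFun φ) (0 : 𝕜) 0
      rw [zero_smul, zero_smul] at this
      rw [this, smul_zero])
  filter_upwards [key, ae_restrict_mem hX.measurableSet] with x hx hxX
  exact hx hxX

/-- The linear space `C_b^k(X, ℝⁿ)` of maps whose derivatives of all orders `0, …, k` exist, are
continuous and are bounded on `X`. It is used for open `X`; the maps are written as functions on
the whole of `ℝⁿ`, but only their values on `X` matter, here and in the norm below. -/
def cbSubmodule {n : ℕ} (k : ℕ) (X : Set (EuclideanSpace ℝ (Fin n))) :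
    Submodule ℝ (EuclideanSpace ℝ (Fin n) → EuclideanSpace ℝ (Fin n)) where
  carrier := {f | (∀ x ∈ X, ContDiffAt ℝ k f x) ∧
    ∀ j ≤ k, ∃ C : ℝ, ∀ x ∈ X, ‖iteratedFDeriv ℝ j f x‖ ≤ C}
  zero_mem' := by
    refine ⟨fun x _ => contDiffAt_const, fun j _ => ⟨0, fun x _ => ?_⟩⟩
    rw [show (0 : EuclideanSpace ℝ (Fin n) → EuclideanSpace ℝ (Fin n)) = fun _ => 0 from rfl,
      iteratedFDeriv_fun_zero]
    simp
  add_mem' := by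
    rintro f g ⟨hf, hf'⟩ ⟨hg, hg'⟩
    refine ⟨fun x hx => (hf x hx).add (hg x hx), fun j hj => ?_⟩
    obtain ⟨C, hC⟩ := hf' j hj
    obtain ⟨D, hD⟩ := hg' j hj
    refine ⟨C + D, fun x hx => ?_⟩
    rw [iteratedFDeriv_add_apply ((hf x hx).of_le (by exact_mod_cast hj))
      ((hg x hx).of_le (by exact_mod_cast hj))]
    exact (norm_add_le _ _).trans (add_le_add (hC x hx) (hD x hx))
  smul_mem' := by
    rintro c f ⟨hf, hf'⟩
    refine ⟨fun x hx => (hf x hx).const_smul c, fun j hj => ?_⟩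
    obtain ⟨C, hC⟩ := hf' j hj
    refine ⟨‖c‖ * C, fun x hx => ?_⟩
    rw [iteratedFDeriv_const_smul_apply ((hf x hx).of_le (by exact_mod_cast hj)), norm_smul]
    exact mul_le_mul_of_nonneg_left (hC x hx) (norm_nonneg c)

/-- The space `C_b^k(X, ℝⁿ)`, to be given the norm below. -/
def Cb {n : ℕ} (k : ℕ) (X : Set (EuclideanSpace ℝ (Fin n))) : Type :=
  cbSubmodule k X

instance {n k : ℕ} {X : Set (EuclideanSpace ℝ (Fin n))} : AddCommGroup (Cb k X) :=
  inferInstanceAs (AddCommGroup (cbSubmodule k X))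

instance {n k : ℕ} {X : Set (EuclideanSpace ℝ (Fin n))} :
    CoeFun (Cb k X) (fun _ => EuclideanSpace ℝ (Fin n) → EuclideanSpace ℝ (Fin n)) :=
  ⟨Subtype.val⟩

/-- The map `f ↦ (D^j f)_{j ≤ k}` from `C_b^k(X, ℝⁿ)` to a product of spaces of bounded continuous
functions on `X` with the supremum norm. -/
def Cb.jet {n k : ℕ} {X : Set (EuclideanSpace ℝ (Fin n))} :
    Cb k X →+ ((j : Fin (k + 1)) → BoundedContinuousFunction X
      (ContinuousMultilinearMap ℝ (fun _ : Fin (j : ℕ) => EuclideanSpace ℝ (Fin n))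
        (EuclideanSpace ℝ (Fin n)))) where
  toFun f j := BoundedContinuousFunction.ofNormedAddCommGroup
    (fun x : X => iteratedFDeriv ℝ (j : ℕ) f.1 x)
    (continuous_iff_continuousAt.2 fun x =>
      ((f.2.1 x x.2).continuousAt_iteratedFDeriv
        (by exact_mod_cast Nat.lt_succ_iff.1 j.2)).comp continuous_subtype_val.continuousAt)
    (f.2.2 j (Nat.lt_succ_iff.1 j.2)).choose
    (fun x => (f.2.2 j (Nat.lt_succ_iff.1 j.2)).choose_spec x x.2)
  map_zero' := by
    funext j
    ext1 x
    change iteratedFDeriv ℝ (j : ℕ) (fun _ => 0) (x : EuclideanSpace ℝ (Fin n)) = 0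
    rw [iteratedFDeriv_fun_zero]
    rfl
  map_add' f g := by
    funext j
    ext1 x
    have hj : ((j : ℕ) : WithTop ℕ∞) ≤ (k : WithTop ℕ∞) := by
      exact_mod_cast Nat.lt_succ_iff.1 j.2
    exact iteratedFDeriv_add_apply ((f.2.1 x x.2).of_le hj) ((g.2.1 x x.2).of_le hj)

/-- The norm `‖f‖_{C_b^k} = max_{j ≤ k} sup_{x ∈ X} ‖D^j f(x)‖` and its topology (a seminorm in the
sense of Lean, since the values of `f` off `X` are ignored). -/
instance {n k : ℕ} {X : Set (EuclideanSpace ℝ (Fin n))} : SeminormedAddCommGroup (Cb k X) :=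
  SeminormedAddCommGroup.induced _ _ Cb.jet

/-- The inclusion of `C_b^{k+1}(X, ℝⁿ)` in `C_b^k(X, ℝⁿ)`. -/
def Cb.lower {n k : ℕ} {X : Set (EuclideanSpace ℝ (Fin n))} (f : Cb (k + 1) X) : Cb k X :=
  ⟨f.1, fun x hx => (f.2.1 x hx).of_le (by exact_mod_cast Nat.le_succ k),
    fun j hj => f.2.2 j (hj.trans (Nat.le_succ k))⟩

/-- The norm `‖v‖_{H^s} = (∑_{|α| ≤ s} ∫_X ‖∂^α v‖²)^{1/2}` of a vector-valued map `v` which is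
`s` times continuously differentiable with bounded derivatives on the bounded open set `X`. -/
def vectorSobolevNorm {n : ℕ} (s : ℕ) (X : Set (EuclideanSpace ℝ (Fin n)))
    (v : EuclideanSpace ℝ (Fin n) → EuclideanSpace ℝ (Fin n)) : ℝ :=
  √(∑ α : MultiIndex n s, ∫ x in X, ‖partialDeriv α.toFun v x‖ ^ 2)

/-- `X` is a bounded open set with Lipschitz boundary: near each boundary point there are a unit
vector `e` (the vertical direction) and a Lipschitz function `γ` of the horizontal component
`x - ⟪e, x⟫ e` such that `X` is the part lying strictly above the graph of `γ`. -/
structure IsBoundedLipschitzDomain {n : ℕ} (X : Set (EuclideanSpace ℝ (Fin n))) : Prop where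
  isOpen : IsOpen X
  isBounded : Bornology.IsBounded X
  lipschitz_boundary : ∀ p ∈ frontier X, ∃ e : EuclideanSpace ℝ (Fin n), ‖e‖ = 1 ∧
    ∃ (γ : EuclideanSpace ℝ (Fin n) → ℝ) (L : NNReal), LipschitzWith L γ ∧
      ∃ r : ℝ, 0 < r ∧ ∀ x ∈ Metric.ball p r,
        x ∈ X ↔ γ (x - inner ℝ e x • e) < inner ℝ e x

/-- `K` is the Koopman operator `g ↦ g ∘ f` from `H^a(X)` to `H^b(X)`: whenever a function `g`
represents `u ∈ H^a(X)` almost everywhere on `X`, the composition `g ∘ f` represents `K u`. -/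
def IsKoopman {𝕜 : Type*} [RCLike 𝕜] {n a b : ℕ} {X : Set (EuclideanSpace ℝ (Fin n))}
    (f : EuclideanSpace ℝ (Fin n) → EuclideanSpace ℝ (Fin n))
    (K : Sobolev 𝕜 a X →L[𝕜] Sobolev 𝕜 b X) : Prop :=
  ∀ (u : Sobolev 𝕜 a X) (g : EuclideanSpace ℝ (Fin n) → 𝕜),
    (sobolevFn u : EuclideanSpace ℝ (Fin n) → 𝕜) =ᵐ[volume.restrict X] g →
    (sobolevFn (K u) : EuclideanSpace ℝ (Fin n) → 𝕜) =ᵐ[volume.restrict X] g ∘ f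

end

end Koopmanizing

/-! Composition with `f` is bounded on L² because `f` does not compress volume too much, and this is
put in a quantitative form that is stable under perturbation. Since |det Df| is bounded below and Df
is bounded and uniformly continuous, there are m, r₁ > 0 with m‖y - x‖ ≤ ‖f y - f x‖ for all x, y in
X at distance less than r₁ (`UniformCone.exists_antilipschitz`). On each of finitely many small
balls covering X the map has a Lipschitz inverse, whence ∫_X U ∘ f ≤ K ∫ U with K depending only on
m, r₁ and X (`exists_compBound`). With m/2 in place of m, one constant serves all maps close to `f`
in C¹, their interpolants f + t(f' - f), and the translates of these.

The boundary enters only through a uniform cone property, which joins nearby points of X by paths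
inside X of comparable length. To estimate G ∘ f' - G ∘ f, the derivative DG is integrated along
three segments: from f(x) into the cone, then parallel to f'(x) - f(x), then back out to f'(x). The
axis of the cone depends only on a nearby point of a finite net, so on each piece every stage of the
motion is an anti-Lipschitz map of x. This gives ‖G ∘ f' - G ∘ f‖ ≤ C sup‖f' - f‖ ‖DG‖ in L²
(`UniformCone.exists_lintegral_comp_sub_comp_le`).

By the chain rule, derivatives of order k ≤ s of the difference reduce to such increments of D^m G
and to products D^m G(f') · D^j(f' - f) with m ≥ 1 and m + j ≤ k + 1. For the bound in C_b^s the
factor D^j(f' - f) is taken out in the supremum norm. For the bound in H^s with s > n/2 the products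
are handled by a version of the algebra property of Sobolev spaces, proved with weighted integrals
over cones (`UniformCone.exists_lintegral_iteratedFDeriv_comp_mul_le`).

All this concerns smooth G, on a compact K ⊆ X, and uses the derivatives of G only on a compact K' ⊆
X, with constants independent of K. Mollification provides smooth G close to u in L²(X) whose
derivatives on K' are bounded by those of u. Testing against φ supported in K and letting G tend to
u bounds the distributional derivatives as functionals on L²(X), and Riesz representation turns them
into weak derivatives (`TransferBound.exists_sobolev`). Applied to G ↦ G ∘ f this yields the
operator, and applied to G ↦ G ∘ f' - G ∘ f the first-order bounds. Continuity follows from the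
first of them, as the C_b^s norm is at most the C_b^{s+1} norm. -/

namespace Koopmanizing

/-! ### The uniform cone property of Lipschitz domains -/

/-- `X` has the uniform cone property at scale `r` with opening `κ`. -/
structure UniformCone {E : Type*} [NormedAddCommGroup E] [NormedSpace ℝ E]
    (X : Set E) (r κ : ℝ) : Prop where
  r_pos : 0 < r
  κ_pos : 0 < κ
  κ_le : κ ≤ 1
  cone : ∀ x ∈ X, ∃ e : E, ‖e‖ ≤ 1 ∧ ∀ y ∈ X, ‖y - x‖ < 2 * r → ∀ h, 0 ≤ h → h ≤ r →
    ∀ v : E, ‖v‖ ≤ κ * h → y + h • e + v ∈ X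

/-- A move by h e + v raises the height by at least h - ‖v‖, while the graph below rises by at most
2L‖v‖, so a narrow enough cone around the vertical direction stays above the graph. -/
theorem exists_cone_near_frontier {n : ℕ} {X : Set (EuclideanSpace ℝ (Fin n))}
    (hX : IsBoundedLipschitzDomain X) {p : EuclideanSpace ℝ (Fin n)} (hp : p ∈ frontier X) :
    ∃ ρ κ : ℝ, 0 < ρ ∧ 0 < κ ∧ κ ≤ 1 ∧ ∃ e : EuclideanSpace ℝ (Fin n), ‖e‖ ≤ 1 ∧
      ∀ y ∈ X, ‖y - p‖ < ρ → ∀ h, 0 ≤ h → h ≤ ρ →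
        ∀ v : EuclideanSpace ℝ (Fin n), ‖v‖ ≤ κ * h → y + h • e + v ∈ X := by
  obtain ⟨e, he, γ, L, hγ, r, hr, hrX⟩ := hX.lipschitz_boundary p hp
  have hL : (0 : ℝ) ≤ L := L.2
  -- The requirement is (2L + 1)‖v‖ < h for h > 0; with this opening (2L + 1) κ h = h - κ h. The
  -- factor 2L stems from bounding the horizontal part of v by 2‖v‖.
  set κ : ℝ := 1 / (2 * L + 2) with hκ
  have hκ0 : 0 < κ := by positivity
  have hκ1 : κ ≤ 1 := by rw [hκ, div_le_one (by positivity)]; linarith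
  have hκL : (2 * L + 2) * κ = 1 := by rw [hκ]; field_simp
  refine ⟨r / 4, κ, by positivity, hκ0, hκ1, e, he.le, fun y hy hyp h h0 h1 v hv => ?_⟩
  have hvh : ‖v‖ ≤ h := hv.trans (by nlinarith)
  have hz : y + h • e + v ∈ Metric.ball p r := by
    rw [mem_ball_iff_norm]
    have e1 : y + h • e + v - p = (y - p) + h • e + v := by abel
    have e2 : ‖h • e‖ = h := by rw [norm_smul, he, Real.norm_of_nonneg h0, mul_one]
    rw [e1]
    calc _ ≤ ‖y - p‖ + ‖h • e‖ + ‖v‖ := norm_add₃_le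
      _ < r := by rw [e2]; linarith
  have hyb : y ∈ Metric.ball p r := by rw [mem_ball_iff_norm]; linarith
  rw [hrX _ hz]
  have hy' := (hrX _ hyb).1 hy
  have hee : inner ℝ e e = (1 : ℝ) := by rw [real_inner_self_eq_norm_sq, he]; norm_num
  have hin : inner ℝ e (y + h • e + v) = inner ℝ e y + h + inner ℝ e v := by
    rw [inner_add_right, inner_add_right, inner_smul_right, hee, mul_one]
  have hev : |inner ℝ e v| ≤ ‖v‖ := by
    simpa [he] using abs_real_inner_le_norm e v
  rw [hin]
  have hd := hγ.dist_le_mul (y + h • e + v - (inner ℝ e y + h + inner ℝ e v) • e) (y - inner ℝ e y • e)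
  rw [dist_eq_norm, dist_eq_norm] at hd
  have e3 : y + h • e + v - (inner ℝ e y + h + inner ℝ e v) • e - (y - inner ℝ e y • e)
      = v - inner ℝ e v • e := by
    simp only [add_smul]; abel
  rw [e3] at hd
  have e4 : ‖v - inner ℝ e v • e‖ ≤ 2 * ‖v‖ := by
    calc _ ≤ ‖v‖ + ‖inner ℝ e v • e‖ := norm_sub_le _ _
      _ ≤ 2 * ‖v‖ := by rw [norm_smul, he, mul_one, Real.norm_eq_abs]; linarith
  have e5 := (le_abs_self _).trans ((Real.norm_eq_abs _).symm.le.trans hd)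
  have e6 : (L : ℝ) * ‖v - inner ℝ e v • e‖ ≤ L * (2 * ‖v‖) := by gcongr
  have e7 : (2 * (L : ℝ) + 1) * ‖v‖ ≤ (2 * L + 1) * (κ * h) := by gcongr
  have e8 : (2 * (L : ℝ) + 1) * (κ * h) = h - κ * h := by linear_combination h * hκL
  have e9 := neg_abs_le (inner ℝ e v)
  by_cases hh : h = 0
  · have hv0 : ‖v‖ ≤ 0 := by rw [hh] at hv; simpa using hv
    have : v = 0 := by simpa using hv0
    subst this
    subst hh
    simpa using hy'
  · have : 0 < κ * h := by positivity
    nlinarith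

/-- Compactness of the closure: the property with some constants holds on a neighbourhood of each
point and passes to finite unions on taking minima. At an interior point the axis 0 serves. The
radius is divided by 4 so that one axis serves all points of X within 2r of x. -/
theorem IsBoundedLipschitzDomain.exists_uniformCone {n : ℕ} {X : Set (EuclideanSpace ℝ (Fin n))}
    (hX : IsBoundedLipschitzDomain X) : ∃ r κ : ℝ, UniformCone X r κ := by
  have hc : IsCompact (closure X) := hX.isBounded.isCompact_closure
  let P : Set (EuclideanSpace ℝ (Fin n)) → ℝ → ℝ → Prop := fun S r κ =>
    0 < r ∧ 0 < κ ∧ κ ≤ 1 ∧ ∀ x ∈ X ∩ S, ∃ e : EuclideanSpace ℝ (Fin n), ‖e‖ ≤ 1 ∧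
      ∀ y ∈ X, ‖y - x‖ < 2 * r → ∀ h, 0 ≤ h → h ≤ r →
        ∀ v : EuclideanSpace ℝ (Fin n), ‖v‖ ≤ κ * h → y + h • e + v ∈ X
  have hmono : ∀ S r κ r' κ', P S r κ → 0 < r' → 0 < κ' → r' ≤ r → κ' ≤ κ → P S r' κ' := by
    rintro S r κ r' κ' ⟨_, _, h3, h4⟩ h5 h6 h7 h8
    refine ⟨h5, h6, h8.trans h3, fun x hx => ?_⟩
    obtain ⟨e, he, H⟩ := h4 x hx
    exact ⟨e, he, fun y hy hyx h h0 h1 v hv => H y hy (by linarith) h h0 (h1.trans h7) v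
      (hv.trans (by gcongr))⟩
  suffices H : ∃ r κ, P (closure X) r κ by
    obtain ⟨r, κ, h1, h2, h3, h4⟩ := H
    exact ⟨r, κ, h1, h2, h3, fun x hx => h4 x ⟨hx, subset_closure hx⟩⟩
  refine hc.induction_on (p := fun S => ∃ r κ, P S r κ) ?_ ?_ ?_ ?_
  · exact ⟨1, 1, one_pos, one_pos, le_rfl, fun x hx => hx.2.elim⟩
  · rintro s t hst ⟨r, κ, h1, h2, h3, h4⟩
    exact ⟨r, κ, h1, h2, h3, fun x hx => h4 x ⟨hx.1, hst hx.2⟩⟩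
  · rintro s t ⟨r, κ, hs⟩ ⟨r', κ', ht⟩
    have hr : 0 < min r r' := lt_min hs.1 ht.1
    have hκ : 0 < min κ κ' := lt_min hs.2.1 ht.2.1
    have hs' := hmono _ _ _ _ _ hs hr hκ (min_le_left _ _) (min_le_left _ _)
    have ht' := hmono _ _ _ _ _ ht hr hκ (min_le_right _ _) (min_le_right _ _)
    refine ⟨_, _, hr, hκ, hs'.2.2.1, ?_⟩
    rintro x ⟨hx, hx' | hx'⟩
    · exact hs'.2.2.2 x ⟨hx, hx'⟩
    · exact ht'.2.2.2 x ⟨hx, hx'⟩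
  · intro p hp
    by_cases hpX : p ∈ X
    · obtain ⟨ρ, hρ, hb⟩ := Metric.isOpen_iff.1 hX.isOpen p hpX
      refine ⟨Metric.ball p (ρ / 4), mem_nhdsWithin_of_mem_nhds (Metric.ball_mem_nhds _ (by positivity)),
        ρ / 4, 1, by positivity, one_pos, le_rfl, fun x hx => ⟨0, by simp, ?_⟩⟩
      intro y hy hyx h h0 h1 v hv
      apply hb
      have hxp := mem_ball_iff_norm.1 hx.2
      rw [mem_ball_iff_norm, smul_zero, add_zero]
      have : y + v - p = (y - x) + (x - p) + v := by abel
      rw [this]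
      calc _ ≤ ‖y - x‖ + ‖x - p‖ + ‖v‖ := norm_add₃_le
        _ < ρ := by linarith
    · have hpf : p ∈ frontier X := by
        rw [frontier, hX.isOpen.interior_eq]; exact ⟨hp, hpX⟩
      obtain ⟨ρ, κ, h1, h2, h3, e, he, H⟩ := exists_cone_near_frontier hX hpf
      refine ⟨Metric.ball p (ρ / 4), mem_nhdsWithin_of_mem_nhds (Metric.ball_mem_nhds _ (by positivity)),
        ρ / 4, κ, by positivity, h2, h3, fun x hx => ⟨e, he, ?_⟩⟩
      intro y hy hyx h h0 h1 v hv
      have hxp := mem_ball_iff_norm.1 hx.2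
      refine H y hy ?_ h h0 (by linarith) v hv
      have : y - p = (y - x) + (x - p) := by abel
      rw [this]
      exact (norm_add_le _ _).trans_lt (by linarith)

section Cone
variable {E : Type*} [NormedAddCommGroup E] [NormedSpace ℝ E] {X : Set E} {r κ : ℝ}
  {G : Type*} [NormedAddCommGroup G] [NormedSpace ℝ G]

theorem norm_sub_le_of_segment {φ : E → G} {ε : ℝ} {x v : E}
    (hd : ∀ t : ℝ, 0 ≤ t → t ≤ 1 → DifferentiableAt ℝ φ (x + t • v))
    (hε : ∀ t : ℝ, 0 ≤ t → t ≤ 1 → ‖fderiv ℝ φ (x + t • v)‖ ≤ ε) :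
    ‖φ (x + v) - φ x‖ ≤ ε * ‖v‖ := by
  have h := norm_image_sub_le_of_norm_deriv_le_segment_01' (f := fun t : ℝ => φ (x + t • v))
    (f' := fun t => fderiv ℝ φ (x + t • v) v) (C := ε * ‖v‖) (fun t ht => ?_) (fun t ht => ?_)
  · simpa using h
  · have h1 : HasDerivAt (fun t : ℝ => x + t • v) v t := by
      simpa using ((hasDerivAt_id t).smul_const v).const_add x
    exact ((hd t ht.1 ht.2).hasFDerivAt.comp_hasDerivAt t h1).hasDerivWithinAt
  · exact (ContinuousLinearMap.le_opNorm _ _).trans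
      (by gcongr; exact hε t ht.1 ht.2.le)

/-- A mean value inequality on sets with the uniform cone property, where two points are joined by
the path that first moves into the cone, then moves parallel to their difference, and then moves
out of the cone. -/
theorem UniformCone.norm_sub_le (hX : UniformCone X r κ) {φ : E → G}
    (hd : ∀ z ∈ X, DifferentiableAt ℝ φ z) {x y : E} (hx : x ∈ X) (hy : y ∈ X)
    (hxy : ‖y - x‖ ≤ κ * r) {ε : ℝ}
    (hε : ∀ z ∈ X, ‖z - x‖ ≤ (3 / κ) * ‖y - x‖ → ‖fderiv ℝ φ z‖ ≤ ε) :
    ‖φ y - φ x‖ ≤ ε * (3 / κ) * ‖y - x‖ := by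
  have hκ := hX.κ_pos
  have hr := hX.r_pos
  have hε0 : 0 ≤ ε := (norm_nonneg _).trans (hε x hx (by simp; positivity))
  set d := ‖y - x‖ with hd'
  have hd0 : 0 ≤ d := norm_nonneg _
  -- At this height the cone is wide enough to contain the displacement y - x, since κ h = d. The
  -- whole path then has length at most 2h + d ≤ 3h = (3/κ) d.
  set h := d / κ with hh
  have hκh : κ * h = d := by rw [hh]; field_simp
  have h0 : 0 ≤ h := by positivity
  have hdh : d ≤ h := by rw [hh, le_div_iff₀ hκ]; nlinarith [hX.κ_le]
  have h1 : h ≤ r := by rw [hh, div_le_iff₀ hκ]; linarith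
  have h3 : 3 / κ * d = 3 * h := by rw [hh]; ring
  obtain ⟨e, he, H⟩ := hX.cone x hx
  have hxx : ‖x - x‖ < 2 * r := by simp; exact hr
  have hyx : ‖y - x‖ < 2 * r := by rw [← hd']; nlinarith [hX.κ_le]
  have hsm : ∀ t : ℝ, 0 ≤ t → t ≤ 1 → 0 ≤ t * h ∧ t * h ≤ h := fun t h0' h1' =>
    ⟨by positivity, by nlinarith⟩
  have hn : ∀ t : ℝ, 0 ≤ t → t ≤ h → ‖t • e‖ ≤ h := fun t h0' h1' => by
    rw [norm_smul, Real.norm_of_nonneg h0']; nlinarith [norm_nonneg e]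
  have A1 : ∀ t : ℝ, 0 ≤ t → t ≤ 1 → x + t • h • e ∈ X ∧ ‖x + t • h • e - x‖ ≤ 3 / κ * d := by
    intro t t0 t1
    have := H x hx hxx (t * h) (hsm t t0 t1).1 ((hsm t t0 t1).2.trans h1) 0 (by simp; positivity)
    rw [add_zero, mul_smul] at this
    refine ⟨this, ?_⟩
    rw [add_sub_cancel_left, h3, smul_smul]
    have := hn _ (hsm t t0 t1).1 (hsm t t0 t1).2
    linarith
  have A2 : ∀ t : ℝ, 0 ≤ t → t ≤ 1 → (x + h • e) + t • (y - x) ∈ X ∧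
      ‖(x + h • e) + t • (y - x) - x‖ ≤ 3 / κ * d := by
    intro t t0 t1
    have hn' : ‖t • (y - x)‖ ≤ d := by
      rw [norm_smul, Real.norm_of_nonneg t0, ← hd']; nlinarith
    have := H x hx hxx h h0 h1 (t • (y - x)) (by rw [hκh]; exact hn')
    refine ⟨this, ?_⟩
    have e1 : (x + h • e) + t • (y - x) - x = h • e + t • (y - x) := by abel
    rw [e1, h3]
    have := hn h h0 le_rfl
    exact (norm_add_le _ _).trans (by linarith)
  have A3 : ∀ t : ℝ, 0 ≤ t → t ≤ 1 → y + t • h • e ∈ X ∧ ‖y + t • h • e - x‖ ≤ 3 / κ * d := by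
    intro t t0 t1
    have := H y hy hyx (t * h) (hsm t t0 t1).1 ((hsm t t0 t1).2.trans h1) 0 (by simp; positivity)
    rw [add_zero, mul_smul] at this
    refine ⟨this, ?_⟩
    have e1 : y + t • h • e - x = (y - x) + (t * h) • e := by rw [smul_smul]; abel
    rw [e1, h3]
    have := hn _ (hsm t t0 t1).1 (hsm t t0 t1).2
    exact (norm_add_le _ _).trans (by linarith)
  have B1 := norm_sub_le_of_segment (φ := φ) (ε := ε) (x := x) (v := h • e)
    (fun t t0 t1 => hd _ (A1 t t0 t1).1) (fun t t0 t1 => hε _ (A1 t t0 t1).1 (A1 t t0 t1).2)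
  have B2 := norm_sub_le_of_segment (φ := φ) (ε := ε) (x := x + h • e) (v := y - x)
    (fun t t0 t1 => hd _ (A2 t t0 t1).1) (fun t t0 t1 => hε _ (A2 t t0 t1).1 (A2 t t0 t1).2)
  have B3 := norm_sub_le_of_segment (φ := φ) (ε := ε) (x := y) (v := h • e)
    (fun t t0 t1 => hd _ (A3 t t0 t1).1) (fun t t0 t1 => hε _ (A3 t t0 t1).1 (A3 t t0 t1).2)
  have e1 : x + h • e + (y - x) = y + h • e := by abel
  rw [e1] at B2
  have hne := hn h h0 le_rfl
  have e2 : φ y - φ x = (φ (x + h • e) - φ x) + (φ (y + h • e) - φ (x + h • e))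
      - (φ (y + h • e) - φ y) := by abel
  rw [e2, mul_assoc, h3]
  calc _ ≤ ‖φ (x + h • e) - φ x‖ + ‖φ (y + h • e) - φ (x + h • e)‖ + ‖φ (y + h • e) - φ y‖ :=
        (_root_.norm_sub_le _ _).trans (by gcongr; exact norm_add_le _ _)
    _ ≤ ε * ‖h • e‖ + ε * ‖y - x‖ + ε * ‖h • e‖ := by gcongr
    _ ≤ ε * h + ε * h + ε * h := by gcongr
    _ = _ := by ring

end Cone

/-! ### Anti-Lipschitz maps and the integral of a composition -/

section Antilipschitz
variable {E : Type*} [NormedAddCommGroup E] [NormedSpace ℝ E] [FiniteDimensional ℝ E]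
  {X : Set E} {r κ : ℝ}

/-- The maps A with |det A| ≥ c and ‖A‖ ≤ B form a compact set of injective maps, so ‖A v‖ has a
positive minimum over this set and the unit sphere. -/
theorem exists_pos_mul_norm_le_of_det (c B : ℝ) (hc : 0 < c) : ∃ m : ℝ, 0 < m ∧
    ∀ A : E →L[ℝ] E, c ≤ |A.det| → ‖A‖ ≤ B → ∀ v, m * ‖v‖ ≤ ‖A v‖ := by
  have : ProperSpace (E →L[ℝ] E) := FiniteDimensional.proper ℝ _
  have : ProperSpace E := FiniteDimensional.proper ℝ _
  have hK : IsCompact (Metric.closedBall (0 : E →L[ℝ] E) B ∩ {A | c ≤ |A.det|}) :=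
    (isCompact_closedBall _ _).inter_right
      (isClosed_le continuous_const ContinuousLinearMap.continuous_det.abs)
  have hK' := hK.prod (isCompact_sphere (0 : E) 1)
  have hcont : Continuous (fun p : (E →L[ℝ] E) × E => ‖p.1 p.2‖) := by fun_prop
  obtain ⟨m, hm, H⟩ := hK'.exists_forall_le' hcont.continuousOn (a := 0) (by
    rintro ⟨A, v⟩ ⟨⟨_, hA⟩, hv⟩
    rw [norm_pos_iff]
    intro h0
    have hv1 : ‖v‖ = 1 := by simpa using hv
    have hdet : A.det ≠ 0 := by
      intro h; simp only [mem_ofPred_eq, h, abs_zero] at hA; linarith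
    have hinj : Function.Injective A := by
      have := (LinearMap.equivOfDetNeZero (A : E →ₗ[ℝ] E) hdet).injective
      exact this
    have : v = 0 := hinj (by rw [map_zero]; exact h0)
    simp [this] at hv1)
  refine ⟨m, hm, fun A hA hB v => ?_⟩
  by_cases hv : v = 0
  · simp [hv]
  have hv' : 0 < ‖v‖ := norm_pos_iff.2 hv
  have := H (A, ‖v‖⁻¹ • v) ⟨⟨by simpa using hB, hA⟩, by simp [norm_smul, hv'.ne']⟩
  simp only [map_smul, norm_smul, norm_inv, norm_norm] at this
  calc m * ‖v‖ ≤ (‖v‖⁻¹ * ‖A v‖) * ‖v‖ := by gcongr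
    _ = _ := by field_simp

/-- Near x the derivative of f - Df(x) is small by uniform continuity, so the mean value inequality
on X makes the increments of f differ little from those of Df(x), which are bounded below by the
preceding lemma. -/
theorem UniformCone.exists_antilipschitz (hX : UniformCone X r κ) {f : E → E}
    (hd : ∀ z ∈ X, DifferentiableAt ℝ f z) {c B : ℝ} (hc : 0 < c)
    (hdet : ∀ z ∈ X, c ≤ |(fderiv ℝ f z).det|) (hB : ∀ z ∈ X, ‖fderiv ℝ f z‖ ≤ B)
    (hu : UniformContinuousOn (fderiv ℝ f) X) :
    ∃ m r₁ : ℝ, 0 < m ∧ 0 < r₁ ∧ ∀ x ∈ X, ∀ y ∈ X, ‖y - x‖ < r₁ →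
      m * ‖y - x‖ ≤ ‖f y - f x‖ := by
  obtain ⟨m, hm, H⟩ := exists_pos_mul_norm_le_of_det (E := E) c B hc
  have hκ := hX.κ_pos
  have hr := hX.r_pos
  have hε : 0 < m * κ / 6 := by positivity
  obtain ⟨δ, hδ, hδ'⟩ := Metric.uniformContinuousOn_iff_le.1 hu _ hε
  -- The path of the mean value inequality reaches to distance (3/κ)‖y - x‖ from x, which κ/3 brings
  -- down to δ. The constant 3/κ also turns the oscillation m κ / 6 of Df into m/2.
  refine ⟨m / 2, min (κ * r) (κ / 3 * δ), by positivity, by positivity, fun x hx y hy hxy => ?_⟩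
  have h1 : ‖y - x‖ ≤ κ * r := (hxy.trans_le (min_le_left _ _)).le
  have h2 : ‖y - x‖ ≤ κ / 3 * δ := (hxy.trans_le (min_le_right _ _)).le
  have key := hX.norm_sub_le (φ := fun z => f z - fderiv ℝ f x z) (ε := m * κ / 6)
    (fun z hz => (hd z hz).sub (fderiv ℝ f x).differentiableAt) hx hy h1 (fun z hz hzx => by
      rw [fderiv_fun_sub (hd z hz) (fderiv ℝ f x).differentiableAt, ContinuousLinearMap.fderiv,
        ← dist_eq_norm]
      refine hδ' _ hz _ hx ?_
      rw [dist_eq_norm]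
      calc _ ≤ 3 / κ * (κ / 3 * δ) := hzx.trans (by gcongr)
        _ = δ := by field_simp)
  have h3 := H _ (hdet x hx) (hB x hx) (y - x)
  have e1 : f y - (fderiv ℝ f x) y - (f x - (fderiv ℝ f x) x) =
      (f y - f x) - (fderiv ℝ f x) (y - x) := by rw [map_sub]; abel
  simp only [e1] at key
  have e2 : m * κ / 6 * (3 / κ) = m / 2 := by field_simp; norm_num
  rw [e2] at key
  have := norm_sub_norm_le ((fderiv ℝ f x) (y - x)) (f y - f x)
  rw [norm_sub_rev ((fderiv ℝ f x) (y - x)) (f y - f x)] at this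
  linarith

variable [MeasurableSpace E] [BorelSpace E] (μ : Measure E) [μ.IsAddHaarMeasure]

/-- The Haar measure is a multiple of the Hausdorff measure of the same dimension, which a Lipschitz
map enlarges at most by a power of its constant. This is applied to the inverse of F, with constant
1/m, so neither a change of variables formula nor differentiability of F is needed. -/
theorem exists_measure_le_image_of_antilipschitz {m : ℝ} (hm : 0 < m) : ∃ K : ENNReal, K ≠ ⊤ ∧
    ∀ (F : E → E) (T : Set E), (∀ x ∈ T, ∀ y ∈ T, m * ‖y - x‖ ≤ ‖F y - F x‖) →
      μ T ≤ K * μ (F '' T) := by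
  set d := Module.finrank ℝ E
  have hH : (μH[(d : ℝ)] : Measure E).IsAddHaarMeasure := isAddHaarMeasure_hausdorffMeasure
  set c := μ.addHaarScalarFactor (μH[(d : ℝ)] : Measure E)
  have hμ : μ = c • (μH[(d : ℝ)] : Measure E) := Measure.isAddLeftInvariant_eq_smul _ _
  set M : NNReal := ⟨m⁻¹, by positivity⟩
  refine ⟨(M : ENNReal) ^ (d : ℝ), by simp, fun F T hT => ?_⟩
  have hinj : InjOn F T := by
    intro x hx y hy hxy
    have := hT x hx y hy
    rw [hxy, sub_self, norm_zero] at this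
    have h0 : ‖y - x‖ ≤ 0 := by
      by_contra h
      push Not at h
      have : 0 < m * ‖y - x‖ := by positivity
      linarith
    exact (sub_eq_zero.1 (norm_le_zero_iff.1 h0)).symm
  have hleft : LeftInvOn (Function.invFunOn F T) F T := hinj.leftInvOn_invFunOn
  have hlip : LipschitzOnWith M (Function.invFunOn F T) (F '' T) := by
    refine LipschitzOnWith.of_dist_le_mul ?_
    rintro _ ⟨x, hx, rfl⟩ _ ⟨y, hy, rfl⟩
    rw [hleft hx, hleft hy, dist_eq_norm, dist_eq_norm]
    change _ ≤ m⁻¹ * _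
    rw [inv_mul_eq_div, le_div_iff₀ hm, mul_comm]
    exact hT y hy x hx
  have h1 := hlip.hausdorffMeasure_image_le (d := d) (by positivity)
  rw [hleft.image_image] at h1
  rw [hμ, Measure.smul_apply, Measure.smul_apply]
  calc c • μH[(d : ℝ)] T ≤ c • ((M : ENNReal) ^ (d : ℝ) * μH[(d : ℝ)] (F '' T)) := by gcongr
    _ = _ := by rw [ENNReal.smul_def, ENNReal.smul_def, smul_eq_mul, smul_eq_mul]; ring

/-- Composition with maps `F` on subsets `A ⊆ X`, which satisfy an anti-Lipschitz condition at
scale `r₁`, increases integrals at most by the factor `K`. -/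
def CompBound {E : Type*} [NormedAddCommGroup E] [MeasurableSpace E] (μ : Measure E) (X : Set E)
    (m r₁ : ℝ) (K : ENNReal) : Prop :=
  ∀ (F : E → E) (A : Set E), A ⊆ X → MeasurableSet A → ContinuousOn F A →
    (∀ x ∈ A, ∀ y ∈ A, ‖y - x‖ < r₁ → m * ‖y - x‖ ≤ ‖F y - F x‖) →
    ∀ U : E → ENNReal, Measurable U → ∫⁻ x in A, U (F x) ∂μ ≤ K * ∫⁻ x, U x ∂μ

/-- In balls of radius r₁/2 any two points are closer than r₁, so there the anti-Lipschitz condition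
is global and the preceding lemma applies. The constant is the number of balls needed to cover X
times the constant for one ball, hence the same for all maps F and all subsets A. -/
theorem exists_compBound (hX : Bornology.IsBounded X) {m r₁ : ℝ} (hm : 0 < m)
    (hr₁ : 0 < r₁) : ∃ K : ENNReal, K ≠ ⊤ ∧ CompBound μ X m r₁ K := by
  obtain ⟨K, hK, H⟩ := exists_measure_le_image_of_antilipschitz μ hm
  have htb : TotallyBounded X := by
    have : ProperSpace E := FiniteDimensional.proper ℝ _
    exact (hX.isCompact_closure.totallyBounded).subset subset_closure
  obtain ⟨t, -, ht, htX⟩ := Metric.finite_approx_of_totallyBounded htb (r₁ / 2) (by positivity)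
  lift t to Finset E using ht
  refine ⟨t.card * K, ENNReal.mul_ne_top (by simp) hK, fun F A hAX hA hF hanti U hU => ?_⟩
  have hFm : AEMeasurable F (μ.restrict A) := hF.aemeasurable hA
  have hle : (μ.restrict A).map F ≤ (t.card * K) • μ := by
    refine Measure.le_iff.2 fun S hS => ?_
    rw [Measure.map_apply_of_aemeasurable hFm hS, Measure.restrict_apply' hA, Measure.smul_apply]
    have hsub : F ⁻¹' S ∩ A ⊆ ⋃ p ∈ t, (F ⁻¹' S ∩ A ∩ Metric.ball p (r₁ / 2)) := by
      intro x hx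
      obtain ⟨p, hp, hxp⟩ := mem_iUnion₂.1 (htX (hAX hx.2))
      exact mem_iUnion₂.2 ⟨p, hp, hx, hxp⟩
    calc μ (F ⁻¹' S ∩ A) ≤ ∑ p ∈ t, μ (F ⁻¹' S ∩ A ∩ Metric.ball p (r₁ / 2)) :=
          (measure_mono hsub).trans (measure_biUnion_finset_le _ _)
      _ ≤ ∑ p ∈ t, K * μ S := by
          refine Finset.sum_le_sum fun p _ => (H F _ ?_).trans ?_
          · rintro x ⟨⟨-, hx⟩, hxp⟩ y ⟨⟨-, hy⟩, hyp⟩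
            refine hanti x hx y hy ?_
            rw [← dist_eq_norm]
            rw [Metric.mem_ball] at hxp hyp
            have := dist_triangle_right y x p
            linarith
          · gcongr
            rintro _ ⟨x, ⟨⟨hx, -⟩, -⟩, rfl⟩
            exact hx
      _ = _ := by rw [Finset.sum_const, nsmul_eq_mul, smul_eq_mul, mul_assoc]
  calc ∫⁻ x in A, U (F x) ∂μ = ∫⁻ y, U y ∂((μ.restrict A).map F) :=
        (lintegral_map' hU.aemeasurable hFm).symm
    _ ≤ ∫⁻ y, U y ∂((t.card * K) • μ) := lintegral_mono' hle le_rfl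
    _ = _ := by rw [lintegral_smul_measure, smul_eq_mul]

end Antilipschitz

/-! ### Pointwise bounds for derivatives of compositions -/

section Composition
universe u
variable {E : Type} [NormedAddCommGroup E] [NormedSpace ℝ E]

theorem norm_iteratedFDeriv_comp_le_of_isOpen {V : Type*} [NormedAddCommGroup V] [NormedSpace ℝ V]
    {X : Set E} (hX : IsOpen X) {k : ℕ} {f : E → E} (hf : ContDiffOn ℝ k f X) {G : E → V}
    (hG : ContDiff ℝ ∞ G) {x : E} (hx : x ∈ X) {C B : ℝ} (hB : 1 ≤ B)
    (hGC : ∀ m ≤ k, ‖iteratedFDeriv ℝ m G (f x)‖ ≤ C)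
    (hfB : ∀ i, 1 ≤ i → i ≤ k → ‖iteratedFDeriv ℝ i f x‖ ≤ B) :
    ‖iteratedFDeriv ℝ k (fun y => G (f y)) x‖ ≤ k.factorial * C * B ^ k := by
  have h := norm_iteratedFDerivWithin_comp_le (g := G) (f := f) (n := k) (s := X) (t := univ)
    (x := x) (N := k) (hG.of_le (by exact_mod_cast le_top)).contDiffOn hf le_rfl uniqueDiffOn_univ
    hX.uniqueDiffOn (mapsTo_univ _ _) hx (C := C) (D := B)
    (fun i hi => by rw [iteratedFDerivWithin_univ]; exact hGC i hi)
    (fun i h1 hi => by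
      rw [iteratedFDerivWithin_of_isOpen i hX hx]
      exact (hfB i h1 hi).trans (le_self_pow₀ hB (by omega)))
  rwa [iteratedFDerivWithin_of_isOpen k hX hx] at h

theorem norm_iteratedFDeriv_bilinear_le_of_isOpen {V W Z : Type*} [NormedAddCommGroup V]
    [NormedSpace ℝ V] [NormedAddCommGroup W] [NormedSpace ℝ W] [NormedAddCommGroup Z]
    [NormedSpace ℝ Z] (B : V →L[ℝ] W →L[ℝ] Z) (hB : ‖B‖ ≤ 1)
    {X : Set E} (hX : IsOpen X) {k : ℕ} {f : E → V} {g : E → W} (hf : ContDiffOn ℝ k f X)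
    (hg : ContDiffOn ℝ k g X) {x : E} (hx : x ∈ X) {T : ℝ}
    (hT : ∀ i ≤ k, ‖iteratedFDeriv ℝ i f x‖ * ‖iteratedFDeriv ℝ (k - i) g x‖ ≤ T) :
    ‖iteratedFDeriv ℝ k (fun y => B (f y) (g y)) x‖ ≤ 2 ^ k * T := by
  have hT0 : 0 ≤ T := le_trans (by positivity) (hT 0 (Nat.zero_le _))
  have h := B.norm_iteratedFDerivWithin_le_of_bilinear hf hg hX.uniqueDiffOn hx (n := k) le_rfl
  rw [iteratedFDerivWithin_of_isOpen k hX hx] at h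
  refine h.trans ?_
  have h2 : ∑ i ∈ Finset.range (k + 1), (k.choose i : ℝ) * ‖iteratedFDerivWithin ℝ i f X x‖ *
      ‖iteratedFDerivWithin ℝ (k - i) g X x‖ ≤ ∑ i ∈ Finset.range (k + 1), (k.choose i : ℝ) * T := by
    refine Finset.sum_le_sum fun i hi => ?_
    rw [iteratedFDerivWithin_of_isOpen _ hX hx, iteratedFDerivWithin_of_isOpen _ hX hx, mul_assoc]
    gcongr
    exact hT i (Nat.lt_succ_iff.1 (Finset.mem_range.1 hi))
  have h3 : ∑ i ∈ Finset.range (k + 1), (k.choose i : ℝ) * T = 2 ^ k * T := by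
    rw [← Finset.sum_mul]
    congr 1
    exact_mod_cast Nat.sum_range_choose k
  rw [h3] at h2
  calc _ ≤ 1 * (2 ^ k * T) := by gcongr
    _ = _ := one_mul _

theorem norm_iteratedFDeriv_fderiv_sub {V : Type*} [NormedAddCommGroup V] [NormedSpace ℝ V]
    (m : ℕ) (G : E → V) (y z : E) :
    ‖iteratedFDeriv ℝ m (fderiv ℝ G) y - iteratedFDeriv ℝ m (fderiv ℝ G) z‖ =
      ‖iteratedFDeriv ℝ (m + 1) G y - iteratedFDeriv ℝ (m + 1) G z‖ := by
  rw [iteratedFDeriv_succ_eq_comp_right, iteratedFDeriv_succ_eq_comp_right]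
  simp only [Function.comp_apply, ← dist_eq_norm]
  exact (LinearIsometryEquiv.dist_map _ _ _).symm

set_option maxSynthPendingDepth 3 in
/-- A pointwise bound for the derivatives of `G ∘ f' - G ∘ f`: they are controlled by
the increments of the derivatives of `G`, and by products of derivatives of `G` of order `m ≥ 1`
and of derivatives of `f' - f` of order `j ≤ k + 1 - m`. -/
theorem exists_norm_iteratedFDeriv_comp_sub_comp_le (k : ℕ) {B : ℝ} (hB : 1 ≤ B) :
    ∃ C : ℝ, 0 ≤ C ∧ ∀ {V : Type u} [NormedAddCommGroup V] [NormedSpace ℝ V] {G : E → V},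
      ContDiff ℝ ∞ G → ∀ {X : Set E}, IsOpen X → ∀ {f f' : E → E}, ContDiffOn ℝ k f X →
      ContDiffOn ℝ k f' X → ∀ {x : E}, x ∈ X →
      (∀ i, 1 ≤ i → i ≤ k → ‖iteratedFDeriv ℝ i f x‖ ≤ B) →
      (∀ i, 1 ≤ i → i ≤ k → ‖iteratedFDeriv ℝ i f' x‖ ≤ B) → ∀ {T : ℝ},
      (∀ m ≤ k, ‖iteratedFDeriv ℝ m G (f' x) - iteratedFDeriv ℝ m G (f x)‖ ≤ T) →
      (∀ m j, 1 ≤ m → m ≤ k → j ≤ k → m + j ≤ k + 1 →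
        ‖iteratedFDeriv ℝ m G (f' x)‖ * ‖iteratedFDeriv ℝ j (fun y => f' y - f y) x‖ ≤ T) →
      ‖iteratedFDeriv ℝ k (fun y => G (f' y) - G (f y)) x‖ ≤ C * T := by
  -- The induction passes from G to DG, so the target V must vary; with E in `Type` the space of
  -- continuous linear maps from E to V stays in the universe of V.
  induction k using Nat.strong_induction_on with
  | _ k ih =>
  rcases k with _ | k
  · refine ⟨1, zero_le_one, fun {V} _ _ {G} hG {X} hX {f f'} hf hf' {x} hx h1 h2 {T} h3 h4 => ?_⟩
    have := h3 0 le_rfl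
    rw [norm_iteratedFDeriv_zero, one_mul]
    refine le_trans (le_of_eq ?_) this
    rw [iteratedFDeriv_zero_eq_comp]
    simp only [Function.comp_apply]
    rw [← map_sub, LinearIsometryEquiv.norm_map]
  · choose! c hc0 hc using ih
    set D : ℝ := ∑ i ∈ Finset.range (k + 1), (c i + i.factorial * B ^ i) with hD
    have hDi : ∀ i ≤ k, c i + i.factorial * B ^ i ≤ D := fun i hi => by
      refine Finset.single_le_sum (f := fun i => c i + i.factorial * B ^ i) (fun i hi' => ?_)
        (Finset.mem_range.2 (Nat.lt_succ_iff.2 hi))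
      have := hc0 i (Finset.mem_range.1 hi')
      positivity
    have hD0 : 0 ≤ D := le_trans (by have := hc0 0 (by omega); positivity) (hDi 0 (by omega))
    refine ⟨2 ^ k * (D * B) + 2 ^ k * D, by positivity,
      fun {V} _ _ {G} hG {X} hX {f f'} hf hf' {x} hx h1 h2 {T} h3 h4 => ?_⟩
    have hT0 : 0 ≤ T := (norm_nonneg _).trans (h3 0 (Nat.zero_le _))
    have hone : (1 : WithTop ℕ∞) ≤ ((k + 1 : ℕ) : WithTop ℕ∞) := by
      exact_mod_cast Nat.le_add_left 1 k
    have hkk : ((k : ℕ) : WithTop ℕ∞) ≤ ((k + 1 : ℕ) : WithTop ℕ∞) := by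
      exact_mod_cast Nat.le_succ k
    have hfd : ∀ y ∈ X, DifferentiableAt ℝ f y := fun y hy =>
      ((hf.differentiableOn (by simp)) y hy).differentiableAt (hX.mem_nhds hy)
    have hfd' : ∀ y ∈ X, DifferentiableAt ℝ f' y := fun y hy =>
      ((hf'.differentiableOn (by simp)) y hy).differentiableAt (hX.mem_nhds hy)
    have hGd : Differentiable ℝ G := hG.differentiable (by simp)
    have hDG : ContDiff ℝ ∞ (fderiv ℝ G) := hG.fderiv_right (by simp)
    have hDGk : ContDiff ℝ k (fderiv ℝ G) := hDG.of_le (by exact_mod_cast le_top)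
    have hDf : ContDiffOn ℝ k (fderiv ℝ f) X := hf.fderiv_of_isOpen hX (by simp)
    have hDft : ContDiffOn ℝ k (fderiv ℝ (fun y => f' y - f y)) X :=
      (hf'.sub hf).fderiv_of_isOpen hX (by simp)
    have hfk := hf.of_le hkk
    have hfk' := hf'.of_le hkk
    have hE1 : ContDiffOn ℝ k (fun y => fderiv ℝ G (f' y)) X := hDGk.comp_contDiffOn hfk'
    have hE2 : ContDiffOn ℝ k (fun y => fderiv ℝ G (f y)) X := hDGk.comp_contDiffOn hfk
    let L := ContinuousLinearMap.compL ℝ E E V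
    have hL : ‖L‖ ≤ 1 := ContinuousLinearMap.norm_compL_le ℝ E E V
    -- The difference of the chain rules is split as (DG∘f' - DG∘f) · Df + DG∘f' · D(f' - f). The
    -- induction hypothesis for DG takes care of the first term, and the Leibniz rule with the bound
    -- for one composition takes care of the second.
    have hfder : fderiv ℝ (fun y => G (f' y) - G (f y)) =ᶠ[nhds x] fun y =>
        L (fderiv ℝ G (f' y) - fderiv ℝ G (f y)) (fderiv ℝ f y) +
        L (fderiv ℝ G (f' y)) (fderiv ℝ (fun z => f' z - f z) y) := by
      filter_upwards [hX.mem_nhds hx] with y hy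
      have e1 : HasFDerivAt (fun y => G (f' y)) ((fderiv ℝ G (f' y)).comp (fderiv ℝ f' y)) y :=
        (hGd _).hasFDerivAt.comp y (hfd' y hy).hasFDerivAt
      have e2 : HasFDerivAt (fun y => G (f y)) ((fderiv ℝ G (f y)).comp (fderiv ℝ f y)) y :=
        (hGd _).hasFDerivAt.comp y (hfd y hy).hasFDerivAt
      rw [(e1.fun_sub e2).fderiv, fderiv_fun_sub (hfd' y hy) (hfd y hy)]
      simp only [L, ContinuousLinearMap.compL_apply, ContinuousLinearMap.sub_comp,
        ContinuousLinearMap.comp_sub]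
      abel
    rw [← norm_iteratedFDeriv_fderiv, (hfder.iteratedFDeriv ℝ k).eq_of_nhds]
    have hA : ContDiffOn ℝ k
        (fun y => L (fderiv ℝ G (f' y) - fderiv ℝ G (f y)) (fderiv ℝ f y)) X :=
      L.isBoundedBilinearMap.contDiff.comp_contDiffOn ((hE1.sub hE2).prodMk hDf)
    have hA' : ContDiffOn ℝ k
        (fun y => L (fderiv ℝ G (f' y)) (fderiv ℝ (fun z => f' z - f z) y)) X :=
      L.isBoundedBilinearMap.contDiff.comp_contDiffOn (hE1.prodMk hDft)
    have hadd := iteratedFDeriv_add_apply (hA.contDiffAt (hX.mem_nhds hx))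
      (hA'.contDiffAt (hX.mem_nhds hx))
    refine (congrArg norm hadd).le.trans ?_
    rw [add_mul]
    refine (norm_add_le _ _).trans (add_le_add ?_ ?_)
    · rw [mul_assoc]
      refine norm_iteratedFDeriv_bilinear_le_of_isOpen L hL hX (hE1.sub hE2) hDf hx fun i hi => ?_
      have hik : ((i : ℕ) : WithTop ℕ∞) ≤ ((k + 1 : ℕ) : WithTop ℕ∞) := by
        exact_mod_cast (by omega : i ≤ k + 1)
      have b1 := hc i (by omega) hDG hX (hf.of_le hik) (hf'.of_le hik) hx
        (fun a ha ha' => h1 a ha (by omega)) (fun a ha ha' => h2 a ha (by omega)) (T := T)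
        (fun m hm => by rw [norm_iteratedFDeriv_fderiv_sub]; exact h3 _ (by omega))
        (fun m j hm hm' hj hmj => by
          rw [norm_iteratedFDeriv_fderiv]; exact h4 _ _ (by omega) (by omega) (by omega) (by omega))
      have b2 : ‖iteratedFDeriv ℝ (k - i) (fderiv ℝ f) x‖ ≤ B := by
        rw [norm_iteratedFDeriv_fderiv]; exact h1 _ (by omega) (by omega)
      have b3 : c i ≤ D := le_trans (by simp; positivity) (hDi i hi)
      have b4 := hc0 i (by omega)
      calc _ ≤ (c i * T) * B := by gcongr
        _ ≤ (D * T) * B := by gcongr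
        _ = _ := by ring
    · rw [mul_assoc]
      refine norm_iteratedFDeriv_bilinear_le_of_isOpen L hL hX hE1 hDft hx fun i hi => ?_
      rw [norm_iteratedFDeriv_fderiv]
      have b3 : i.factorial * B ^ i ≤ D :=
        le_trans (by have := hc0 i (by omega); linarith) (hDi i hi)
      -- The hypothesis bounds only the products with q, the norm of a derivative of f' - f. If q =
      -- 0 the term vanishes; otherwise T / q bounds the derivatives of G alone, and the factor q is
      -- restored at the end.
      rcases (norm_nonneg (iteratedFDeriv ℝ (k - i + 1) (fun y => f' y - f y) x)).eq_or_lt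
        with hq | hq
      · rw [← hq, mul_zero]; positivity
      set q := ‖iteratedFDeriv ℝ (k - i + 1) (fun y => f' y - f y) x‖ with hqd
      have b1 := norm_iteratedFDeriv_comp_le_of_isOpen hX
        (hf'.of_le (m := (i : ℕ)) (by exact_mod_cast (by omega : i ≤ k + 1))) hDG hx hB
        (C := T / q) (fun m hm => by
          rw [norm_iteratedFDeriv_fderiv, le_div_iff₀ hq]
          exact h4 _ _ (by omega) (by omega) (by omega) (by omega))
        (fun a ha ha' => h2 a ha (by omega))
      calc _ ≤ (i.factorial * (T / q) * B ^ i) * q := by gcongr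
        _ = (i.factorial * B ^ i) * T := by field_simp
        _ ≤ D * T := by gcongr

end Composition

/-! ### Differences of compositions in quadratic mean -/

theorem sq_lintegral_mul_le {α : Type*} [MeasurableSpace α] (μ : Measure α) {f g : α → ENNReal}
    (hf : AEMeasurable f μ) (hg : AEMeasurable g μ) :
    (∫⁻ x, f x * g x ∂μ) ^ 2 ≤ (∫⁻ x, f x ^ 2 ∂μ) * ∫⁻ x, g x ^ 2 ∂μ := by
  have h := ENNReal.lintegral_mul_le_Lp_mul_Lq μ Real.HolderConjugate.two_two hf hg
  have h2 := ENNReal.pow_le_pow_left (n := 2) h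
  refine h2.trans (le_of_eq ?_)
  rw [mul_pow, ← ENNReal.rpow_natCast, ← ENNReal.rpow_natCast, ← ENNReal.rpow_mul,
    ← ENNReal.rpow_mul]
  norm_num

theorem ennreal_add_sq_le {a b : ENNReal} : (a + b) ^ 2 ≤ 2 * (a ^ 2 + b ^ 2) := by
  have h := ENNReal.rpow_add_le_mul_rpow_add_rpow a b (p := 2) (by norm_num)
  norm_num at h
  exact h

theorem lintegral_biUnion_finset_le {α ι : Type*} [MeasurableSpace α] (μ : Measure α)
    (t : Finset ι) (A : ι → Set α) (f : α → ENNReal) :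
    ∫⁻ x in ⋃ p ∈ t, A p, f x ∂μ ≤ ∑ p ∈ t, ∫⁻ x in A p, f x ∂μ := by
  classical
  induction t using Finset.induction_on with
  | empty => simp
  | insert p t hp ih =>
    rw [Finset.set_biUnion_insert, Finset.sum_insert hp]
    exact (lintegral_union_le _ _ _).trans (by gcongr)

section Path
variable {E : Type*} [NormedAddCommGroup E] [NormedSpace ℝ E] [FiniteDimensional ℝ E]
  [MeasurableSpace E] [BorelSpace E] (μ : Measure E) [μ.IsAddHaarMeasure]
  {V : Type*} [NormedAddCommGroup V] [NormedSpace ℝ V] [CompleteSpace V]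

omit [FiniteDimensional ℝ E] [MeasurableSpace E] [BorelSpace E] in
theorem enorm_sub_sq_le_lintegral_segment {G : E → V} (hG : ContDiff ℝ 1 G) (a b : E) :
    ‖G (a + b) - G a‖ₑ ^ 2 ≤ ‖b‖ₑ ^ 2 * ∫⁻ t in Icc (0 : ℝ) 1, ‖fderiv ℝ G (a + t • b)‖ₑ ^ 2 := by
  have hDG : Continuous (fderiv ℝ G) := hG.continuous_fderiv (by simp)
  have hc : Continuous fun t : ℝ => fderiv ℝ G (a + t • b) := by fun_prop
  have hcb : Continuous fun t : ℝ => fderiv ℝ G (a + t • b) b := by fun_prop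
  have h1 : ∫ t in (0 : ℝ)..1, fderiv ℝ G (a + t • b) b = G (a + b) - G a := by
    have := intervalIntegral.integral_eq_sub_of_hasDerivAt (f := fun t : ℝ => G (a + t • b))
      (f' := fun t => fderiv ℝ G (a + t • b) b) (a := 0) (b := 1) (fun t _ => by
        have h1 : HasDerivAt (fun t : ℝ => a + t • b) b t := by
          simpa using ((hasDerivAt_id t).smul_const b).const_add a
        exact ((hG.differentiable (by simp)) _).hasFDerivAt.comp_hasDerivAt t h1)
      (hcb.intervalIntegrable _ _)
    simpa using this
  rw [← h1, intervalIntegral.integral_of_le zero_le_one]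
  have h2 : ‖∫ t in Ioc (0 : ℝ) 1, fderiv ℝ G (a + t • b) b‖ₑ ≤
      ‖b‖ₑ * ∫⁻ t in Icc (0 : ℝ) 1, ‖fderiv ℝ G (a + t • b)‖ₑ * 1 := by
    refine (enorm_integral_le_lintegral_enorm _).trans ?_
    simp only [mul_one]
    rw [← lintegral_const_mul' _ _ enorm_ne_top]
    refine (lintegral_mono_set Ioc_subset_Icc_self).trans (lintegral_mono fun t => ?_)
    rw [mul_comm]
    exact ContinuousLinearMap.le_opENorm _ _
  refine (ENNReal.pow_le_pow_left h2).trans ?_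
  rw [mul_pow]
  gcongr
  refine (sq_lintegral_mul_le _ (hc.enorm.measurable.aemeasurable) aemeasurable_const).trans ?_
  simp

/-- After the integrals over x and t are exchanged, each fixed t leaves a composition with the
single map x ↦ a x + t b x, which is anti-Lipschitz uniformly in t. As its values lie in K', only DG
on K' contributes. -/
theorem lintegral_enorm_segment_sub_sq_le {X K' A : Set E} {m r₁ : ℝ} {K : ENNReal}
    (hcov : CompBound μ X m r₁ K)
    (hA : MeasurableSet A) (hAX : A ⊆ X) (hK' : MeasurableSet K') {a b : E → E}
    (ha : ContinuousOn a A) (hb : ContinuousOn b A) {H : ℝ} (hbH : ∀ x ∈ A, ‖b x‖ ≤ H)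
    (hmem : ∀ t : ℝ, 0 ≤ t → t ≤ 1 → ∀ x ∈ A, a x + t • b x ∈ K')
    (hanti : ∀ t : ℝ, 0 ≤ t → t ≤ 1 → ∀ x ∈ A, ∀ y ∈ A, ‖y - x‖ < r₁ →
      m * ‖y - x‖ ≤ ‖(a y + t • b y) - (a x + t • b x)‖) {G : E → V} (hG : ContDiff ℝ 1 G) :
    ∫⁻ x in A, ‖G (a x + b x) - G (a x)‖ₑ ^ 2 ∂μ ≤
      ENNReal.ofReal H ^ 2 * (K * ∫⁻ y in K', ‖fderiv ℝ G y‖ₑ ^ 2 ∂μ) := by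
  have hDG : Continuous (fderiv ℝ G) := hG.continuous_fderiv (by simp)
  have h1 : ∫⁻ x in A, ‖G (a x + b x) - G (a x)‖ₑ ^ 2 ∂μ ≤
      ∫⁻ x in A, (ENNReal.ofReal H ^ 2 *
        ∫⁻ t in Icc (0 : ℝ) 1, ‖fderiv ℝ G (a x + t • b x)‖ₑ ^ 2) ∂μ := by
    refine setLIntegral_mono' hA fun x hx => ?_
    refine (enorm_sub_sq_le_lintegral_segment hG _ _).trans ?_
    gcongr
    rw [← ofReal_norm]
    exact ENNReal.ofReal_le_ofReal (hbH x hx)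
  refine h1.trans ?_
  rw [lintegral_const_mul' _ _ (by simp)]
  gcongr
  have hcont : ContinuousOn (fun p : E × ℝ => ‖fderiv ℝ G (a p.1 + p.2 • b p.1)‖ₑ ^ 2)
      (A ×ˢ Icc (0 : ℝ) 1) := by
    have ha' : ContinuousOn (fun p : E × ℝ => a p.1) (A ×ˢ Icc (0 : ℝ) 1) :=
      ha.comp continuousOn_fst fun p hp => hp.1
    have hb' : ContinuousOn (fun p : E × ℝ => b p.1) (A ×ˢ Icc (0 : ℝ) 1) :=
      hb.comp continuousOn_fst fun p hp => hp.1
    have := hDG.comp_continuousOn (ha'.add (continuousOn_snd.smul hb'))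
    exact (ENNReal.continuous_pow 2).comp_continuousOn this.enorm
  rw [lintegral_lintegral_swap (by
    rw [Measure.prod_restrict]
    exact hcont.aemeasurable (hA.prod measurableSet_Icc))]
  have h2 : ∀ t ∈ Icc (0 : ℝ) 1, ∫⁻ x in A, ‖fderiv ℝ G (a x + t • b x)‖ₑ ^ 2 ∂μ ≤
      K * ∫⁻ y in K', ‖fderiv ℝ G y‖ₑ ^ 2 ∂μ := by
    intro t ht
    have hU : Measurable (K'.indicator fun y => ‖fderiv ℝ G y‖ₑ ^ 2) :=
      Measurable.indicator (by fun_prop) hK'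
    have h3 := hcov (fun x => a x + t • b x) A hAX hA (ha.add (continuousOn_const.smul hb)) (hanti t ht.1 ht.2) _ hU
    rw [lintegral_indicator hK'] at h3
    refine le_trans (le_of_eq ?_) h3
    refine setLIntegral_congr_fun hA fun x hx => ?_
    rw [indicator_of_mem (hmem t ht.1 ht.2 x hx)]
  calc _ ≤ ∫⁻ t in Icc (0 : ℝ) 1, (K * ∫⁻ y in K', ‖fderiv ℝ G y‖ₑ ^ 2 ∂μ) :=
        setLIntegral_mono' measurableSet_Icc h2
    _ = _ := by simp


omit [CompleteSpace V] in
-- The straight segment from f(x) to f'(x) may leave X, so G is followed along a detour through a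
-- cone, in three segments. The compact set K' consists of the points met on the way and does not
-- depend on G.
theorem UniformCone.exists_lintegral_comp_sub_comp_le {X : Set E} {r κ : ℝ}
    (hX : UniformCone X r κ) (hXb : Bornology.IsBounded X) {m r₁ : ℝ} (hm : 0 < m)
    (hr₁ : 0 < r₁) : ∃ C : ENNReal, C ≠ ⊤ ∧ ∀ f f' : E → E, ContinuousOn f X → ContinuousOn f' X →
      MapsTo f X X → MapsTo f' X X →
      (∀ x ∈ X, ∀ y ∈ X, ‖y - x‖ < r₁ → m * ‖y - x‖ ≤ ‖f y - f x‖) →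
      (∀ x ∈ X, ∀ y ∈ X, ‖y - x‖ < r₁ →
        ‖(f' y - f y) - (f' x - f x)‖ ≤ m / 2 * ‖y - x‖) →
      ∀ H : ℝ, H ≤ κ * r / 2 → (∀ x ∈ X, ‖f' x - f x‖ ≤ H) →
      ∀ K ⊆ X, IsCompact K → ∃ K' ⊆ X, IsCompact K' ∧
      ∀ {V : Type*} [NormedAddCommGroup V] [NormedSpace ℝ V] [CompleteSpace V] {G : E → V},
        ContDiff ℝ 1 G → ∫⁻ x in K, ‖G (f' x) - G (f x)‖ₑ ^ 2 ∂μ ≤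
          C * ENNReal.ofReal H ^ 2 * ∫⁻ y in K', ‖fderiv ℝ G y‖ₑ ^ 2 ∂μ := by
  have hκ := hX.κ_pos
  have hκ1 := hX.κ_le
  have hr := hX.r_pos
  obtain ⟨N, hN, hcov⟩ := exists_compBound μ hXb (half_pos hm) hr₁
  have htb : TotallyBounded X := by
    have : ProperSpace E := FiniteDimensional.proper ℝ _
    exact (hXb.isCompact_closure.totallyBounded).subset subset_closure
  -- The axis of the cone is chosen at the points of a finite net only. Where f(x) lies near a fixed
  -- p the detour uses a constant vector, and the moves into and out of the cone are translations of
  -- f and f', which preserve the anti-Lipschitz condition.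
  obtain ⟨t, htX, ht, htc⟩ := Metric.finite_approx_of_totallyBounded htb r hr
  lift t to Finset E using ht
  refine ⟨t.card * (4 * (3 * (ENNReal.ofReal (1 / κ) ^ 2 * N))), ?_, ?_⟩
  · refine ENNReal.mul_ne_top (by simp) (ENNReal.mul_ne_top (by simp) (ENNReal.mul_ne_top (by simp)
      (ENNReal.mul_ne_top (by simp) hN)))
  intro f f' hf hf' hfX hfX' hanti hclose H hH hfH K hKX hK
  rcases K.eq_empty_or_nonempty with rfl | ⟨x₀, hx₀⟩
  · exact ⟨∅, empty_subset _, isCompact_empty, by simp⟩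
  have hH0 : 0 ≤ H := (norm_nonneg _).trans (hfH x₀ (hKX hx₀))
  choose! e he hcone using hX.cone
  set h : ℝ := H / κ with hh
  have hh0 : 0 ≤ h := by positivity
  have hκh : κ * h = H := by rw [hh]; field_simp
  have hHh : H ≤ h := by rw [hh, le_div_iff₀ hκ]; nlinarith
  have hhr : h ≤ r := by rw [hh, div_le_iff₀ hκ]; nlinarith
  have hHr : H ≤ r / 2 := by nlinarith
  let A : E → Set E := fun p => K ∩ f ⁻¹' Metric.closedBall p r
  have hAc : ∀ p, IsCompact (A p) := fun p => hK.of_isClosed_subset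
    ((hf.mono hKX).preimage_isClosed_of_isClosed hK.isClosed Metric.isClosed_closedBall)
    inter_subset_left
  have hAX : ∀ p, A p ⊆ X := fun p => inter_subset_left.trans hKX
  have hAcov : K ⊆ ⋃ p ∈ t, A p := by
    intro x hx
    obtain ⟨p, hp, hxp⟩ := mem_iUnion₂.1 (htc (hfX (hKX hx)))
    exact mem_iUnion₂.2 ⟨p, hp, hx, Metric.ball_subset_closedBall hxp⟩
  let γ₁ : E → ℝ × E → E := fun p z => f z.2 + z.1 • h • e p
  let γ₂ : E → ℝ × E → E := fun p z => (f z.2 + h • e p) + z.1 • (f' z.2 - f z.2)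
  let γ₃ : E → ℝ × E → E := fun p z => f' z.2 + z.1 • h • e p
  let Q : E → Set (ℝ × E) := fun p => Icc (0 : ℝ) 1 ×ˢ A p
  have hQc : ∀ p, IsCompact (Q p) := fun p => isCompact_Icc.prod (hAc p)
  have hfQ : ∀ p, ContinuousOn (fun z : ℝ × E => f z.2) (Q p) := fun p =>
    (hf.mono (hAX p)).comp continuousOn_snd fun z hz => hz.2
  have hfQ' : ∀ p, ContinuousOn (fun z : ℝ × E => f' z.2) (Q p) := fun p =>
    (hf'.mono (hAX p)).comp continuousOn_snd fun z hz => hz.2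
  have hγ₁ : ∀ p, IsCompact (γ₁ p '' Q p) := fun p => (hQc p).image_of_continuousOn
    ((hfQ p).add (continuousOn_fst.smul continuousOn_const))
  have hγ₂ : ∀ p, IsCompact (γ₂ p '' Q p) := fun p => (hQc p).image_of_continuousOn
    (((hfQ p).add continuousOn_const).add (continuousOn_fst.smul ((hfQ' p).sub (hfQ p))))
  have hγ₃ : ∀ p, IsCompact (γ₃ p '' Q p) := fun p => (hQc p).image_of_continuousOn
    ((hfQ' p).add (continuousOn_fst.smul continuousOn_const))
  let K' : Set E := ⋃ p ∈ t, (γ₁ p '' Q p ∪ γ₂ p '' Q p ∪ γ₃ p '' Q p)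
  have hK' : IsCompact K' := t.isCompact_biUnion fun p _ => ((hγ₁ p).union (hγ₂ p)).union (hγ₃ p)
  have hfp : ∀ p, ∀ x ∈ A p, ‖f x - p‖ ≤ r := fun p x hx => mem_closedBall_iff_norm.1 hx.2
  have hfp' : ∀ p, ∀ x ∈ A p, ‖f' x - p‖ < 2 * r := fun p x hx => by
    have e1 : f' x - p = (f' x - f x) + (f x - p) := by abel
    rw [e1]
    have := hfH x (hAX p hx)
    exact (norm_add_le _ _).trans_lt (by linarith [hfp p x hx])
  have hK'X : K' ⊆ X := by
    refine iUnion₂_subset fun p hp => ?_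
    have hpX := htX hp
    refine union_subset (union_subset ?_ ?_) ?_
    · rintro _ ⟨⟨τ, x⟩, ⟨hτ, hx⟩, rfl⟩
      have := hcone p hpX (f x) (hfX (hAX p hx)) (by linarith [hfp p x hx]) (τ * h)
        (mul_nonneg hτ.1 hh0) ((mul_le_of_le_one_left hh0 hτ.2).trans hhr) 0
        (by rw [norm_zero]; exact mul_nonneg hκ.le (mul_nonneg hτ.1 hh0))
      rwa [add_zero, mul_smul] at this
    · rintro _ ⟨⟨τ, x⟩, ⟨hτ, hx⟩, rfl⟩
      refine hcone p hpX (f x) (hfX (hAX p hx)) (by linarith [hfp p x hx]) h hh0 hhr _ ?_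
      rw [hκh, norm_smul, Real.norm_of_nonneg hτ.1]
      exact (mul_le_of_le_one_left (norm_nonneg _) hτ.2).trans (hfH x (hAX p hx))
    · rintro _ ⟨⟨τ, x⟩, ⟨hτ, hx⟩, rfl⟩
      have := hcone p hpX (f' x) (hfX' (hAX p hx)) (hfp' p x hx) (τ * h)
        (mul_nonneg hτ.1 hh0) ((mul_le_of_le_one_left hh0 hτ.2).trans hhr) 0
        (by rw [norm_zero]; exact mul_nonneg hκ.le (mul_nonneg hτ.1 hh0))
      rwa [add_zero, mul_smul] at this
  refine ⟨K', hK'X, hK', fun {V} _ _ _ {G} hG => ?_⟩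
  set I := ∫⁻ y in K', ‖fderiv ℝ G y‖ₑ ^ 2 ∂μ with hI
  -- All interpolants f + τ(f' - f) keep half of the anti-Lipschitz constant. The values τ = 0,
  -- strictly between, and τ = 1 are used on the three segments.
  have hmix : ∀ τ : ℝ, 0 ≤ τ → τ ≤ 1 → ∀ x ∈ X, ∀ y ∈ X, ‖y - x‖ < r₁ → m / 2 * ‖y - x‖ ≤
      ‖(f y - f x) + τ • ((f' y - f y) - (f' x - f x))‖ := by
    intro τ h0 h1 x hx y hy hxy
    have a1 := hanti x hx y hy hxy
    have a2 := hclose x hx y hy hxy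
    have a3 : ‖τ • ((f' y - f y) - (f' x - f x))‖ ≤ m / 2 * ‖y - x‖ := by
      rw [norm_smul, Real.norm_of_nonneg h0]
      exact (mul_le_of_le_one_left (norm_nonneg _) h1).trans a2
    have a4 := norm_sub_le_norm_add (f y - f x) (τ • ((f' y - f y) - (f' x - f x)))
    linarith
  have key : ∀ p ∈ t, ∫⁻ x in A p, ‖G (f' x) - G (f x)‖ₑ ^ 2 ∂μ ≤
      4 * (3 * (ENNReal.ofReal h ^ 2 * (N * I))) := by
    intro p hp
    have hpX := htX hp
    have hsub := subset_biUnion_of_mem (u := fun p => γ₁ p '' Q p ∪ γ₂ p '' Q p ∪ γ₃ p '' Q p) hp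
    have hne : ‖h • e p‖ ≤ h := by
      rw [norm_smul, Real.norm_of_nonneg hh0]
      exact mul_le_of_le_one_right hh0 (he p hpX)
    have hfA := hf.mono (hAX p)
    have hfA' := hf'.mono (hAX p)
    have s1 := lintegral_enorm_segment_sub_sq_le μ hcov (hAc p).measurableSet (hAX p)
      hK'.measurableSet (a := f) (b := fun _ => h • e p) hfA continuousOn_const
      (H := h) (fun _ _ => hne)
      (fun τ h0 h1 x hx => hsub (Or.inl (Or.inl ⟨(τ, x), ⟨⟨h0, h1⟩, hx⟩, rfl⟩)))
      (fun τ h0 h1 x hx y hy hxy => by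
        have := hmix 0 le_rfl zero_le_one x (hAX p hx) y (hAX p hy) hxy
        rw [add_sub_add_right_eq_sub]
        simpa using this) hG
    have s2 := lintegral_enorm_segment_sub_sq_le μ hcov (hAc p).measurableSet (hAX p)
      hK'.measurableSet (a := fun x => f x + h • e p) (b := fun x => f' x - f x)
      (hfA.add continuousOn_const) (hfA'.sub hfA)
      (H := h) (fun x hx => (hfH x (hAX p hx)).trans hHh)
      (fun τ h0 h1 x hx => hsub (Or.inl (Or.inr ⟨(τ, x), ⟨⟨h0, h1⟩, hx⟩, rfl⟩)))
      (fun τ h0 h1 x hx y hy hxy => by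
        have := hmix τ h0 h1 x (hAX p hx) y (hAX p hy) hxy
        refine this.trans (le_of_eq ?_)
        rw [smul_sub]
        congr 1
        abel) hG
    have s3 := lintegral_enorm_segment_sub_sq_le μ hcov (hAc p).measurableSet (hAX p)
      hK'.measurableSet (a := f') (b := fun _ => h • e p) hfA' continuousOn_const
      (H := h) (fun _ _ => hne)
      (fun τ h0 h1 x hx => hsub (Or.inr ⟨(τ, x), ⟨⟨h0, h1⟩, hx⟩, rfl⟩))
      (fun τ h0 h1 x hx y hy hxy => by
        have := hmix 1 zero_le_one le_rfl x (hAX p hx) y (hAX p hy) hxy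
        rw [add_sub_add_right_eq_sub]
        refine this.trans (le_of_eq ?_)
        rw [one_smul]
        congr 1
        abel) hG
    have hGc : Continuous G := hG.continuous
    have m1 : AEMeasurable (fun x => ‖G (f x + h • e p) - G (f x)‖ₑ ^ 2) (μ.restrict (A p)) :=
      ContinuousOn.aemeasurable ((ENNReal.continuous_pow 2).comp_continuousOn
        ((hGc.comp_continuousOn (hfA.add continuousOn_const)).sub
          (hGc.comp_continuousOn hfA)).enorm) (hAc p).measurableSet
    have m3 : AEMeasurable (fun x => ‖G (f' x + h • e p) - G (f' x)‖ₑ ^ 2) (μ.restrict (A p)) :=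
      ContinuousOn.aemeasurable ((ENNReal.continuous_pow 2).comp_continuousOn
        ((hGc.comp_continuousOn (hfA'.add continuousOn_const)).sub
          (hGc.comp_continuousOn hfA')).enorm) (hAc p).measurableSet
    calc ∫⁻ x in A p, ‖G (f' x) - G (f x)‖ₑ ^ 2 ∂μ
        ≤ ∫⁻ x in A p, 4 * (‖G (f x + h • e p) - G (f x)‖ₑ ^ 2 +
            (‖G (f x + h • e p + (f' x - f x)) - G (f x + h • e p)‖ₑ ^ 2 +
            ‖G (f' x + h • e p) - G (f' x)‖ₑ ^ 2)) ∂μ := by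
          refine lintegral_mono fun x => ?_
          have e1 : f x + h • e p + (f' x - f x) = f' x + h • e p := by abel
          have e2 : G (f' x) - G (f x) = (G (f x + h • e p) - G (f x)) +
              ((G (f' x + h • e p) - G (f x + h • e p)) - (G (f' x + h • e p) - G (f' x))) := by
            abel
          rw [e1, e2]
          have e3 := (enorm_add_le (G (f x + h • e p) - G (f x))
              ((G (f' x + h • e p) - G (f x + h • e p)) - (G (f' x + h • e p) - G (f' x)))).trans
              (add_le_add_right enorm_sub_le _)
          refine (ENNReal.pow_le_pow_left e3).trans ?_
          refine ennreal_add_sq_le.trans ?_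
          calc 2 * (‖G (f x + h • e p) - G (f x)‖ₑ ^ 2 +
                (‖G (f' x + h • e p) - G (f x + h • e p)‖ₑ + ‖G (f' x + h • e p) - G (f' x)‖ₑ) ^ 2)
              ≤ 2 * (2 * ‖G (f x + h • e p) - G (f x)‖ₑ ^ 2 +
                2 * (‖G (f' x + h • e p) - G (f x + h • e p)‖ₑ ^ 2 +
                  ‖G (f' x + h • e p) - G (f' x)‖ₑ ^ 2)) := by
                gcongr
                · exact le_mul_of_one_le_left (zero_le) (by norm_num)
                · exact ennreal_add_sq_le
            _ = _ := by ring
      _ ≤ 4 * (ENNReal.ofReal h ^ 2 * (N * I) + (ENNReal.ofReal h ^ 2 * (N * I) +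
            ENNReal.ofReal h ^ 2 * (N * I))) := by
          rw [lintegral_const_mul' _ _ (by simp), lintegral_add_left' m1, lintegral_add_right' _ m3]
          gcongr
      _ = _ := by ring
  have hhH : ENNReal.ofReal h = ENNReal.ofReal (1 / κ) * ENNReal.ofReal H := by
    rw [← ENNReal.ofReal_mul (by positivity), hh]
    congr 1
    ring
  calc ∫⁻ x in K, ‖G (f' x) - G (f x)‖ₑ ^ 2 ∂μ
      ≤ ∫⁻ x in ⋃ p ∈ t, A p, ‖G (f' x) - G (f x)‖ₑ ^ 2 ∂μ := lintegral_mono_set hAcov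
    _ ≤ ∑ p ∈ t, ∫⁻ x in A p, ‖G (f' x) - G (f x)‖ₑ ^ 2 ∂μ :=
        lintegral_biUnion_finset_le _ _ _ _
    _ ≤ ∑ p ∈ t, 4 * (3 * (ENNReal.ofReal h ^ 2 * (N * I))) := Finset.sum_le_sum key
    _ = _ := by rw [Finset.sum_const, nsmul_eq_mul, hhH]; ring

end Path

/-! ### One-dimensional weighted inequalities of Hardy and Sobolev type -/

section Hardy

/-- Tonelli on the triangle 0 < ρ ≤ τ ≤ r, where ρ^a ≤ τ^a and the inner interval has length τ. -/
theorem lintegral_pow_mul_lintegral_tail_le {v : ℝ → ENNReal} (hv : Measurable v) (r : ℝ) (a : ℕ) :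
    ∫⁻ ρ in Ioc 0 r, ENNReal.ofReal ρ ^ a * ∫⁻ τ in Icc ρ r, v τ ≤
      ∫⁻ τ in Ioc 0 r, ENNReal.ofReal τ ^ (a + 1) * v τ := by
  let g : ℝ × ℝ → ENNReal := fun p =>
    {p : ℝ × ℝ | 0 < p.1 ∧ p.1 ≤ p.2}.indicator (fun p => ENNReal.ofReal p.1 ^ a * v p.2) p
  have hg : Measurable g := by
    refine Measurable.indicator (by fun_prop) ?_
    exact (measurableSet_lt measurable_const measurable_fst).inter
      (measurableSet_le measurable_fst measurable_snd)
  calc _ ≤ ∫⁻ ρ in Ioc 0 r, ∫⁻ τ in Ioc 0 r, g (ρ, τ) := by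
        refine setLIntegral_mono' measurableSet_Ioc fun ρ hρ => ?_
        rw [← lintegral_const_mul _ hv, ← lintegral_indicator measurableSet_Icc,
          ← lintegral_indicator measurableSet_Ioc]
        refine lintegral_mono fun τ => ?_
        by_cases hτ : τ ∈ Icc ρ r
        · have h1 : τ ∈ Ioc 0 r := ⟨hρ.1.trans_le hτ.1, hτ.2⟩
          have h2 : (ρ, τ) ∈ {p : ℝ × ℝ | 0 < p.1 ∧ p.1 ≤ p.2} := ⟨hρ.1, hτ.1⟩
          rw [indicator_of_mem hτ, indicator_of_mem h1]
          simp only [g]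
          rw [indicator_of_mem h2]
        · rw [indicator_of_notMem hτ]; exact zero_le
    _ = ∫⁻ τ in Ioc 0 r, ∫⁻ ρ in Ioc 0 r, g (ρ, τ) :=
        lintegral_lintegral_swap hg.aemeasurable
    _ ≤ _ := by
        refine setLIntegral_mono' measurableSet_Ioc fun τ hτ => ?_
        calc ∫⁻ ρ in Ioc 0 r, g (ρ, τ) ≤ ∫⁻ ρ, (Ioc 0 τ).indicator
              (fun _ => ENNReal.ofReal τ ^ a * v τ) ρ := by
              refine (setLIntegral_le_lintegral _ _).trans (lintegral_mono fun ρ => ?_)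
              by_cases hρ : ρ ∈ Ioc 0 τ
              · have h2 : (ρ, τ) ∈ {p : ℝ × ℝ | 0 < p.1 ∧ p.1 ≤ p.2} := hρ
                simp only [g]
                rw [indicator_of_mem h2, indicator_of_mem hρ]
                gcongr
                exact hρ.2
              · have h2 : (ρ, τ) ∉ {p : ℝ × ℝ | 0 < p.1 ∧ p.1 ≤ p.2} := hρ
                simp only [g]
                rw [indicator_of_notMem h2]; exact zero_le
          _ = _ := by
              rw [lintegral_indicator_const measurableSet_Ioc, Real.volume_Ioc, sub_zero]
              ring

/-- The average of `u` over `[r / 2, r]` controls the values of `u` to the left, up to the total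
increase of `u`. -/
theorem le_average_add_lintegral {r : ℝ} (hr : 0 < r) {c : ENNReal} {u v : ℝ → ENNReal}
    (hu : Measurable u)
    (h : ∀ ρ τ, 0 ≤ ρ → ρ ≤ τ → τ ≤ r → u ρ ≤ u τ + c * ∫⁻ x in Icc ρ τ, v x)
    {ρ : ℝ} (h0 : 0 ≤ ρ) (h1 : ρ ≤ r / 2) :
    u ρ ≤ ENNReal.ofReal (2 / r) * (∫⁻ τ in Ioc (r / 2) r, u τ) + c * ∫⁻ x in Icc ρ r, v x := by
  have hvol : volume (Ioc (r / 2) r) = ENNReal.ofReal (r / 2) := by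
    rw [Real.volume_Ioc]; congr 1; ring
  have e1 : ENNReal.ofReal (2 / r) * ENNReal.ofReal (r / 2) = 1 := by
    rw [← ENNReal.ofReal_mul (by positivity)]
    rw [show 2 / r * (r / 2) = 1 by field_simp, ENNReal.ofReal_one]
  have key : u ρ * ENNReal.ofReal (r / 2) ≤ (∫⁻ τ in Ioc (r / 2) r, u τ) +
      c * (∫⁻ x in Icc ρ r, v x) * ENNReal.ofReal (r / 2) := by
    rw [← hvol, ← setLIntegral_const, ← setLIntegral_const, ← lintegral_add_left hu]
    refine setLIntegral_mono' measurableSet_Ioc fun τ hτ => ?_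
    refine (h ρ τ h0 (h1.trans hτ.1.le) hτ.2).trans ?_
    gcongr
    exact hτ.2
  calc u ρ = ENNReal.ofReal (2 / r) * (u ρ * ENNReal.ofReal (r / 2)) := by
        rw [mul_comm (u ρ), ← mul_assoc, e1, one_mul]
    _ ≤ ENNReal.ofReal (2 / r) * ((∫⁻ τ in Ioc (r / 2) r, u τ) +
      c * (∫⁻ x in Icc ρ r, v x) * ENNReal.ofReal (r / 2)) := by gcongr
    _ = ENNReal.ofReal (2 / r) * (∫⁻ τ in Ioc (r / 2) r, u τ) +
      c * (∫⁻ x in Icc ρ r, v x) * (ENNReal.ofReal (2 / r) * ENNReal.ofReal (r / 2)) := by ring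
    _ = _ := by rw [e1, mul_one]

theorem lintegral_half_le {r : ℝ} (hr : 0 < r) (u : ℝ → ENNReal) (a : ℕ) :
    ∫⁻ τ in Ioc (r / 2) r, u τ ≤
      ENNReal.ofReal (2 / r) ^ a * ∫⁻ τ in Ioc 0 r, ENNReal.ofReal τ ^ a * u τ := by
  rw [← lintegral_const_mul' _ _ (by simp)]
  refine le_trans (setLIntegral_mono' measurableSet_Ioc fun τ hτ => ?_)
    (lintegral_mono_set (Ioc_subset_Ioc_left (by positivity)))
  have h1 : 1 ≤ ENNReal.ofReal (2 / r) * ENNReal.ofReal τ := by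
    rw [← ENNReal.ofReal_mul (by positivity), ENNReal.one_le_ofReal, div_mul_eq_mul_div,
      le_div_iff₀ hr]
    linarith [hτ.1]
  rw [← mul_assoc, ← mul_pow]
  exact le_mul_of_one_le_left zero_le (one_le_pow₀ h1)

/-- A one-dimensional Hardy type inequality. -/
theorem lintegral_pow_mul_le {r : ℝ} (hr : 0 < r) {c : ENNReal} {u v : ℝ → ENNReal}
    (hu : Measurable u) (hv : Measurable v)
    (h : ∀ ρ τ, 0 ≤ ρ → ρ ≤ τ → τ ≤ r → u ρ ≤ u τ + c * ∫⁻ x in Icc ρ τ, v x) (a : ℕ) :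
    ∫⁻ ρ in Ioc 0 r, ENNReal.ofReal ρ ^ a * u ρ ≤
      (ENNReal.ofReal (2 / r) ^ (a + 2) * ENNReal.ofReal r ^ (a + 1) + ENNReal.ofReal (2 / r)) *
        (∫⁻ ρ in Ioc 0 r, ENNReal.ofReal ρ ^ (a + 1) * u ρ) +
      c * ∫⁻ ρ in Ioc 0 r, ENNReal.ofReal ρ ^ (a + 1) * v ρ := by
  set S := ∫⁻ ρ in Ioc 0 r, ENNReal.ofReal ρ ^ (a + 1) * u ρ with hS
  have hb : ∀ ρ ∈ Ioc 0 r, ENNReal.ofReal ρ ^ a * u ρ ≤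
      ENNReal.ofReal r ^ a * (ENNReal.ofReal (2 / r) * (ENNReal.ofReal (2 / r) ^ (a + 1) * S)) +
      ENNReal.ofReal (2 / r) * (ENNReal.ofReal ρ ^ (a + 1) * u ρ) +
      c * (ENNReal.ofReal ρ ^ a * ∫⁻ x in Icc ρ r, v x) := by
    intro ρ hρ
    -- For small ρ the value of u is compared with its average over the right half. For large ρ the
    -- additional factor ρ in the weight costs only the constant 2/r.
    rcases le_total ρ (r / 2) with hc | hc
    · have h1 := le_average_add_lintegral hr hu h hρ.1.le hc
      calc _ ≤ ENNReal.ofReal ρ ^ a * (ENNReal.ofReal (2 / r) *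
            (ENNReal.ofReal (2 / r) ^ (a + 1) * S) + c * ∫⁻ x in Icc ρ r, v x) := by
            gcongr
            refine h1.trans ?_
            gcongr
            exact lintegral_half_le hr u (a + 1)
        _ = ENNReal.ofReal ρ ^ a * (ENNReal.ofReal (2 / r) *
            (ENNReal.ofReal (2 / r) ^ (a + 1) * S)) + 0 +
              c * (ENNReal.ofReal ρ ^ a * ∫⁻ x in Icc ρ r, v x) := by ring
        _ ≤ _ := by
            gcongr
            · exact hρ.2
            · exact zero_le
    · have h1 : 1 ≤ ENNReal.ofReal (2 / r) * ENNReal.ofReal ρ := by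
        rw [← ENNReal.ofReal_mul (by positivity), ENNReal.one_le_ofReal, div_mul_eq_mul_div,
          le_div_iff₀ hr]
        linarith
      calc _ ≤ (ENNReal.ofReal (2 / r) * ENNReal.ofReal ρ) * (ENNReal.ofReal ρ ^ a * u ρ) :=
            le_mul_of_one_le_left zero_le h1
        _ = 0 + ENNReal.ofReal (2 / r) * (ENNReal.ofReal ρ ^ (a + 1) * u ρ) + 0 := by ring
        _ ≤ _ := by gcongr <;> exact zero_le
  refine (setLIntegral_mono' measurableSet_Ioc hb).trans ?_
  have hm : Measurable fun ρ : ℝ => ENNReal.ofReal ρ ^ (a + 1) * u ρ := by fun_prop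
  rw [lintegral_add_left (by fun_prop), lintegral_add_left (by fun_prop),
    lintegral_const_mul _ hm, setLIntegral_const, Real.volume_Ioc, sub_zero]
  have hc' : ∫⁻ ρ in Ioc 0 r, c * (ENNReal.ofReal ρ ^ a * ∫⁻ x in Icc ρ r, v x) ≤
      c * ∫⁻ ρ in Ioc 0 r, ENNReal.ofReal ρ ^ (a + 1) * v ρ := by
    rw [lintegral_const_mul'']
    · exact mul_le_mul_right (lintegral_pow_mul_lintegral_tail_le hv r a) c
    · have hanti : Antitone fun ρ : ℝ => ∫⁻ x in Icc ρ r, v x := fun ρ ρ' h =>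
        lintegral_mono_set (Icc_subset_Icc_left h)
      have := hanti.measurable
      fun_prop
  calc _ ≤ ENNReal.ofReal r ^ a * (ENNReal.ofReal (2 / r) * (ENNReal.ofReal (2 / r) ^ (a + 1) * S)) *
        ENNReal.ofReal r + ENNReal.ofReal (2 / r) * S +
        c * ∫⁻ ρ in Ioc 0 r, ENNReal.ofReal ρ ^ (a + 1) * v ρ := by gcongr
    _ = _ := by ring

/-- A one-dimensional Sobolev inequality with weights, for a sequence of functions each of which
controls the increase of the preceding one. -/
theorem exists_le_sum_lintegral_pow_mul {r : ℝ} (hr : 0 < r) {c : ENNReal} (hc : c ≠ ⊤) (a : ℕ) :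
    ∃ C : ENNReal, C ≠ ⊤ ∧ ∀ u : ℕ → ℝ → ENNReal, (∀ i, Measurable (u i)) →
      (∀ i ≤ a, ∀ ρ τ, 0 ≤ ρ → ρ ≤ τ → τ ≤ r →
        u i ρ ≤ u i τ + c * ∫⁻ x in Icc ρ τ, u (i + 1) x) →
      u 0 0 ≤ C * ∑ i ∈ Finset.range (a + 2), ∫⁻ ρ in Ioc 0 r, ENNReal.ofReal ρ ^ a * u i ρ := by
  induction a with
  | zero =>
    refine ⟨ENNReal.ofReal (2 / r) + c, by finiteness, fun u hu h => ?_⟩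
    have h1 := le_average_add_lintegral hr (hu 0) (h 0 le_rfl) le_rfl (by positivity : 0 ≤ r / 2)
    rw [Finset.sum_range_succ, Finset.sum_range_one]
    simp only [pow_zero, one_mul]
    have h2 : ∫⁻ τ in Ioc (r / 2) r, u 0 τ ≤ ∫⁻ τ in Ioc 0 r, u 0 τ :=
      lintegral_mono_set (Ioc_subset_Ioc_left (by positivity))
    have h3 : ∫⁻ x in Icc 0 r, u 1 x = ∫⁻ x in Ioc 0 r, u 1 x :=
      setLIntegral_congr Ioc_ae_eq_Icc.symm
    rw [zero_add, h3] at h1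
    refine h1.trans ?_
    rw [add_mul]
    gcongr
    · exact h2.trans le_self_add
    · exact le_add_self
  | succ a ih =>
    obtain ⟨C, hC, H⟩ := ih
    set D : ENNReal := ENNReal.ofReal (2 / r) ^ (a + 2) * ENNReal.ofReal r ^ (a + 1) +
      ENNReal.ofReal (2 / r) with hD
    have hD' : D ≠ ⊤ := by rw [hD]; finiteness
    refine ⟨C * (D + c), by finiteness, fun u hu h => ?_⟩
    set S : ℕ → ENNReal := fun i => ∫⁻ ρ in Ioc 0 r, ENNReal.ofReal ρ ^ (a + 1) * u i ρ with hS
    -- The sum with weight ρ^a runs over i ≤ a + 1. The Hardy inequality raises the weight of the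
    -- i-th term to ρ^(a+1) at the cost of the function of index i + 1 ≤ a + 2.
    refine (H u hu fun i hi => h i (by omega)).trans ?_
    rw [mul_assoc]
    gcongr
    calc _ ≤ ∑ i ∈ Finset.range (a + 2), (D * S i + c * S (i + 1)) := by
          refine Finset.sum_le_sum fun i hi => ?_
          have := Finset.mem_range.1 hi
          exact lintegral_pow_mul_le hr (hu i) (hu (i + 1)) (h i (by omega)) a
      _ = D * (∑ i ∈ Finset.range (a + 2), S i) + c * ∑ i ∈ Finset.range (a + 2), S (i + 1) := by
          rw [Finset.sum_add_distrib, Finset.mul_sum, Finset.mul_sum]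
      _ ≤ D * (∑ i ∈ Finset.range (a + 3), S i) + c * ∑ i ∈ Finset.range (a + 3), S i := by
          gcongr
          · omega
          · rw [Finset.sum_range_succ' S (a + 2)]; exact le_self_add
      _ = _ := by rw [← add_mul]

theorem lintegral_Ioc_rpow_ne_top {p : ℝ} (r : ℝ) (hp : -1 < p) :
    ∫⁻ ρ in Ioc 0 r, ENNReal.ofReal (ρ ^ p) ≠ ⊤ := by
  have h := (intervalIntegral.intervalIntegrable_rpow' (a := 0) (b := r) hp).1
  exact (h.lintegral_lt_top).ne

/-- The square version of the weighted Sobolev inequality. -/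
theorem exists_sq_le_sum_lintegral_rpow_mul {r : ℝ} (hr : 0 < r) {c : ENNReal} (hc : c ≠ ⊤)
    (a : ℕ) :
    ∃ C : ENNReal, C ≠ ⊤ ∧ ∀ u : ℕ → ℝ → ENNReal, (∀ i, Measurable (u i)) →
      (∀ i ≤ a, ∀ ρ τ, 0 ≤ ρ → ρ ≤ τ → τ ≤ r →
        u i ρ ≤ u i τ + c * ∫⁻ x in Icc ρ τ, u (i + 1) x) →
      u 0 0 ^ 2 ≤ C * ∑ i ∈ Finset.range (a + 2),
        ∫⁻ ρ in Ioc 0 r, ENNReal.ofReal (ρ ^ (2 * a + 3 / 4 : ℝ)) * u i ρ ^ 2 := by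
  obtain ⟨C, hC, H⟩ := exists_le_sum_lintegral_pow_mul hr hc a
  -- Cauchy-Schwarz with ρ^a = ρ^(-θ/2) ρ^(a+θ/2), where θ = 3/4. Integrability of ρ^(-θ) needs θ <
  -- 1, and the product estimate for Sobolev functions later needs θ > 1/2.
  set D := ∫⁻ ρ in Ioc 0 r, ENNReal.ofReal (ρ ^ (-3 / 4 : ℝ)) with hD
  have hD' : D ≠ ⊤ := lintegral_Ioc_rpow_ne_top r (by norm_num)
  refine ⟨C ^ 2 * ((a + 2 : ℕ) * D), by finiteness, fun u hu h => ?_⟩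
  have h1 := ENNReal.pow_le_pow_left (n := 2) (H u hu h)
  refine h1.trans ?_
  rw [mul_pow, mul_assoc, mul_assoc]
  gcongr
  have h2 : (∑ i ∈ Finset.range (a + 2), ∫⁻ ρ in Ioc 0 r, ENNReal.ofReal ρ ^ a * u i ρ) ^ 2 ≤
      (a + 2 : ℕ) * ∑ i ∈ Finset.range (a + 2),
        (∫⁻ ρ in Ioc 0 r, ENNReal.ofReal ρ ^ a * u i ρ) ^ 2 := by
    have := ENNReal.inner_le_Lp_mul_Lq (Finset.range (a + 2)) (fun _ => 1)
      (fun i => ∫⁻ ρ in Ioc 0 r, ENNReal.ofReal ρ ^ a * u i ρ) Real.HolderConjugate.two_two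
    have := ENNReal.pow_le_pow_left (n := 2) this
    rw [mul_pow, ← ENNReal.rpow_natCast (_ ^ _), ← ENNReal.rpow_natCast (_ ^ _),
      ← ENNReal.rpow_mul, ← ENNReal.rpow_mul] at this
    norm_num at this
    simpa using this
  refine h2.trans ?_
  gcongr
  rw [Finset.mul_sum]
  refine Finset.sum_le_sum fun i _ => ?_
  have h3 := sq_lintegral_mul_le (volume.restrict (Ioc 0 r))
    (f := fun ρ => ENNReal.ofReal (ρ ^ (-3 / 8 : ℝ)))
    (g := fun ρ => ENNReal.ofReal (ρ ^ (a + 3 / 8 : ℝ)) * u i ρ)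
    (by fun_prop) (by have := hu i; fun_prop)
  calc _ = (∫⁻ ρ in Ioc 0 r, ENNReal.ofReal (ρ ^ (-3 / 8 : ℝ)) *
        (ENNReal.ofReal (ρ ^ (a + 3 / 8 : ℝ)) * u i ρ)) ^ 2 := by
        congr 1
        refine setLIntegral_congr_fun measurableSet_Ioc fun ρ hρ => ?_
        have hρ0 := hρ.1
        rw [← mul_assoc, ← ENNReal.ofReal_mul (by positivity), ← ENNReal.ofReal_pow hρ0.le,
          ← Real.rpow_add hρ0, ← Real.rpow_natCast]
        congr 3
        ring
    _ ≤ _ := h3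
    _ = _ := by
        congr 1
        · refine setLIntegral_congr_fun measurableSet_Ioc fun ρ hρ => ?_
          have hρ0 := hρ.1
          rw [← ENNReal.ofReal_pow (by positivity), ← Real.rpow_natCast, ← Real.rpow_mul hρ0.le]
          norm_num
        · refine setLIntegral_congr_fun measurableSet_Ioc fun ρ hρ => ?_
          have hρ0 := hρ.1
          rw [mul_pow, ← ENNReal.ofReal_pow (by positivity), ← Real.rpow_natCast (_ ^ _),
            ← Real.rpow_mul hρ0.le]
          congr 3
          push_cast
          ring

end Hardy

/-! ### Integrals over cones -/

theorem measurable_indicator_of_continuousOn {α β : Type*} [TopologicalSpace α] [MeasurableSpace α]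
    [BorelSpace α] [TopologicalSpace β] [MeasurableSpace β] [BorelSpace β] [Zero β] {s : Set α}
    {f : α → β} (hf : ContinuousOn f s) (hs : MeasurableSet s) : Measurable (s.indicator f) := by
  classical
  rw [← piecewise_eq_indicator]
  exact hf.measurable_piecewise continuousOn_const hs

theorem lintegral_mul_lintegral_swap {α β γ : Type*} [MeasurableSpace α] [MeasurableSpace β]
    [MeasurableSpace γ] (μ : Measure α) (ν : Measure β) (ξ : Measure γ) [SFinite μ] [SFinite ν]
    [SFinite ξ] {f : β → α → ENNReal} {g : γ → α → ENNReal} (hf : Measurable (Function.uncurry f))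
    (hg : Measurable (Function.uncurry g)) :
    ∫⁻ x, (∫⁻ b, f b x ∂ν) * (∫⁻ c, g c x ∂ξ) ∂μ = ∫⁻ b, ∫⁻ c, ∫⁻ x, f b x * g c x ∂μ ∂ξ ∂ν := by
  have hfx : ∀ x, Measurable fun b => f b x := fun x => hf.comp (measurable_id.prodMk measurable_const)
  have hgx : ∀ x, Measurable fun c => g c x := fun x => hg.comp (measurable_id.prodMk measurable_const)
  have e1 : ∀ x, (∫⁻ b, f b x ∂ν) * (∫⁻ c, g c x ∂ξ) = ∫⁻ b, ∫⁻ c, f b x * g c x ∂ξ ∂ν := by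
    intro x
    rw [← lintegral_mul_const _ (hfx x)]
    refine lintegral_congr fun b => ?_
    rw [lintegral_const_mul _ (hgx x)]
  simp_rw [e1]
  have h3 : Measurable fun q : (α × β) × γ => f q.1.2 q.1.1 * g q.2 q.1.1 :=
    (hf.comp ((measurable_snd.comp measurable_fst).prodMk (measurable_fst.comp measurable_fst))).mul
      (hg.comp (measurable_snd.prodMk (measurable_fst.comp measurable_fst)))
  rw [lintegral_lintegral_swap (h3.lintegral_prod_right').aemeasurable]
  refine lintegral_congr fun b => ?_
  rw [lintegral_lintegral_swap]
  refine Measurable.aemeasurable ?_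
  exact (hf.comp (measurable_const.prodMk measurable_fst)).mul
    (hg.comp (measurable_snd.prodMk measurable_fst))

section ConeIntegral
variable {E : Type*} [NormedAddCommGroup E] [NormedSpace ℝ E] [FiniteDimensional ℝ E]
  [MeasurableSpace E] [BorelSpace E] (μ : Measure E) [μ.IsAddHaarMeasure]

/-- The integral of `U` over the section at height `ρ` of the cone with vertex `y`, axis `e` and
opening `κ`, in the scale of the section. -/
noncomputable def coneSection (κ : ℝ) (e : E) (U : E → ENNReal) (ρ : ℝ) (y : E) : ENNReal :=
  ∫⁻ w in Metric.closedBall 0 κ, U (y + ρ • (e + w)) ∂μ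

/-- The integral of `U` over the truncated cone with vertex `y`, with the weight `ρ ^ p` at height
`ρ`. -/
noncomputable def coneIntegral (r κ p : ℝ) (e : E) (U : E → ENNReal) (y : E) : ENNReal :=
  ∫⁻ ρ in Ioc 0 r, ENNReal.ofReal (ρ ^ p) * coneSection μ κ e U ρ y

theorem measurable_coneSection (κ : ℝ) (e : E) {U : E → ENNReal} (hU : Measurable U) :
    Measurable fun q : ℝ × E => coneSection μ κ e U q.1 q.2 := by
  have : Measurable fun q : (ℝ × E) × E => U (q.1.2 + q.1.1 • (e + q.2)) := by
    refine hU.comp (Continuous.measurable ?_)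
    fun_prop
  exact this.lintegral_prod_right'

/-- The change of variables z = y + ρ(e + w) has Jacobian ρ^(-d). This is the bound from L¹ to the
supremum, which degenerates at the vertex of the cone. -/
theorem coneSection_le (κ : ℝ) (e : E) {U : E → ENNReal} (hU : Measurable U) {ρ : ℝ} (hρ : 0 < ρ)
    (y : E) : coneSection μ κ e U ρ y ≤
      ENNReal.ofReal (ρ ^ (-(Module.finrank ℝ E : ℝ))) * ∫⁻ x, U x ∂μ := by
  refine (setLIntegral_le_lintegral _ _).trans (le_of_eq ?_)
  have h1 : ∫⁻ w, U (y + ρ • (e + w)) ∂μ = ∫⁻ w, U (y + ρ • w) ∂μ :=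
    lintegral_add_left_eq_self (μ := μ) (fun w => U (y + ρ • w)) e
  have hm : Measurable fun w : E => U (y + w) := hU.comp (measurable_const_add y)
  have h2 : ∫⁻ w, U (y + ρ • w) ∂μ = ∫⁻ w, U (y + w) ∂(μ.map (ρ • ·)) :=
    (lintegral_map hm (measurable_const_smul ρ)).symm
  rw [h1, h2, Measure.map_addHaar_smul μ hρ.ne', lintegral_smul_measure,
    lintegral_add_left_eq_self (μ := μ) U y, smul_eq_mul]
  congr 2
  rw [abs_of_pos (by positivity), Real.rpow_neg hρ.le, Real.rpow_natCast]

/-- The complementary bound from L¹ to L¹, uniform in the height: for each fixed w the section is a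
composition with a translate of F. -/
theorem lintegral_coneSection_comp_le (κ : ℝ) (e : E) {U : E → ENNReal} (hU : Measurable U) (ρ : ℝ)
    {A : Set E} {F : E → E} (hF : Measurable F) {K : ENNReal}
    (hK : ∀ z, ∫⁻ x in A, U (F x + z) ∂μ ≤ K * ∫⁻ x, U x ∂μ) :
    ∫⁻ x in A, coneSection μ κ e U ρ (F x) ∂μ ≤
      μ (Metric.closedBall 0 κ) * (K * ∫⁻ x, U x ∂μ) := by
  unfold coneSection
  rw [lintegral_lintegral_swap]
  · refine (lintegral_mono fun w => hK _).trans ?_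
    rw [lintegral_const, Measure.restrict_apply_univ, mul_comm]
  · refine Measurable.aemeasurable ?_
    refine hU.comp ?_
    refine (hF.comp measurable_fst).add ?_
    exact (Continuous.measurable (by fun_prop))

/-- The section at the larger height is bounded in the supremum norm and the other one in L¹, which
costs max(ρ, σ)^(-d). This is at most ρ^(-x₀) σ^(-(d - x₀)) for every x₀ in [0, d], a product in
which the two heights can be integrated separately. -/
theorem lintegral_coneSection_mul_le (κ : ℝ) (e e' : E) {U V : E → ENNReal} (hU : Measurable U)
    (hV : Measurable V) {A : Set E} {F : E → E} (hF : Measurable F) {K : ENNReal}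
    (hK : ∀ z, ∫⁻ x in A, U (F x + z) ∂μ ≤ K * ∫⁻ x, U x ∂μ) {ρ σ : ℝ} (hρ : 0 < ρ) (hσ : 0 < σ)
    {x₀ : ℝ} (h0 : 0 ≤ x₀) (h1 : x₀ ≤ Module.finrank ℝ E) :
    ∫⁻ x in A, coneSection μ κ e U ρ (F x) * coneSection μ κ e' V σ x ∂μ ≤
      ENNReal.ofReal (ρ ^ (-x₀)) * ENNReal.ofReal (σ ^ (-(Module.finrank ℝ E - x₀))) *
      (μ (Metric.closedBall 0 κ) * (K + 1) * ((∫⁻ x, U x ∂μ) * ∫⁻ x, V x ∂μ)) := by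
  set d : ℝ := ((Module.finrank ℝ E : ℕ) : ℝ)
  have hmU : Measurable fun x => coneSection μ κ e U ρ (F x) :=
    (measurable_coneSection μ κ e hU).comp (measurable_const.prodMk hF)
  have hmV : Measurable fun x => coneSection μ κ e' V σ x :=
    (measurable_coneSection μ κ e' hV).comp (measurable_const.prodMk measurable_id)
  rcases le_total ρ σ with hc | hc
  · calc _ ≤ ∫⁻ x in A, coneSection μ κ e U ρ (F x) *
          (ENNReal.ofReal (σ ^ (-d)) * ∫⁻ x, V x ∂μ) ∂μ := by
          refine lintegral_mono fun x => ?_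
          gcongr
          exact coneSection_le μ κ e' hV hσ x
      _ ≤ (μ (Metric.closedBall 0 κ) * (K * ∫⁻ x, U x ∂μ)) *
          (ENNReal.ofReal (σ ^ (-d)) * ∫⁻ x, V x ∂μ) := by
          rw [lintegral_mul_const _ hmU]
          gcongr
          exact lintegral_coneSection_comp_le μ κ e hU ρ hF hK
      _ = ENNReal.ofReal (σ ^ (-d)) *
          (μ (Metric.closedBall 0 κ) * K * ((∫⁻ x, U x ∂μ) * ∫⁻ x, V x ∂μ)) := by ring
      _ ≤ _ := by
          gcongr
          · rw [← ENNReal.ofReal_mul (by positivity)]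
            refine ENNReal.ofReal_le_ofReal ?_
            calc σ ^ (-d) = σ ^ (-x₀) * σ ^ (-(d - x₀)) := by
                  rw [← Real.rpow_add hσ]; congr 1; ring
              _ ≤ _ := by
                  gcongr ?_ * _
                  exact Real.rpow_le_rpow_of_nonpos hρ hc (by linarith)
          · exact le_self_add
  · calc _ ≤ ∫⁻ x in A, (ENNReal.ofReal (ρ ^ (-d)) * ∫⁻ x, U x ∂μ) *
          coneSection μ κ e' V σ x ∂μ := by
          refine lintegral_mono fun x => ?_
          gcongr
          exact coneSection_le μ κ e hU hρ (F x)
      _ ≤ (ENNReal.ofReal (ρ ^ (-d)) * ∫⁻ x, U x ∂μ) *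
          (μ (Metric.closedBall 0 κ) * (1 * ∫⁻ x, V x ∂μ)) := by
          rw [lintegral_const_mul _ hmV]
          gcongr
          refine lintegral_coneSection_comp_le μ κ e' hV σ measurable_id fun z => ?_
          rw [one_mul]
          refine (setLIntegral_le_lintegral _ _).trans (le_of_eq ?_)
          exact lintegral_add_right_eq_self (μ := μ) V z
      _ = ENNReal.ofReal (ρ ^ (-d)) *
          (μ (Metric.closedBall 0 κ) * 1 * ((∫⁻ x, U x ∂μ) * ∫⁻ x, V x ∂μ)) := by ring
      _ ≤ _ := by
          gcongr
          · rw [← ENNReal.ofReal_mul (by positivity)]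
            refine ENNReal.ofReal_le_ofReal ?_
            calc ρ ^ (-d) = ρ ^ (-x₀) * ρ ^ (-(d - x₀)) := by
                  rw [← Real.rpow_add hρ]; congr 1; ring
              _ ≤ _ := by
                  gcongr _ * ?_
                  exact Real.rpow_le_rpow_of_nonpos hσ hc (by linarith)
          · exact le_add_self

theorem coneIntegral_le (r κ : ℝ) (p : ℝ) (e : E) {U : E → ENNReal} (hU : Measurable U) (y : E) :
    coneIntegral μ r κ p e U y ≤
      (∫⁻ ρ in Ioc 0 r, ENNReal.ofReal (ρ ^ (p - Module.finrank ℝ E))) * ∫⁻ x, U x ∂μ := by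
  rw [← lintegral_mul_const _ (by fun_prop)]
  refine setLIntegral_mono' measurableSet_Ioc fun ρ hρ => ?_
  calc _ ≤ ENNReal.ofReal (ρ ^ p) *
        (ENNReal.ofReal (ρ ^ (-(Module.finrank ℝ E : ℝ))) * ∫⁻ x, U x ∂μ) := by
        gcongr
        exact coneSection_le μ κ e hU hρ.1 y
    _ = _ := by
        rw [← mul_assoc, ← ENNReal.ofReal_mul (Real.rpow_nonneg hρ.1.le _),
          ← Real.rpow_add hρ.1, sub_eq_add_neg]

/-- The two conditions on p and q say that the separated integrals over the heights converge at 0;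
x₀ distributes the total loss d between the two factors. -/
theorem exists_lintegral_coneIntegral_mul_le (r κ : ℝ) {p q x₀ : ℝ} (h0 : 0 ≤ x₀)
    (h1 : x₀ ≤ Module.finrank ℝ E) (hp : -1 < p - x₀)
    (hq : -1 < q - (Module.finrank ℝ E - x₀)) {K : ENNReal} (hK' : K ≠ ⊤) :
    ∃ C : ENNReal, C ≠ ⊤ ∧ ∀ (e e' : E) {U V : E → ENNReal}, Measurable U → Measurable V →
      ∀ {A : Set E} {F : E → E}, Measurable F →
      (∀ z, ∫⁻ x in A, U (F x + z) ∂μ ≤ K * ∫⁻ x, U x ∂μ) →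
      ∫⁻ x in A, coneIntegral μ r κ p e U (F x) * coneIntegral μ r κ q e' V x ∂μ ≤
        C * ((∫⁻ x, U x ∂μ) * ∫⁻ x, V x ∂μ) := by
  set d : ℝ := ((Module.finrank ℝ E : ℕ) : ℝ) with hd
  have hprop : ProperSpace E := FiniteDimensional.proper ℝ _
  have hB : μ (Metric.closedBall 0 κ) ≠ ⊤ := measure_closedBall_lt_top.ne
  set I := ∫⁻ ρ in Ioc 0 r, ENNReal.ofReal (ρ ^ (p - x₀))
  set J := ∫⁻ ρ in Ioc 0 r, ENNReal.ofReal (ρ ^ (q - (d - x₀)))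
  have hI : I ≠ ⊤ := lintegral_Ioc_rpow_ne_top r hp
  have hJ : J ≠ ⊤ := lintegral_Ioc_rpow_ne_top r hq
  refine ⟨I * (J * (μ (Metric.closedBall 0 κ) * (K + 1))), by finiteness,
    fun e e' {U V} hU hV {A F} hF hK => ?_⟩
  unfold coneIntegral
  have hmU : Measurable (Function.uncurry fun (ρ : ℝ) (x : E) =>
      ENNReal.ofReal (ρ ^ p) * coneSection μ κ e U ρ (F x)) := by
    have := (measurable_coneSection μ κ e hU).comp
      (measurable_fst.prodMk (hF.comp measurable_snd) : Measurable fun q : ℝ × E => (q.1, F q.2))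
    exact Measurable.mul (by fun_prop) this
  have hmV : Measurable (Function.uncurry fun (ρ : ℝ) (x : E) =>
      ENNReal.ofReal (ρ ^ q) * coneSection μ κ e' V ρ x) :=
    Measurable.mul (by fun_prop) (measurable_coneSection μ κ e' hV)
  rw [lintegral_mul_lintegral_swap _ _ _ hmU hmV]
  set T := (∫⁻ x, U x ∂μ) * ∫⁻ x, V x ∂μ
  calc _ ≤ ∫⁻ ρ in Ioc 0 r, ∫⁻ σ in Ioc 0 r, ENNReal.ofReal (ρ ^ (p - x₀)) *
        (ENNReal.ofReal (σ ^ (q - (d - x₀))) * (μ (Metric.closedBall 0 κ) * (K + 1) * T)) := by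
        refine setLIntegral_mono' measurableSet_Ioc fun ρ hρ => ?_
        refine setLIntegral_mono' measurableSet_Ioc fun σ hσ => ?_
        calc _ = ENNReal.ofReal (ρ ^ p) * ENNReal.ofReal (σ ^ q) *
              ∫⁻ x in A, coneSection μ κ e U ρ (F x) * coneSection μ κ e' V σ x ∂μ := by
              rw [← lintegral_const_mul' _ _ (by finiteness)]
              refine lintegral_congr fun x => ?_
              ring
          _ ≤ ENNReal.ofReal (ρ ^ p) * ENNReal.ofReal (σ ^ q) *
              (ENNReal.ofReal (ρ ^ (-x₀)) * ENNReal.ofReal (σ ^ (-(d - x₀))) *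
              (μ (Metric.closedBall 0 κ) * (K + 1) * T)) := by
              gcongr
              exact lintegral_coneSection_mul_le μ κ e e' hU hV hF hK hρ.1 hσ.1 h0 h1
          _ = (ENNReal.ofReal (ρ ^ p) * ENNReal.ofReal (ρ ^ (-x₀))) *
              ((ENNReal.ofReal (σ ^ q) * ENNReal.ofReal (σ ^ (-(d - x₀)))) *
              (μ (Metric.closedBall 0 κ) * (K + 1) * T)) := by ring
          _ = _ := by
              rw [← ENNReal.ofReal_mul (Real.rpow_nonneg hρ.1.le _), ← Real.rpow_add hρ.1,
                ← ENNReal.ofReal_mul (Real.rpow_nonneg hσ.1.le _), ← Real.rpow_add hσ.1]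
              rfl
    _ = _ := by
        have e1 : ∀ ρ : ℝ, ∫⁻ σ in Ioc 0 r, ENNReal.ofReal (ρ ^ (p - x₀)) *
            (ENNReal.ofReal (σ ^ (q - (d - x₀))) * (μ (Metric.closedBall 0 κ) * (K + 1) * T)) =
            ENNReal.ofReal (ρ ^ (p - x₀)) * (J * (μ (Metric.closedBall 0 κ) * (K + 1) * T)) := by
          intro ρ
          rw [lintegral_const_mul _ (by fun_prop), lintegral_mul_const _ (by fun_prop)]
        simp_rw [e1]
        rw [lintegral_mul_const _ (by fun_prop)]
        ring

variable {V : Type*} [NormedAddCommGroup V] [NormedSpace ℝ V] [CompleteSpace V]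

omit [FiniteDimensional ℝ E] [MeasurableSpace E] [BorelSpace E] in
theorem enorm_iteratedFDeriv_le_add_lintegral {X : Set E} (hX : IsOpen X) {N i : ℕ} {H : E → V}
    (hH : ContDiffOn ℝ N H X) (hi : i < N) {y d : E} {r : ℝ}
    (hray : ∀ ρ ∈ Icc 0 r, y + ρ • d ∈ X) {ρ τ : ℝ} (h0 : 0 ≤ ρ) (h1 : ρ ≤ τ) (h2 : τ ≤ r) :
    ‖iteratedFDeriv ℝ i H (y + ρ • d)‖ₑ ≤ ‖iteratedFDeriv ℝ i H (y + τ • d)‖ₑ +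
      ‖d‖ₑ * ∫⁻ x in Icc ρ τ, ‖iteratedFDeriv ℝ (i + 1) H (y + x • d)‖ₑ := by
  have hsub : ∀ t ∈ Icc ρ τ, y + t • d ∈ X := fun t ht => hray t ⟨h0.trans ht.1, ht.2.trans h2⟩
  have hat : ∀ t ∈ Icc ρ τ, ContDiffAt ℝ N H (y + t • d) := fun t ht =>
    hH.contDiffAt (hX.mem_nhds (hsub t ht))
  have hline : Continuous fun t : ℝ => y + t • d := by fun_prop
  have hcont : ContinuousOn (fun t : ℝ => fderiv ℝ (iteratedFDeriv ℝ i H) (y + t • d) d)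
      (Icc ρ τ) := by
    intro t ht
    have h3 : ContDiffAt ℝ 1 (iteratedFDeriv ℝ i H) (y + t • d) :=
      (hat t ht).iteratedFDeriv_right (by exact_mod_cast (by omega : 1 + i ≤ N))
    have h4 : ContinuousAt (fderiv ℝ (iteratedFDeriv ℝ i H)) (y + t • d) :=
      (h3.fderiv_right (m := 0) (by simp)).continuousAt
    exact ((h4.comp (f := fun t : ℝ => y + t • d) hline.continuousAt).clm_apply
      continuousAt_const).continuousWithinAt
  have hint := intervalIntegral.integral_eq_sub_of_hasDerivAt_of_le h1
    (f := fun t : ℝ => iteratedFDeriv ℝ i H (y + t • d))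
    (f' := fun t => fderiv ℝ (iteratedFDeriv ℝ i H) (y + t • d) d) (fun t ht =>
      (((hat t ht).continuousAt_iteratedFDeriv (by exact_mod_cast hi.le)).comp
        (f := fun t : ℝ => y + t • d) hline.continuousAt).continuousWithinAt)
    (fun t ht => by
      have h5 : HasDerivAt (fun t : ℝ => y + t • d) d t := by
        simpa using ((hasDerivAt_id t).smul_const d).const_add y
      have h6 : DifferentiableAt ℝ (iteratedFDeriv ℝ i H) (y + t • d) :=
        (hat t (Ioo_subset_Icc_self ht)).differentiableAt_iteratedFDeriv (by exact_mod_cast hi)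
      exact h6.hasFDerivAt.comp_hasDerivAt t h5)
    (hcont.intervalIntegrable_of_Icc h1)
  rw [intervalIntegral.integral_of_le h1] at hint
  have h7 : iteratedFDeriv ℝ i H (y + ρ • d) = iteratedFDeriv ℝ i H (y + τ • d) -
      ∫ t in Ioc ρ τ, fderiv ℝ (iteratedFDeriv ℝ i H) (y + t • d) d := by
    rw [hint]; abel
  rw [h7]
  refine enorm_sub_le.trans ?_
  gcongr
  refine (enorm_integral_le_lintegral_enorm _).trans ?_
  rw [← lintegral_const_mul' _ _ enorm_ne_top]
  refine (lintegral_mono_set Ioc_subset_Icc_self).trans (lintegral_mono fun t => ?_)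
  rw [mul_comm]
  refine (ContinuousLinearMap.le_opENorm _ _).trans (le_of_eq ?_)
  rw [← ofReal_norm, norm_fderiv_iteratedFDeriv, ofReal_norm]

/-- The derivatives of a function at the vertex of a cone are controlled by weighted integrals over
the cone of derivatives up to a higher order. -/
theorem exists_enorm_iteratedFDeriv_sq_le_coneIntegral {r κ : ℝ} (hr : 0 < r) (hκ : 0 < κ)
    (hκ1 : κ ≤ 1) (a : ℕ) :
    ∃ C : ENNReal, C ≠ ⊤ ∧ ∀ {V : Type*} [NormedAddCommGroup V] [NormedSpace ℝ V] [CompleteSpace V]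
      {X : Set E}, IsOpen X → ∀ {N m : ℕ}, m + a + 1 ≤ N → ∀ {H : E → V}, ContDiffOn ℝ N H X →
      ∀ {y e : E}, ‖e‖ ≤ 1 →
      (∀ h, 0 ≤ h → h ≤ r → ∀ v : E, ‖v‖ ≤ κ * h → y + h • e + v ∈ X) →
      ∀ {U : E → ENNReal}, Measurable U →
      (∀ h, 0 ≤ h → h ≤ r → ∀ v : E, ‖v‖ ≤ κ * h → ∀ i ≤ N,
        ‖iteratedFDeriv ℝ i H (y + h • e + v)‖ₑ ^ 2 ≤ U (y + h • e + v)) →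
      ‖iteratedFDeriv ℝ m H y‖ₑ ^ 2 ≤ C * coneIntegral μ r κ (2 * a + 3 / 4) e U y := by
  obtain ⟨C, hC, hS⟩ := exists_sq_le_sum_lintegral_rpow_mul hr (c := 2) (by simp) a
  have hB0 : μ (Metric.closedBall 0 κ) ≠ 0 := (Metric.measure_closedBall_pos μ 0 hκ).ne'
  have hprop : ProperSpace E := FiniteDimensional.proper ℝ _
  have hB : μ (Metric.closedBall 0 κ) ≠ ⊤ := measure_closedBall_lt_top.ne
  refine ⟨(μ (Metric.closedBall 0 κ))⁻¹ * (C * (a + 2 : ℕ)), ?_, ?_⟩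
  · have := ENNReal.inv_ne_top.2 hB0
    finiteness
  intro V _ _ _ X hX N m hN H hH y e he hcone U hU hHU
  have hdir : ∀ w ∈ Metric.closedBall (0 : E) κ, ∀ ρ ∈ Icc 0 r,
      y + ρ • (e + w) = y + ρ • e + ρ • w ∧ ‖ρ • w‖ ≤ κ * ρ := by
    intro w hw ρ hρ
    refine ⟨by rw [smul_add]; abel, ?_⟩
    rw [norm_smul, Real.norm_of_nonneg hρ.1, mul_comm]
    exact mul_le_mul_of_nonneg_right (mem_closedBall_zero_iff.1 hw) hρ.1
  have hray : ∀ w ∈ Metric.closedBall (0 : E) κ, ∀ ρ ∈ Icc 0 r, y + ρ • (e + w) ∈ X := by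
    intro w hw ρ hρ
    rw [(hdir w hw ρ hρ).1]
    exact hcone ρ hρ.1 hρ.2 _ (hdir w hw ρ hρ).2
  have key : ∀ w ∈ Metric.closedBall (0 : E) κ, ‖iteratedFDeriv ℝ m H y‖ₑ ^ 2 ≤
      C * (a + 2 : ℕ) * ∫⁻ ρ in Ioc 0 r, ENNReal.ofReal (ρ ^ (2 * a + 3 / 4 : ℝ)) *
        U (y + ρ • (e + w)) := by
    intro w hw
    have hline : Continuous fun ρ : ℝ => y + ρ • (e + w) := by fun_prop
    -- The value 0 for m + i > N only provides measurability for all i. The inequality uses i ≤ a +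
    -- 1, and m + a + 1 ≤ N.
    let u : ℕ → ℝ → ENNReal := fun i => if m + i ≤ N then
      (Icc 0 r).indicator fun ρ => ‖iteratedFDeriv ℝ (m + i) H (y + ρ • (e + w))‖ₑ else 0
    have hui : ∀ i, m + i ≤ N → u i =
        (Icc 0 r).indicator fun ρ => ‖iteratedFDeriv ℝ (m + i) H (y + ρ • (e + w))‖ₑ :=
      fun i hi => if_pos hi
    have hu : ∀ i, Measurable (u i) := by
      intro i
      by_cases hi : m + i ≤ N
      · rw [hui i hi]
        refine measurable_indicator_of_continuousOn ?_ measurableSet_Icc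
        intro ρ hρ
        exact ((((hH.contDiffAt (hX.mem_nhds (hray w hw ρ hρ))).continuousAt_iteratedFDeriv
          (by exact_mod_cast hi)).comp (f := fun ρ : ℝ => y + ρ • (e + w))
          hline.continuousAt).enorm).continuousWithinAt
      · have : u i = 0 := if_neg hi
        rw [this]
        exact measurable_zero
    have hd : ‖e + w‖ₑ ≤ 2 := by
      rw [← ofReal_norm]
      refine ENNReal.ofReal_le_of_le_toReal ?_
      have := mem_closedBall_zero_iff.1 hw
      exact (norm_add_le _ _).trans (by simp; linarith)
    have h1 := hS u hu (fun i hi ρ τ hρ hρτ hτ => by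
      have hρI : ρ ∈ Icc 0 r := ⟨hρ, hρτ.trans hτ⟩
      have hτI : τ ∈ Icc 0 r := ⟨hρ.trans hρτ, hτ⟩
      rw [hui i (by omega), hui (i + 1) (by omega), indicator_of_mem hρI, indicator_of_mem hτI]
      refine (enorm_iteratedFDeriv_le_add_lintegral hX hH (by omega) (hray w hw) hρ hρτ hτ).trans ?_
      refine add_le_add le_rfl (mul_le_mul' hd (le_of_eq ?_))
      refine setLIntegral_congr_fun measurableSet_Icc fun x hx => ?_
      have hxI : x ∈ Icc 0 r := ⟨hρ.trans hx.1, hx.2.trans hτ⟩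
      rw [indicator_of_mem hxI]
      rfl)
    have hu0 : u 0 0 = ‖iteratedFDeriv ℝ m H y‖ₑ := by
      have h0I : (0 : ℝ) ∈ Icc 0 r := ⟨le_rfl, hr.le⟩
      rw [hui 0 (by omega), indicator_of_mem h0I]
      simp
    rw [hu0] at h1
    refine h1.trans ?_
    rw [mul_assoc]
    gcongr
    calc _ ≤ ∑ i ∈ Finset.range (a + 2), ∫⁻ ρ in Ioc 0 r,
          ENNReal.ofReal (ρ ^ (2 * a + 3 / 4 : ℝ)) * U (y + ρ • (e + w)) := by
          refine Finset.sum_le_sum fun i hi => ?_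
          have hi' := Finset.mem_range.1 hi
          refine setLIntegral_mono' measurableSet_Ioc fun ρ hρ => ?_
          have hρ' : ρ ∈ Icc 0 r := Ioc_subset_Icc_self hρ
          rw [hui i (by omega), indicator_of_mem hρ']
          gcongr
          have h2 := hHU ρ hρ'.1 hρ'.2 _ (hdir w hw ρ hρ').2 (m + i) (by omega)
          rwa [← (hdir w hw ρ hρ').1] at h2
      _ = _ := by rw [Finset.sum_const, Finset.card_range, nsmul_eq_mul]
  -- The estimate along a single ray is averaged over the directions e + w with ‖w‖ ≤ κ, which turns
  -- it into an integral over the cone.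
  have h3 : ‖iteratedFDeriv ℝ m H y‖ₑ ^ 2 * μ (Metric.closedBall 0 κ) ≤
      C * (a + 2 : ℕ) * coneIntegral μ r κ (2 * a + 3 / 4) e U y := by
    have hsw : coneIntegral μ r κ (2 * a + 3 / 4) e U y = ∫⁻ w in Metric.closedBall 0 κ,
        (∫⁻ ρ in Ioc 0 r, ENNReal.ofReal (ρ ^ (2 * a + 3 / 4 : ℝ)) * U (y + ρ • (e + w))) ∂μ := by
      have hm : Measurable (Function.uncurry fun (ρ : ℝ) (w : E) =>
          ENNReal.ofReal (ρ ^ (2 * a + 3 / 4 : ℝ)) * U (y + ρ • (e + w))) := by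
        refine Measurable.mul (by fun_prop) (hU.comp (Continuous.measurable ?_))
        fun_prop
      rw [← lintegral_lintegral_swap hm.aemeasurable]
      unfold coneIntegral coneSection
      refine lintegral_congr fun ρ => ?_
      rw [lintegral_const_mul' _ _ (by finiteness)]
    rw [← setLIntegral_const, hsw, ← lintegral_const_mul' _ _ (by finiteness)]
    exact setLIntegral_mono' Metric.isClosed_closedBall.measurableSet key
  calc _ = (μ (Metric.closedBall 0 κ))⁻¹ *
        (‖iteratedFDeriv ℝ m H y‖ₑ ^ 2 * μ (Metric.closedBall 0 κ)) := by
        rw [mul_comm _ (μ _), ← mul_assoc, ENNReal.inv_mul_cancel hB0 hB, one_mul]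
    _ ≤ _ := by
        rw [mul_assoc]
        gcongr

end ConeIntegral

/-! ### Sobolev embedding and products on domains with the cone property -/

section Product
variable {E : Type*} [NormedAddCommGroup E] [NormedSpace ℝ E] [FiniteDimensional ℝ E]
  [MeasurableSpace E] [BorelSpace E] (μ : Measure E) [μ.IsAddHaarMeasure]
  {V : Type*} [NormedAddCommGroup V] [NormedSpace ℝ V]

/-- The sum of the squared norms of the derivatives of orders `0, …, N`. -/
noncomputable def jetSq (N : ℕ) (H : E → V) (x : E) : ENNReal :=
  ∑ i ∈ Finset.range (N + 1), ‖iteratedFDeriv ℝ i H x‖ₑ ^ 2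

omit [FiniteDimensional ℝ E] [MeasurableSpace E] [BorelSpace E] in
theorem enorm_iteratedFDeriv_sq_le_jetSq {N i : ℕ} (hi : i ≤ N) (H : E → V) (x : E) :
    ‖iteratedFDeriv ℝ i H x‖ₑ ^ 2 ≤ jetSq N H x :=
  Finset.single_le_sum (f := fun i => ‖iteratedFDeriv ℝ i H x‖ₑ ^ 2) (fun _ _ => zero_le)
    (Finset.mem_range.2 (Nat.lt_succ_iff.2 hi))

omit [FiniteDimensional ℝ E] [MeasurableSpace E] [BorelSpace E] in
theorem continuousOn_jetSq {N : ℕ} {H : E → V} {X : Set E} (hX : IsOpen X)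
    (hH : ContDiffOn ℝ N H X) : ContinuousOn (jetSq N H) X := by
  refine continuousOn_finsetSum _ fun i hi => ?_
  intro x hx
  have h1 : ContinuousAt (iteratedFDeriv ℝ i H) x :=
    (hH.contDiffAt (hX.mem_nhds hx)).continuousAt_iteratedFDeriv
      (by exact_mod_cast Nat.lt_succ_iff.1 (Finset.mem_range.1 hi))
  exact ((ENNReal.continuous_pow 2).continuousAt.comp h1.enorm).continuousWithinAt

/-- This is the Sobolev embedding for s > d/2. With a = s - 1 the cone integral has the kernel
exponent 2(s - 1) + 3/4 - d, which exceeds -1 because d + 1 ≤ 2s. -/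
theorem UniformCone.exists_enorm_sq_le_lintegral_jetSq {X : Set E} {r κ : ℝ}
    (hX : UniformCone X r κ) (hXo : IsOpen X) {s : ℕ} (hs : Module.finrank ℝ E < 2 * s) :
    ∃ C : ENNReal, C ≠ ⊤ ∧ ∀ {V : Type*} [NormedAddCommGroup V] [NormedSpace ℝ V] [CompleteSpace V]
      {v : E → V}, ContDiffOn ℝ s v X → ∀ x ∈ X,
        ‖v x‖ₑ ^ 2 ≤ C * ∫⁻ x in X, jetSq s v x ∂μ := by
  obtain ⟨a, rfl⟩ : ∃ a, s = a + 1 := ⟨s - 1, by omega⟩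
  obtain ⟨C, hC, H⟩ := exists_enorm_iteratedFDeriv_sq_le_coneIntegral μ hX.r_pos hX.κ_pos hX.κ_le a
  have hI : ∫⁻ ρ in Ioc 0 r, ENNReal.ofReal (ρ ^ (2 * a + 3 / 4 - Module.finrank ℝ E : ℝ)) ≠ ⊤ := by
    refine lintegral_Ioc_rpow_ne_top r ?_
    have : ((Module.finrank ℝ E : ℕ) : ℝ) + 1 ≤ 2 * (a + 1) := by exact_mod_cast hs
    linarith
  refine ⟨_, ENNReal.mul_ne_top hC hI, fun {V} _ _ _ {v} hv x hx => ?_⟩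
  obtain ⟨e, he, hcone⟩ := hX.cone x hx
  have hcone' := hcone x hx (by simpa using hX.r_pos)
  have hU : Measurable (X.indicator (jetSq (a + 1) v)) :=
    measurable_indicator_of_continuousOn (continuousOn_jetSq hXo hv) hXo.measurableSet
  have h1 := H hXo (N := a + 1) (m := 0) (by omega) hv he hcone' hU (fun h h0 h1 w hw i hi => by
    rw [indicator_of_mem (hcone' h h0 h1 w hw)]
    exact enorm_iteratedFDeriv_sq_le_jetSq hi _ _)
  have h2 : ‖v x‖ₑ = ‖iteratedFDeriv ℝ 0 v x‖ₑ := by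
    rw [← ofReal_norm, ← ofReal_norm, norm_iteratedFDeriv_zero]
  rw [h2, mul_assoc, ← lintegral_indicator hXo.measurableSet]
  refine h1.trans ?_
  gcongr
  exact coneIntegral_le μ r κ _ e hU x

omit [NormedSpace ℝ E] [FiniteDimensional ℝ E] [BorelSpace E] [μ.IsAddHaarMeasure] in
-- Translation preserves the anti-Lipschitz condition. The indicator replaces F by a map that is
-- measurable everywhere and agrees with F on A, as the cone integrals require.
theorem CompBound.lintegral_indicator_comp_add_le {X A : Set E} {m r₁ : ℝ} {K : ENNReal}
    (h : CompBound μ X m r₁ K) (hAX : A ⊆ X) (hA : MeasurableSet A) {F : E → E}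
    (hF : ContinuousOn F A)
    (hanti : ∀ x ∈ A, ∀ y ∈ A, ‖y - x‖ < r₁ → m * ‖y - x‖ ≤ ‖F y - F x‖) {U : E → ENNReal}
    (hU : Measurable U) (z : E) :
    ∫⁻ x in A, U (A.indicator F x + z) ∂μ ≤ K * ∫⁻ x, U x ∂μ := by
  have := h (fun x => F x + z) A hAX hA (hF.add continuousOn_const)
    (fun x hx y hy hxy => by rw [add_sub_add_right_eq_sub]; exact hanti x hx y hy hxy) U hU
  refine le_trans (le_of_eq (setLIntegral_congr_fun hA fun x hx => ?_)) this
  simp only [indicator_of_mem hx]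

/-- The multiplicative estimate behind the algebra property of Sobolev spaces, for the product of a
derivative of `v` with a derivative of `G` composed with an anti-Lipschitz map `F`. -/
theorem UniformCone.exists_lintegral_iteratedFDeriv_comp_mul_le {X : Set E} {r κ : ℝ}
    (hX : UniformCone X r κ) (hXo : IsOpen X) (hXb : Bornology.IsBounded X) {s : ℕ}
    (hs : Module.finrank ℝ E < 2 * s) {m₀ r₁ : ℝ} (hm₀ : 0 < m₀) (hr₁ : 0 < r₁) {m j : ℕ}
    (hm : 1 ≤ m) (hms : m ≤ s) (hj : j ≤ s) (hmj : m + j ≤ s + 1) :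
    ∃ C : ENNReal, C ≠ ⊤ ∧ ∀ F : E → E, ContinuousOn F X → MapsTo F X X →
      (∀ x ∈ X, ∀ y ∈ X, ‖y - x‖ < r₁ → m₀ * ‖y - x‖ ≤ ‖F y - F x‖) →
      ∀ K ⊆ X, IsCompact K → ∃ K' ⊆ X, IsCompact K' ∧
      ∀ {V W : Type*} [NormedAddCommGroup V] [NormedSpace ℝ V] [CompleteSpace V]
        [NormedAddCommGroup W] [NormedSpace ℝ W] [CompleteSpace W] {G : E → V} {v : E → W},
        ContDiff ℝ ∞ G → ContDiffOn ℝ s v X →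
        ∫⁻ x in K, ‖iteratedFDeriv ℝ m G (F x)‖ₑ ^ 2 * ‖iteratedFDeriv ℝ j v x‖ₑ ^ 2 ∂μ ≤
          C * ((∫⁻ y in K', jetSq (s + 1) G y ∂μ) * ∫⁻ x in X, jetSq s v x ∂μ) := by
  have hκ := hX.κ_pos
  have hr := hX.r_pos
  have hprop : ProperSpace E := FiniteDimensional.proper ℝ _
  obtain ⟨N, hN, hcov⟩ := exists_compBound μ hXb hm₀ hr₁
  have htb : TotallyBounded X := (hXb.isCompact_closure.totallyBounded).subset subset_closure
  obtain ⟨t, htX, ht, htc⟩ := Metric.finite_approx_of_totallyBounded htb r hr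
  lift t to Finset E using ht
  choose! e he hcone using hX.cone
  -- Derivatives of G up to order s + 1 are available, so s - m + 1 of them remain above order m. G
  -- is smooth everywhere, but only the values in the set K' swept out by the cones enter the bound.
  obtain ⟨C₁, hC₁, H₁⟩ :=
    exists_enorm_iteratedFDeriv_sq_le_coneIntegral μ hr hκ hX.κ_le (s - m)
  -- the compact set swept out by the cones
  let Q₀ : Set (ℝ × E) := (Icc 0 r ×ˢ Metric.closedBall 0 (κ * r)) ∩ {z | ‖z.2‖ ≤ κ * z.1}
  have hQ₀ : IsCompact Q₀ := (isCompact_Icc.prod (isCompact_closedBall _ _)).inter_right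
    (isClosed_le (by fun_prop) (by fun_prop))
  have hQmem : ∀ h, 0 ≤ h → h ≤ r → ∀ w : E, ‖w‖ ≤ κ * h → (h, w) ∈ Q₀ := fun h h0 h1 w hw =>
    ⟨⟨⟨h0, h1⟩, mem_closedBall_zero_iff.2 (hw.trans (by gcongr))⟩, hw⟩
  have hswept : ∀ F : E → E, ContinuousOn F X → MapsTo F X X → ∀ K ⊆ X, IsCompact K →
      (∀ p, IsCompact (K ∩ F ⁻¹' Metric.closedBall p r)) ∧ ∃ K' ⊆ X, IsCompact K' ∧
      ∀ p ∈ t, ∀ x ∈ K ∩ F ⁻¹' Metric.closedBall p r, ∀ h, 0 ≤ h → h ≤ r → ∀ w : E, ‖w‖ ≤ κ * h →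
        F x + h • e p + w ∈ K' := by
    intro F hF hFX K hKX hK
    have hAc : ∀ p, IsCompact (K ∩ F ⁻¹' Metric.closedBall p r) := fun p =>
      hK.of_isClosed_subset ((hF.mono hKX).preimage_isClosed_of_isClosed hK.isClosed
        Metric.isClosed_closedBall) inter_subset_left
    refine ⟨hAc, ⋃ p ∈ t, (fun z : (ℝ × E) × E => F z.2 + z.1.1 • e p + z.1.2) ''
      (Q₀ ×ˢ (K ∩ F ⁻¹' Metric.closedBall p r)), ?_, ?_, ?_⟩
    · refine iUnion₂_subset fun p hp => ?_
      rintro _ ⟨⟨⟨h, w⟩, x⟩, ⟨hz, hx⟩, rfl⟩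
      have := mem_closedBall_iff_norm.1 hx.2
      exact hcone p (htX hp) (F x) (hFX (hKX hx.1)) (by linarith) h hz.1.1.1 hz.1.1.2 w hz.2
    · refine t.isCompact_biUnion fun p _ => (hQ₀.prod (hAc p)).image_of_continuousOn ?_
      have : ContinuousOn (fun z : (ℝ × E) × E => F z.2) (Q₀ ×ˢ (K ∩ F ⁻¹' Metric.closedBall p r)) :=
        (hF.mono (inter_subset_left.trans hKX)).comp continuousOn_snd fun z hz => hz.2
      exact (this.add (by fun_prop)).add (by fun_prop)
    · intro p hp x hx h h0 h1 w hw
      exact mem_iUnion₂.2 ⟨p, hp, ((h, w), x), ⟨hQmem h h0 h1 w hw, hx⟩, rfl⟩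
  have hbound₁ : ∀ F : E → E, ∀ K K' : Set E, IsCompact K' →
      (∀ p ∈ t, ∀ x ∈ K ∩ F ⁻¹' Metric.closedBall p r, ∀ h, 0 ≤ h → h ≤ r → ∀ w : E, ‖w‖ ≤ κ * h →
        F x + h • e p + w ∈ K') → ∀ {V : Type _} [NormedAddCommGroup V] [NormedSpace ℝ V]
      [CompleteSpace V] {G : E → V}, ContDiff ℝ ∞ G →
      Measurable (K'.indicator (jetSq (s + 1) G)) ∧
      ∀ p ∈ t, ∀ x ∈ K ∩ F ⁻¹' Metric.closedBall p r, ‖iteratedFDeriv ℝ m G (F x)‖ₑ ^ 2 ≤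
        C₁ * coneIntegral μ r κ (2 * (s - m : ℕ) + 3 / 4) (e p) (K'.indicator (jetSq (s + 1) G)) (F x) := by
    intro F K K' hK' hsw V _ _ _ G hG
    have hG' : ContDiffOn ℝ (s + 1 : ℕ) G univ := (hG.of_le (by exact_mod_cast le_top)).contDiffOn
    have hU : Measurable (K'.indicator (jetSq (s + 1) G)) :=
      measurable_indicator_of_continuousOn
        ((continuousOn_jetSq isOpen_univ hG').mono (subset_univ _)) hK'.measurableSet
    refine ⟨hU, fun p hp x hx => ?_⟩
    exact H₁ isOpen_univ (N := s + 1) (m := m) (by omega) hG' (he p (htX hp))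
      (fun _ _ _ _ _ => mem_univ _) hU (fun h h0 h1 w hw i hi => by
        rw [indicator_of_mem (hsw p hp x hx h h0 h1 w hw)]
        exact enorm_iteratedFDeriv_sq_le_jetSq hi _ _)
  have hAcov : ∀ F : E → E, MapsTo F X X → ∀ K ⊆ X, K ⊆ ⋃ p ∈ t, K ∩ F ⁻¹' Metric.closedBall p r := by
    intro F hFX K hKX x hx
    obtain ⟨p, hp, hxp⟩ := mem_iUnion₂.1 (htc (hFX (hKX hx)))
    exact mem_iUnion₂.2 ⟨p, hp, hx, Metric.ball_subset_closedBall hxp⟩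
  have hs' : ((Module.finrank ℝ E : ℕ) : ℝ) + 1 ≤ 2 * s := by exact_mod_cast hs
  have hcast : ((s - m : ℕ) : ℝ) = s - m := by push_cast [hms]; ring
  -- For j < s both factors are bounded by cone integrals. For j = s no derivative of v is left for
  -- a cone integral, but then m = 1 and DG is bounded by the Sobolev embedding.
  rcases hj.lt_or_eq with hjs | rfl
  · obtain ⟨C₂, hC₂, H₂⟩ :=
      exists_enorm_iteratedFDeriv_sq_le_coneIntegral μ hr hκ hX.κ_le (s - j - 1)
    have hcast2 : ((s - j - 1 : ℕ) : ℝ) = s - j - 1 := by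
      rw [Nat.sub_sub, Nat.cast_sub (by omega)]; push_cast; ring
    have hmj' : (m : ℝ) + j ≤ s + 1 := by exact_mod_cast hmj
    have hjs' : (j : ℝ) + 1 ≤ s := by exact_mod_cast hjs
    have hms' : (m : ℝ) ≤ s := by exact_mod_cast hms
    -- With x₀ as large as p + 3/4 permits, p - x₀ ≥ -3/4. If x₀ = d the second condition is clear;
    -- otherwise it reads p + q - d + 3/4 > -1, and p + q - d ≥ -3/2 because m + j ≤ s + 1 and d + 1
    -- ≤ 2s.
    obtain ⟨C₃, hC₃, H₃⟩ := exists_lintegral_coneIntegral_mul_le μ r κ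
      (p := 2 * (s - m : ℕ) + 3 / 4) (q := 2 * (s - j - 1 : ℕ) + 3 / 4)
      (x₀ := min (Module.finrank ℝ E : ℝ) (2 * (s - m : ℕ) + 3 / 2)) (by positivity)
      (min_le_left _ _)
      (by have := min_le_right (Module.finrank ℝ E : ℝ) (2 * (s - m : ℕ) + 3 / 2); linarith)
      (by
        rcases min_choice (Module.finrank ℝ E : ℝ) (2 * (s - m : ℕ) + 3 / 2) with h | h <;> rw [h]
        · rw [sub_self]; have : (0 : ℝ) ≤ (s - j - 1 : ℕ) := by positivity
          linarith
        · rw [hcast, hcast2]; linarith) hN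
    refine ⟨(t ×ˢ t).card * (C₁ * C₂ * C₃), by finiteness, fun F hF hFX hanti K hKX hK => ?_⟩
    obtain ⟨hAc, K', hK'X, hK', hsw⟩ := hswept F hF hFX K hKX hK
    refine ⟨K', hK'X, hK', fun {V W} _ _ _ _ _ _ {G v} hG hv => ?_⟩
    obtain ⟨hU, hGb⟩ := hbound₁ F K K' hK' hsw hG
    set U := K'.indicator (jetSq (s + 1) G)
    have hZ : Measurable (X.indicator (jetSq s v)) :=
      measurable_indicator_of_continuousOn (continuousOn_jetSq hXo hv) hXo.measurableSet
    set Z := X.indicator (jetSq s v)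
    -- On such a piece F x is near one point of the net and x near another, so the axes of both
    -- cones are constant.
    let A : E × E → Set E := fun q => (K ∩ F ⁻¹' Metric.closedBall q.1 r) ∩ Metric.closedBall q.2 r
    have hA : ∀ q, MeasurableSet (A q) := fun q =>
      (hAc q.1).measurableSet.inter Metric.isClosed_closedBall.measurableSet
    have hAX : ∀ q, A q ⊆ X := fun q x hx => hKX hx.1.1
    have hcov2 : K ⊆ ⋃ q ∈ t ×ˢ t, A q := by
      intro x hx
      obtain ⟨p, hp, hxp⟩ := mem_iUnion₂.1 (hAcov F hFX K hKX hx)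
      obtain ⟨q, hq, hxq⟩ := mem_iUnion₂.1 (htc (hKX hx))
      exact mem_iUnion₂.2 ⟨(p, q), Finset.mem_product.2 ⟨hp, hq⟩, hxp,
        Metric.ball_subset_closedBall hxq⟩
    have key : ∀ q ∈ t ×ˢ t, ∫⁻ x in A q,
        ‖iteratedFDeriv ℝ m G (F x)‖ₑ ^ 2 * ‖iteratedFDeriv ℝ j v x‖ₑ ^ 2 ∂μ ≤
        C₁ * C₂ * C₃ * ((∫⁻ x, U x ∂μ) * ∫⁻ x, Z x ∂μ) := by
      intro q hq
      have hq1 := (Finset.mem_product.1 hq).1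
      have hq2 := (Finset.mem_product.1 hq).2
      have hFA : ContinuousOn F (A q) := hF.mono (hAX q)
      have hFm : Measurable ((A q).indicator F) := measurable_indicator_of_continuousOn hFA (hA q)
      have h3 := H₃ (e q.1) (e q.2) hU hZ hFm (hcov.lintegral_indicator_comp_add_le μ (hAX q) (hA q)
        hFA (fun x hx y hy => hanti x (hAX q hx) y (hAX q hy)) hU)
      calc _ ≤ ∫⁻ x in A q, C₁ * C₂ * (coneIntegral μ r κ (2 * (s - m : ℕ) + 3 / 4) (e q.1) U
            ((A q).indicator F x) *
            coneIntegral μ r κ (2 * (s - j - 1 : ℕ) + 3 / 4) (e q.2) Z x) ∂μ := by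
            refine setLIntegral_mono' (hA q) fun x hx => ?_
            rw [indicator_of_mem hx]
            have hxq := mem_closedBall_iff_norm.1 hx.2
            have b1 := hGb q.1 hq1 x hx.1
            have hc2 : ∀ h, 0 ≤ h → h ≤ r → ∀ w : E, ‖w‖ ≤ κ * h → x + h • e q.2 + w ∈ X :=
              hcone q.2 (htX hq2) x (hAX q hx) (by linarith)
            have b2 := H₂ hXo (N := s) (m := j) (by omega) hv (he q.2 (htX hq2)) hc2 hZ
              (fun h h0 h1 w hw i hi => by
                simp only [Z]
                rw [indicator_of_mem (hc2 h h0 h1 w hw)]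
                exact enorm_iteratedFDeriv_sq_le_jetSq hi _ _)
            calc _ ≤ _ := mul_le_mul' b1 b2
              _ = _ := by ring
        _ ≤ _ := by
            rw [lintegral_const_mul' _ _ (by finiteness), mul_assoc (C₁ * C₂)]
            gcongr
    calc _ ≤ ∫⁻ x in ⋃ q ∈ t ×ˢ t, A q,
          ‖iteratedFDeriv ℝ m G (F x)‖ₑ ^ 2 * ‖iteratedFDeriv ℝ j v x‖ₑ ^ 2 ∂μ :=
          lintegral_mono_set hcov2
      _ ≤ _ := lintegral_biUnion_finset_le _ _ _ _
      _ ≤ _ := Finset.sum_le_sum key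
      _ = _ := by
          rw [Finset.sum_const, nsmul_eq_mul, lintegral_indicator hK'.measurableSet,
            lintegral_indicator hXo.measurableSet]
          ring
  · obtain rfl : m = 1 := by omega
    have hI : ∫⁻ ρ in Ioc 0 r,
        ENNReal.ofReal (ρ ^ (2 * (j - 1 : ℕ) + 3 / 4 - Module.finrank ℝ E : ℝ)) ≠ ⊤ := by
      refine lintegral_Ioc_rpow_ne_top r ?_
      rw [hcast]
      push_cast
      linarith
    refine ⟨C₁ * _, ENNReal.mul_ne_top hC₁ hI, fun F hF hFX hanti K hKX hK => ?_⟩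
    obtain ⟨hAc, K', hK'X, hK', hsw⟩ := hswept F hF hFX K hKX hK
    refine ⟨K', hK'X, hK', fun {V W} _ _ _ _ _ _ {G v} hG hv => ?_⟩
    obtain ⟨hU, hGb⟩ := hbound₁ F K K' hK' hsw hG
    set I := ∫⁻ ρ in Ioc 0 r,
        ENNReal.ofReal (ρ ^ (2 * (j - 1 : ℕ) + 3 / 4 - Module.finrank ℝ E : ℝ))
    have hpt : ∀ x ∈ K, ‖iteratedFDeriv ℝ 1 G (F x)‖ₑ ^ 2 ≤
        C₁ * I * ∫⁻ y in K', jetSq (j + 1) G y ∂μ := by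
      intro x hx
      obtain ⟨p, hp, hxp⟩ := mem_iUnion₂.1 (hAcov F hFX K hKX hx)
      refine (hGb p hp x hxp).trans ?_
      rw [mul_assoc, ← lintegral_indicator hK'.measurableSet]
      gcongr
      exact coneIntegral_le μ r κ _ (e p) hU (F x)
    calc _ ≤ ∫⁻ x in K, (C₁ * I * ∫⁻ y in K', jetSq (j + 1) G y ∂μ) * jetSq j v x ∂μ := by
          refine setLIntegral_mono' hK.measurableSet fun x hx => ?_
          exact mul_le_mul' (hpt x hx) (enorm_iteratedFDeriv_sq_le_jetSq le_rfl _ _)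
      _ = (C₁ * I * ∫⁻ y in K', jetSq (j + 1) G y ∂μ) * ∫⁻ x in K, jetSq j v x ∂μ := by
          refine lintegral_const_mul'' _ ?_
          exact ((continuousOn_jetSq hXo hv).mono hKX).aemeasurable hK.measurableSet
      _ ≤ _ := by
          rw [mul_assoc (C₁ * I)]
          gcongr

end Product

/-! ### Symmetry of higher derivatives -/

section Symmetry
variable {E : Type*} [NormedAddCommGroup E] [NormedSpace ℝ E]
  {V : Type*} [NormedAddCommGroup V] [NormedSpace ℝ V]

theorem iteratedFDeriv_succ_apply_eq_fderiv {n : ℕ} {f : E → V} {x : E}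
    (hf : ContDiffAt ℝ (n + 1 : ℕ) f x) (m : Fin (n + 1) → E) :
    iteratedFDeriv ℝ (n + 1) f x m =
      fderiv ℝ (fun y => iteratedFDeriv ℝ n f y (Fin.tail m)) x (m 0) := by
  have hd : DifferentiableAt ℝ (iteratedFDeriv ℝ n f) x :=
    hf.differentiableAt_iteratedFDeriv (by exact_mod_cast Nat.lt_succ_self n)
  rw [iteratedFDeriv_succ_apply_left, fderiv_continuousMultilinear_apply_const_apply hd]

/-- The derivative of order `n` of a function of class `C^n` is symmetric. -/
theorem iteratedFDeriv_comp_perm_of_contDiffAt (n : ℕ) : ∀ {f : E → V} {x : E},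
    ContDiffAt ℝ n f x → ∀ (v : Fin n → E) (σ : Equiv.Perm (Fin n)),
    iteratedFDeriv ℝ n f x (v ∘ σ) = iteratedFDeriv ℝ n f x v := by
  induction n with
  | zero => intro f x _ v σ; congr 1; exact Subsingleton.elim _ _
  | succ n ih =>
    intro f x hf v σ
    have hev : ∀ᶠ y in nhds x, ContDiffAt ℝ (n + 1 : ℕ) f y := hf.eventually (by simp)
    -- Adjacent transpositions generate the permutations. The one that moves the outermost variable
    -- is the symmetry of a second derivative; the others act under the outermost derivative, where
    -- the induction hypothesis applies.
    have hσ : σ ∈ Submonoid.closure (range fun i : Fin n => Equiv.swap i.castSucc i.succ) := by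
      rw [Equiv.Perm.mclosure_swap_castSucc_succ]; trivial
    induction hσ using Submonoid.closure_induction generalizing v with
    | one => rfl
    | mul σ τ _ _ h1 h2 =>
      have : v ∘ (σ * τ : Equiv.Perm (Fin (n + 1))) = (v ∘ σ) ∘ τ := rfl
      rw [this, h2, h1]
    | mem σ hσ =>
      obtain ⟨i, rfl⟩ := hσ
      simp only
      rcases n with _ | n
      · exact i.elim0
      refine Fin.cases ?_ (fun j => ?_) i
      · -- exchange of the two outer variables
        set m := v ∘ (Equiv.swap (Fin.castSucc (0 : Fin (n + 1))) (Fin.succ 0)) with hm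
        have hm0 : m 0 = v 1 := by simp [hm]
        have hm1 : m 1 = v 0 := by simp [hm]
        have htt : Fin.tail (Fin.tail m) = Fin.tail (Fin.tail v) := by
          ext1 k
          simp only [Fin.tail, hm, Function.comp_apply]
          rw [Equiv.swap_apply_of_ne_of_ne]
          · simp [Fin.ext_iff]
          · simp [Fin.ext_iff]
        have key : ∀ w : Fin (n + 2) → E, iteratedFDeriv ℝ (n + 2) f x w =
            fderiv ℝ (fderiv ℝ fun y => iteratedFDeriv ℝ n f y (Fin.tail (Fin.tail w))) x
              (w 0) (w 1) := by
          intro w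
          rw [iteratedFDeriv_succ_apply_eq_fderiv hf]
          have h1 : (fun y => iteratedFDeriv ℝ (n + 1) f y (Fin.tail w)) =ᶠ[nhds x]
              fun y => fderiv ℝ (fun z => iteratedFDeriv ℝ n f z (Fin.tail (Fin.tail w))) y
                (w 1) := by
            filter_upwards [hev] with y hy
            rw [iteratedFDeriv_succ_apply_eq_fderiv
              (hy.of_le (by exact_mod_cast Nat.le_succ (n + 1)))]
            rfl
          rw [h1.fderiv_eq]
          have h2 : ContDiffAt ℝ 2 (fun z => iteratedFDeriv ℝ n f z (Fin.tail (Fin.tail w))) x := by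
            have : ContDiffAt ℝ 2 (iteratedFDeriv ℝ n f) x :=
              hf.iteratedFDeriv_right (by exact_mod_cast (by omega : 2 + n ≤ n + 1 + 1))
            exact (ContinuousMultilinearMap.apply ℝ (fun _ : Fin n => E) V
              _).contDiff.contDiffAt.comp x this
          have h3 : DifferentiableAt ℝ
              (fderiv ℝ fun z => iteratedFDeriv ℝ n f z (Fin.tail (Fin.tail w))) x :=
            (h2.fderiv_right (m := 1) (by norm_num)).differentiableAt (by simp)
          rw [fderiv_clm_apply h3 (differentiableAt_const _)]
          simp
        have hsymm : ContDiffAt ℝ 2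
            (fun z => iteratedFDeriv ℝ n f z (Fin.tail (Fin.tail v))) x := by
          have : ContDiffAt ℝ 2 (iteratedFDeriv ℝ n f) x :=
            hf.iteratedFDeriv_right (by exact_mod_cast (by omega : 2 + n ≤ n + 1 + 1))
          exact (ContinuousMultilinearMap.apply ℝ (fun _ : Fin n => E) V
              _).contDiff.contDiffAt.comp x this
        rw [key m, key v, htt, hm0, hm1]
        exact (hsymm.isSymmSndFDerivAt (by simp)).eq _ _
      · set m := v ∘ (Equiv.swap (Fin.castSucc (Fin.succ j)) (Fin.succ (Fin.succ j))) with hm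
        have hm0 : m 0 = v 0 := by
          simp only [hm, Function.comp_apply]
          rw [Equiv.swap_apply_of_ne_of_ne]
          · simp [Fin.ext_iff]
          · simp [Fin.ext_iff]
        have ht : Fin.tail m = Fin.tail v ∘ (Equiv.swap (Fin.castSucc j) (Fin.succ j)) := by
          ext1 k
          simp only [Fin.tail, hm, Function.comp_apply]
          rw [Fin.castSucc_succ, ← (Fin.succ_injective (n + 1)).map_swap]
        rw [iteratedFDeriv_succ_apply_eq_fderiv hf, iteratedFDeriv_succ_apply_eq_fderiv hf, hm0]
        have h1 : (fun y => iteratedFDeriv ℝ (n + 1) f y (Fin.tail m)) =ᶠ[nhds x]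
            fun y => iteratedFDeriv ℝ (n + 1) f y (Fin.tail v) := by
          filter_upwards [hev] with y hy
          rw [ht]
          exact ih (hy.of_le (by exact_mod_cast Nat.le_succ (n + 1))) _ _
        rw [h1.fderiv_eq]

theorem iteratedFDeriv_comp_equiv {N M : ℕ} (τ : Fin M ≃ Fin N) {f : E → V} {x : E}
    (hf : ContDiffAt ℝ N f x) (v : Fin N → E) :
    iteratedFDeriv ℝ M f x (v ∘ τ) = iteratedFDeriv ℝ N f x v := by
  obtain rfl : M = N := by simpa using Fintype.card_congr τ
  exact iteratedFDeriv_comp_perm_of_contDiffAt _ hf v τ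

end Symmetry

/-! ### Partial derivatives and the full derivative -/

section PartialDeriv
variable {n : ℕ} {V : Type*} [NormedAddCommGroup V] [NormedSpace ℝ V]

/-- Here α_j counts the positions at which the index j occurs. `partialDeriv` takes the coordinate
vectors sorted by index, so an arbitrary list is brought to that form by symmetry. -/
theorem exists_multiIndex_partialDeriv_eq {s N : ℕ} (hN : N ≤ s) (i : Fin N → Fin n) :
    ∃ α : MultiIndex n s, ∀ {f : EuclideanSpace ℝ (Fin n) → V} {x : EuclideanSpace ℝ (Fin n)},
      ContDiffAt ℝ N f x → iteratedFDeriv ℝ N f x (fun k => EuclideanSpace.single (i k) (1 : ℝ)) =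
        partialDeriv α.toFun f x := by
  classical
  let α : Fin n → ℕ := fun j => Fintype.card {k // i k = j}
  let ε : (Σ j, Fin (α j)) ≃ Fin N :=
    (Equiv.sigmaCongrRight fun j => (Fintype.equivFin {k // i k = j}).symm).trans
      (Equiv.sigmaFiberEquiv i)
  have hε : ∀ q, i (ε q) = q.1 := fun q => ((Fintype.equivFin {k // i k = q.1}).symm q.2).2
  let τ : Fin (∑ j, α j) ≃ Fin N := finSigmaFinEquiv.symm.trans ε
  have hsum : ∑ j, α j = N := by simpa using Fintype.card_congr τ
  have hle : ∀ j, α j ≤ s := fun j =>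
    (Finset.single_le_sum (f := α) (fun _ _ => Nat.zero_le _) (Finset.mem_univ j)).trans
      (hsum.le.trans hN)
  refine ⟨⟨fun j => ⟨α j, Nat.lt_succ_of_le (hle j)⟩, hsum.le.trans hN⟩, fun {f x} hf => ?_⟩
  rw [← iteratedFDeriv_comp_equiv τ hf]
  unfold partialDeriv
  change _ = iteratedFDeriv ℝ (∑ j, α j) f x _
  congr 1
  ext1 k
  simp only [Function.comp_apply]
  congr 1
  exact hε _

theorem norm_partialDeriv_le (α : Fin n → ℕ) (f : EuclideanSpace ℝ (Fin n) → V)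
    (x : EuclideanSpace ℝ (Fin n)) :
    ‖partialDeriv α f x‖ ≤ ‖iteratedFDeriv ℝ (∑ i, α i) f x‖ := by
  unfold partialDeriv
  refine (ContinuousMultilinearMap.le_opNorm _ _).trans (le_of_eq ?_)
  simp

theorem ContinuousMultilinearMap.norm_le_sum_single {N : ℕ}
    (D : ContinuousMultilinearMap ℝ (fun _ : Fin N => EuclideanSpace ℝ (Fin n)) V) :
    ‖D‖ ≤ ∑ i : Fin N → Fin n, ‖D fun k => EuclideanSpace.single (i k) (1 : ℝ)‖ := by
  refine ContinuousMultilinearMap.opNorm_le_bound (by positivity) fun v => ?_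
  have hv : v = fun k => ∑ j, v k j • EuclideanSpace.single j (1 : ℝ) := by
    ext k l
    simp [Pi.single_apply]
  conv_lhs => rw [hv]
  rw [ContinuousMultilinearMap.map_sum, Finset.sum_mul]
  refine (norm_sum_le _ _).trans (Finset.sum_le_sum fun i _ => ?_)
  rw [ContinuousMultilinearMap.map_smul_univ, norm_smul, mul_comm, norm_prod]
  gcongr with k
  exact PiLp.norm_apply_le (v k) (i k)

/-- The norm of a derivative of order N is at most the sum of its values on the n^N lists of
coordinate vectors, each of which is a partial derivative. This relates the norms used in the
estimates to those defining H^s. -/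
theorem exists_jetSq_le_sum_partialDeriv (n s : ℕ) : ∃ C : ENNReal, C ≠ ⊤ ∧
    ∀ {V : Type*} [NormedAddCommGroup V] [NormedSpace ℝ V] {f : EuclideanSpace ℝ (Fin n) → V}
      {x : EuclideanSpace ℝ (Fin n)}, ContDiffAt ℝ s f x →
      jetSq s f x ≤ C * ∑ α : MultiIndex n s, ‖partialDeriv α.toFun f x‖ₑ ^ 2 := by
  refine ⟨∑ N ∈ Finset.range (s + 1), ((n ^ N : ℕ) : ENNReal) ^ 2,
    ENNReal.sum_ne_top.2 fun _ _ => ENNReal.pow_ne_top (ENNReal.natCast_ne_top _),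
    fun {V} _ _ {f x} hf => ?_⟩
  unfold jetSq
  rw [Finset.sum_mul]
  refine Finset.sum_le_sum fun N hN => ?_
  have hNs : N ≤ s := Nat.lt_succ_iff.1 (Finset.mem_range.1 hN)
  set T := ∑ α : MultiIndex n s, ‖partialDeriv α.toFun f x‖ₑ ^ 2
  set M := Finset.univ.sup fun α : MultiIndex n s => ‖partialDeriv α.toFun f x‖ₑ with hM
  have hMT : M ^ 2 ≤ T := by
    obtain ⟨α, -, hα⟩ := Finset.exists_mem_eq_sup (Finset.univ : Finset (MultiIndex n s))
      ⟨MultiIndex.zero n s, Finset.mem_univ _⟩ fun α => ‖partialDeriv α.toFun f x‖ₑ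
    rw [hM, hα]
    exact Finset.single_le_sum (f := fun α : MultiIndex n s => ‖partialDeriv α.toFun f x‖ₑ ^ 2)
      (fun _ _ => zero_le) (Finset.mem_univ α)
  have h1 : ‖iteratedFDeriv ℝ N f x‖ₑ ≤ (n ^ N : ℕ) * M := by
    calc ‖iteratedFDeriv ℝ N f x‖ₑ ≤ ∑ i : Fin N → Fin n,
          ‖iteratedFDeriv ℝ N f x fun k => EuclideanSpace.single (i k) (1 : ℝ)‖ₑ := by
          simp only [← ofReal_norm]
          rw [← ENNReal.ofReal_sum_of_nonneg (fun _ _ => norm_nonneg _)]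
          exact ENNReal.ofReal_le_ofReal (ContinuousMultilinearMap.norm_le_sum_single _)
      _ ≤ ∑ i : Fin N → Fin n, M := by
          refine Finset.sum_le_sum fun i _ => ?_
          obtain ⟨α, hα⟩ := exists_multiIndex_partialDeriv_eq (V := V) hNs i
          rw [hα (hf.of_le (by exact_mod_cast hNs))]
          exact Finset.le_sup (f := fun α : MultiIndex n s => ‖partialDeriv α.toFun f x‖ₑ)
            (Finset.mem_univ α)
      _ = _ := by simp
  calc _ ≤ ((n ^ N : ℕ) * M) ^ 2 := ENNReal.pow_le_pow_left h1
    _ = ((n ^ N : ℕ) : ENNReal) ^ 2 * M ^ 2 := by ring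
    _ ≤ _ := by gcongr

end PartialDeriv

/-! ### Integration by parts and derivatives of convolutions -/

section IntegrationByParts
theorem continuous_smul_of_tsupport_subset {E V : Type*} [TopologicalSpace E]
    [NormedAddCommGroup V] [NormedSpace ℝ V] {X : Set E} {φ : E → ℝ} {H : E → V}
    (hφ : Continuous φ) (hX : tsupport φ ⊆ X) (hH : ∀ x ∈ X, ContinuousAt H x) :
    Continuous fun x => φ x • H x :=
  continuous_of_tsupport fun x hx =>
    hφ.continuousAt.smul (hH x (hX (tsupport_smul_subset_left φ H hx)))

variable {E : Type*} [NormedAddCommGroup E] [NormedSpace ℝ E]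
  {V : Type*} [NormedAddCommGroup V] [NormedSpace ℝ V]

theorem tsupport_fderiv_apply_subset {F : Type*} [NormedAddCommGroup F] [NormedSpace ℝ F]
    (φ : E → F) (v : E) :
    tsupport (fun x => fderiv ℝ φ x v) ⊆ tsupport φ :=
  (tsupport_comp_subset (g := fun D : E →L[ℝ] F => D v) (by simp) _).trans
    (tsupport_fderiv_subset ℝ)

theorem iteratedFDeriv_comp_const_sub_apply {N : ℕ} {g : E → V} (hg : ContDiff ℝ ∞ g) (x t : E)
    (v : Fin N → E) : iteratedFDeriv ℝ N (fun y => g (x - y)) t v =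
      (-1 : ℝ) ^ N • iteratedFDeriv ℝ N g (x - t) v := by
  have h1 : (fun y => g (x - y)) =
      fun y => (g ∘ (-ContinuousLinearMap.id ℝ E : E →L[ℝ] E)) (y - x) := by
    ext y; simp
  rw [h1, iteratedFDeriv_comp_sub,
    ContinuousLinearMap.iteratedFDeriv_comp_right _ hg _ (by exact_mod_cast le_top)]
  simp only [ContinuousMultilinearMap.compContinuousLinearMap_apply]
  have h2 : (fun i : Fin N => (-ContinuousLinearMap.id ℝ E : E →L[ℝ] E) (v i)) =
      fun i => (-1 : ℝ) • v i := by ext i; simp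
  rw [h2, ContinuousMultilinearMap.map_smul_univ]
  simp

variable [MeasurableSpace E] [BorelSpace E]

omit [NormedSpace ℝ E] in
theorem integrable_smul_of_tsupport_subset (μ : Measure E) [IsFiniteMeasureOnCompacts μ]
    {X : Set E} {φ : E → ℝ} {H : E → V}
    (hφ : Continuous φ) (hc : HasCompactSupport φ) (hX : tsupport φ ⊆ X)
    (hH : ∀ x ∈ X, ContinuousAt H x) : Integrable (fun x => φ x • H x) μ :=
  (continuous_smul_of_tsupport_subset hφ hX hH).integrable_of_hasCompactSupport hc.smul_right

/-- Integration by parts of all orders, against a test function supported where `H` is smooth. -/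
theorem integral_smul_iteratedFDeriv_eq [FiniteDimensional ℝ E] (μ : Measure E)
    [μ.IsAddHaarMeasure] {X : Set E} (N : ℕ) : ∀ (v : Fin N → E) {φ : E → ℝ} {H : E → V},
    ContDiff ℝ ∞ φ → HasCompactSupport φ → tsupport φ ⊆ X → (∀ x ∈ X, ContDiffAt ℝ N H x) →
    ∫ x, φ x • iteratedFDeriv ℝ N H x v ∂μ =
      (-1 : ℝ) ^ N • ∫ x, iteratedFDeriv ℝ N φ x v • H x ∂μ := by
  induction N with
  | zero => intro v φ H _ _ _ _; simp
  | succ N ih =>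
    intro v φ H hφ hc hX hH
    have hφ1 : ContDiff ℝ ∞ fun x => fderiv ℝ φ x (v 0) :=
      (hφ.fderiv_right (m := ∞) (by simp)).clm_apply contDiff_const
    have hs1 : tsupport (fun x => fderiv ℝ φ x (v 0)) ⊆ X :=
      (tsupport_fderiv_apply_subset φ (v 0)).trans hX
    have hc1 : HasCompactSupport fun x => fderiv ℝ φ x (v 0) :=
      hc.fderiv_apply ℝ (v 0)
    have hHN : ∀ x ∈ X, ContDiffAt ℝ 1
        (fun y => iteratedFDeriv ℝ N H y (Fin.tail v)) x := fun x hx =>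
      (ContinuousMultilinearMap.apply ℝ (fun _ : Fin N => E) V _).contDiff.contDiffAt.comp x
        ((hH x hx).iteratedFDeriv_right (m := 1) (by exact_mod_cast (by omega : 1 + N ≤ N + 1)))
    have h0 : ∀ x, φ x • iteratedFDeriv ℝ (N + 1) H x v =
        φ x • fderiv ℝ (fun y => iteratedFDeriv ℝ N H y (Fin.tail v)) x (v 0) := by
      intro x
      by_cases hx : x ∈ X
      · rw [iteratedFDeriv_succ_apply_eq_fderiv (hH x hx)]
      · rw [image_eq_zero_of_notMem_tsupport fun h => hx (hX h), zero_smul, zero_smul]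
    simp_rw [h0]
    rw [integral_smul_fderiv_eq_neg_fderiv_smul_of_integrable (μ := μ)
      (integrable_smul_of_tsupport_subset μ hφ1.continuous hc1 hs1 fun x hx =>
        (hHN x hx).continuousAt)
      (integrable_smul_of_tsupport_subset μ hφ.continuous hc hX fun x hx =>
        (((hHN x hx).fderiv_right (m := 0) (by simp)).continuousAt).clm_apply continuousAt_const)
      (integrable_smul_of_tsupport_subset μ hφ.continuous hc hX fun x hx =>
        (hHN x hx).continuousAt)
      (fun x _ => hφ.contDiffAt.differentiableAt (by simp))
      (fun x hx => (hHN x (hX hx)).differentiableAt (by simp)),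
      ih _ hφ1 hc1 hs1 fun x hx => (hH x hx).of_le (by exact_mod_cast Nat.le_succ N),
      pow_succ, mul_neg_one, neg_smul]
    congr 3
    ext1 x
    congr 1
    -- Integration by parts has put the direction v 0 on φ first, hence innermost, whereas it is the
    -- outermost variable in the derivative of order N + 1. A rotation of the variables reconciles
    -- the two.
    have hr : iteratedFDeriv ℝ (N + 1) φ x v =
        iteratedFDeriv ℝ (N + 1) φ x (Fin.snoc (Fin.tail v) (v 0)) := by
      rw [← iteratedFDeriv_comp_perm_of_contDiffAt (N + 1)
        (hφ.contDiffAt.of_le (by exact_mod_cast le_top)) v (finRotate (N + 1))]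
      congr 1
      ext1 k
      refine Fin.lastCases ?_ (fun j => ?_) k
      · simp
      · simp [Fin.tail]
    rw [hr, iteratedFDeriv_succ_apply_right]
    simp only [Fin.init_snoc, Fin.snoc_last]
    have hd : ContDiffAt ℝ N (fderiv ℝ φ) x :=
      (hφ.fderiv_right (m := N) (by exact_mod_cast le_top)).contDiffAt
    have := ((ContinuousLinearMap.apply ℝ ℝ (v 0)).iteratedFDeriv_comp_left hd le_rfl)
    exact congrArg (fun D => D (Fin.tail v)) this

theorem iteratedFDeriv_convolution_right_apply [FiniteDimensional ℝ E] (μ : Measure E)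
    [μ.IsAddHaarMeasure]
    {W : E → V} (hW : LocallyIntegrable W μ) {ρ : E → ℝ} (hρ : ContDiff ℝ ∞ ρ)
    (hc : HasCompactSupport ρ) (N : ℕ) (v : Fin N → E) (x : E) :
    iteratedFDeriv ℝ N (convolution W ρ (ContinuousLinearMap.lsmul ℝ ℝ).flip μ) x v =
      convolution W (fun y => iteratedFDeriv ℝ N ρ y v) (ContinuousLinearMap.lsmul ℝ ℝ).flip μ x := by
  induction N generalizing x with
  | zero => simp
  | succ N ih =>
    have hG : ContDiff ℝ ∞ (convolution W ρ (ContinuousLinearMap.lsmul ℝ ℝ).flip μ) :=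
      hc.contDiff_convolution_right (n := ⊤) _ hW hρ
    have hD : ContDiff ℝ ∞ fun y => iteratedFDeriv ℝ N ρ y (Fin.tail v) :=
      (ContinuousMultilinearMap.apply ℝ (fun _ : Fin N => E) ℝ _).contDiff.comp
        (hρ.iteratedFDeriv_right (m := ∞) (by exact_mod_cast le_top))
    have hDc : HasCompactSupport fun y => iteratedFDeriv ℝ N ρ y (Fin.tail v) :=
      (hc.iteratedFDeriv (𝕜 := ℝ) N).comp_left
        (g := fun D : ContinuousMultilinearMap ℝ (fun _ : Fin N => E) ℝ => D (Fin.tail v)) rfl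
    rw [iteratedFDeriv_succ_apply_eq_fderiv (hG.contDiffAt.of_le (by exact_mod_cast le_top))]
    rw [funext fun y => ih (Fin.tail v) y,
      (hDc.hasFDerivAt_convolution_right _ hW (hD.of_le (by exact_mod_cast le_top)) x).fderiv,
      convolution_precompR_apply _ hW (hDc.fderiv ℝ) (hD.continuous_fderiv (by simp))]
    congr 1
    ext1 y
    rw [iteratedFDeriv_succ_apply_eq_fderiv (hρ.contDiffAt.of_le (by exact_mod_cast le_top))]

end IntegrationByParts

/-! ### Mollification in quadratic mean -/

theorem eLpNorm_two_sq {α V : Type*} [MeasurableSpace α] [NormedAddCommGroup V] (μ : Measure α)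
    (f : α → V) : eLpNorm f 2 μ ^ 2 = ∫⁻ x, ‖f x‖ₑ ^ 2 ∂μ := by
  have := eLpNorm_nnreal_pow_eq_lintegral (f := f) (μ := μ) (p := 2) two_ne_zero
  simpa only [ENNReal.coe_ofNat, NNReal.coe_ofNat, ENNReal.rpow_ofNat] using this

section Mollification
variable {E : Type*} [NormedAddCommGroup E] [NormedSpace ℝ E]
  [MeasurableSpace E] [BorelSpace E] [FiniteDimensional ℝ E]
  {V : Type*} [NormedAddCommGroup V] [NormedSpace ℝ V]

/-- Cauchy-Schwarz after writing ρ as √ρ · √ρ. For a mollifier of integral one this is Jensen's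
inequality. -/
theorem sq_enorm_integral_smul_le {α : Type*} [MeasurableSpace α] (μ : Measure α) {ρ : α → ℝ}
    {h : α → V} (hρ0 : ∀ t, 0 ≤ ρ t) (hρ : Measurable ρ) (hh : AEStronglyMeasurable h μ) :
    ‖∫ t, ρ t • h t ∂μ‖ₑ ^ 2 ≤
      (∫⁻ t, ENNReal.ofReal (ρ t) ∂μ) * ∫⁻ t, ENNReal.ofReal (ρ t) * ‖h t‖ₑ ^ 2 ∂μ := by
  set σ : α → ENNReal := fun t => ENNReal.ofReal √(ρ t) with hσdef
  have hσ : ∀ t, σ t ^ 2 = ENNReal.ofReal (ρ t) := fun t => by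
    rw [hσdef, ← ENNReal.ofReal_pow (Real.sqrt_nonneg _), Real.sq_sqrt (hρ0 t)]
  have hσm : Measurable σ := hρ.sqrt.ennreal_ofReal
  have h1 : ∀ t, ‖ρ t • h t‖ₑ = σ t * (σ t * ‖h t‖ₑ) := fun t => by
    rw [enorm_smul, Real.enorm_of_nonneg (hρ0 t), ← hσ]; ring
  calc ‖∫ t, ρ t • h t ∂μ‖ₑ ^ 2 ≤ (∫⁻ t, σ t * (σ t * ‖h t‖ₑ) ∂μ) ^ 2 := by
        refine ENNReal.pow_le_pow_left ((enorm_integral_le_lintegral_enorm _).trans (le_of_eq ?_))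
        exact lintegral_congr h1
    _ ≤ (∫⁻ t, σ t ^ 2 ∂μ) * ∫⁻ t, (σ t * ‖h t‖ₑ) ^ 2 ∂μ :=
        sq_lintegral_mul_le μ hσm.aemeasurable (hσm.aemeasurable.mul hh.enorm)
    _ = _ := by simp_rw [mul_pow, hσ]

/-- The convolution of `W` with the mollifier `ρ`. -/
noncomputable def mollify (μ : Measure E) (ρ : E → ℝ) (W : E → V) : E → V :=
  convolution W ρ (ContinuousLinearMap.lsmul ℝ ℝ).flip μ

variable (μ : Measure E) [μ.IsAddHaarMeasure] {ρ : E → ℝ} {W : E → V}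

theorem mollify_apply (x : E) : mollify μ ρ W x = ∫ t, ρ t • W (x - t) ∂μ := by
  unfold mollify
  rw [convolution_eq_swap]
  rfl

theorem lintegral_sq_mollify_le [SecondCountableTopologyEither E V] (hρ0 : ∀ t, 0 ≤ ρ t)
    (hρ : Continuous ρ) (hρ1 : ∫⁻ t, ENNReal.ofReal (ρ t) ∂μ = 1) (hW : StronglyMeasurable W) :
    ∫⁻ x, ‖mollify μ ρ W x‖ₑ ^ 2 ∂μ ≤ ∫⁻ x, ‖W x‖ₑ ^ 2 ∂μ := by
  have hm : Measurable fun p : E × E => ENNReal.ofReal (ρ p.2) * ‖W (p.1 - p.2)‖ₑ ^ 2 :=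
    ((hρ.measurable.comp measurable_snd).ennreal_ofReal).mul
      (((hW.comp_measurable (measurable_fst.sub measurable_snd)).enorm).pow_const 2)
  calc ∫⁻ x, ‖mollify μ ρ W x‖ₑ ^ 2 ∂μ
      ≤ ∫⁻ x, (∫⁻ t, ENNReal.ofReal (ρ t) * ‖W (x - t)‖ₑ ^ 2 ∂μ) ∂μ := by
        refine lintegral_mono fun x => ?_
        rw [mollify_apply]
        refine (sq_enorm_integral_smul_le μ hρ0 hρ.measurable
          (hW.comp_measurable (measurable_const.sub measurable_id)).aestronglyMeasurable).trans ?_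
        rw [hρ1, one_mul]
        rfl
    _ = ∫⁻ t, (∫⁻ x, ENNReal.ofReal (ρ t) * ‖W (x - t)‖ₑ ^ 2 ∂μ) ∂μ :=
        lintegral_lintegral_swap hm.aemeasurable
    _ = ∫⁻ t, ENNReal.ofReal (ρ t) * ∫⁻ x, ‖W x‖ₑ ^ 2 ∂μ ∂μ := by
        refine lintegral_congr fun t => ?_
        rw [lintegral_const_mul' _ _ ENNReal.ofReal_ne_top,
          lintegral_sub_right_eq_self (fun x => ‖W x‖ₑ ^ 2) t]
    _ = _ := by
        rw [lintegral_mul_const _ hρ.measurable.ennreal_ofReal, hρ1, one_mul]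

/-- As ρ has integral one, the difference is an average of W(x - t) - W(x) over t in the support of
ρ, so continuity of translations decides how close the mollification is. -/
theorem lintegral_sq_mollify_sub_le [SecondCountableTopologyEither E V] [CompleteSpace V]
    (hρ0 : ∀ t, 0 ≤ ρ t)
    (hρ : Continuous ρ) (hc : HasCompactSupport ρ) (hρ1 : ∫ t, ρ t ∂μ = 1)
    (hW : StronglyMeasurable W) (hWi : LocallyIntegrable W μ) {η : ENNReal}
    (hη : ∀ t, ρ t ≠ 0 → ∫⁻ x, ‖W (x - t) - W x‖ₑ ^ 2 ∂μ ≤ η) :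
    ∫⁻ x, ‖mollify μ ρ W x - W x‖ₑ ^ 2 ∂μ ≤ η := by
  have hρi : Integrable ρ μ := hρ.integrable_of_hasCompactSupport hc
  have hρ1' : ∫⁻ t, ENNReal.ofReal (ρ t) ∂μ = 1 := by
    rw [← ofReal_integral_eq_lintegral_ofReal hρi (Filter.Eventually.of_forall hρ0), hρ1,
      ENNReal.ofReal_one]
  have hsm : StronglyMeasurable fun p : E × E => W (p.1 - p.2) - W p.1 :=
    (hW.comp_measurable (measurable_fst.sub measurable_snd)).sub (hW.comp_measurable measurable_fst)
  have hm : Measurable fun p : E × E =>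
      ENNReal.ofReal (ρ p.2) * ‖W (p.1 - p.2) - W p.1‖ₑ ^ 2 :=
    ((hρ.measurable.comp measurable_snd).ennreal_ofReal).mul (hsm.enorm.pow_const 2)
  have key : ∀ x, mollify μ ρ W x - W x = ∫ t, ρ t • (W (x - t) - W x) ∂μ := by
    intro x
    have hi : Integrable (fun t => ρ t • W (x - t)) μ := by
      have := (hc.convolutionExists_right (ContinuousLinearMap.lsmul ℝ ℝ : ℝ →L[ℝ] V →L[ℝ] V).flip
        hWi hρ x).integrable_swap
      exact this
    simp_rw [smul_sub]
    rw [integral_sub hi (hρi.smul_const (W x)), integral_smul_const, hρ1, one_smul, mollify_apply]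
  calc ∫⁻ x, ‖mollify μ ρ W x - W x‖ₑ ^ 2 ∂μ
      ≤ ∫⁻ x, (∫⁻ t, ENNReal.ofReal (ρ t) * ‖W (x - t) - W x‖ₑ ^ 2 ∂μ) ∂μ := by
        refine lintegral_mono fun x => ?_
        rw [key]
        refine (sq_enorm_integral_smul_le μ hρ0 hρ.measurable
          (hsm.comp_measurable measurable_prodMk_left).aestronglyMeasurable).trans ?_
        rw [hρ1', one_mul]
        rfl
    _ = ∫⁻ t, (∫⁻ x, ENNReal.ofReal (ρ t) * ‖W (x - t) - W x‖ₑ ^ 2 ∂μ) ∂μ :=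
        lintegral_lintegral_swap hm.aemeasurable
    _ ≤ ∫⁻ t, ENNReal.ofReal (ρ t) * η ∂μ := by
        refine lintegral_mono fun t => ?_
        rw [lintegral_const_mul' _ _ ENNReal.ofReal_ne_top]
        by_cases ht : ρ t = 0
        · simp [ht]
        · exact mul_le_mul_right (hη t ht) _
    _ = _ := by rw [lintegral_mul_const _ hρ.measurable.ennreal_ofReal, hρ1', one_mul]

/-- Continuity of translations in the quadratic mean. -/
theorem exists_lintegral_sq_translate_sub_le {V : Type*} [NormedAddCommGroup V] {W : E → V} (hW : MemLp W 2 μ)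
    {η : ENNReal} (hη : 0 < η) :
    ∃ δ : ℝ, 0 < δ ∧ ∀ t, ‖t‖ < δ → ∫⁻ x, ‖W (x - t) - W x‖ₑ ^ 2 ∂μ ≤ η := by
  let g : E → C(E, E) := fun t => ⟨fun x => x - t, by fun_prop⟩
  have hcont : Continuous g :=
    ContinuousMap.continuous_of_continuous_uncurry _ (continuous_snd.sub continuous_fst)
  have hmp : ∀ t : E, MeasurePreserving (g t) μ μ := fun t => measurePreserving_sub_right μ t
  have hT : Continuous fun t => Lp.compMeasurePreserving (g t) (hmp t) (hW.toLp W) :=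
    Continuous.compMeasurePreservingLp continuous_const hcont hmp (by simp)
  obtain ⟨θ, hθ, hθη⟩ : ∃ θ : ENNReal, 0 < θ ∧ θ ^ 2 ≤ η := by
    rcases le_total η 1 with h | h
    · exact ⟨η, hη, (pow_le_of_le_one zero_le h two_ne_zero)⟩
    · exact ⟨1, one_pos, by simpa using h⟩
  obtain ⟨δ, hδ, hball⟩ := Metric.mem_nhds_iff.1
    (hT.continuousAt.preimage_mem_nhds (x := 0) (Metric.eball_mem_nhds _ hθ))
  refine ⟨δ, hδ, fun t ht => ?_⟩
  have h1 : edist (Lp.compMeasurePreserving (g t) (hmp t) (hW.toLp W))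
      (Lp.compMeasurePreserving (g 0) (hmp 0) (hW.toLp W)) < θ :=
    hball (by simpa using ht)
  rw [Lp.edist_def] at h1
  have h2 : ∀ t, (Lp.compMeasurePreserving (g t) (hmp t) (hW.toLp W) : E → V) =ᵐ[μ]
      fun x => W (x - t) := fun t =>
    (Lp.coeFn_compMeasurePreserving _ (hmp t)).trans
      ((hmp t).quasiMeasurePreserving.ae_eq_comp hW.coeFn_toLp)
  refine le_trans ?_ ((ENNReal.pow_le_pow_left h1.le (n := 2)).trans hθη)
  rw [eLpNorm_two_sq]
  refine le_of_eq (lintegral_congr_ae ?_)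
  filter_upwards [h2 t, h2 0] with x hx hx0
  rw [Pi.sub_apply, hx, hx0, sub_zero]

end Mollification

/-! ### Smooth approximation of Sobolev functions -/

section SobolevMollification
variable {n : ℕ} {𝕜 : Type*} [RCLike 𝕜] {X : Set (EuclideanSpace ℝ (Fin n))}

theorem memLp_indicator_coe (hX : IsOpen X) (u : Lp 𝕜 2 (volume.restrict X)) :
    MemLp (X.indicator u) 2 volume :=
  (memLp_indicator_iff_restrict hX.measurableSet).2 (Lp.memLp u)

/-- On points at distance more than the radius of `ρ` from the complement of `X`, the derivatives
of the mollification are the mollifications of the weak derivatives. -/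
theorem partialDeriv_mollify_eq (hX : IsOpen X) {α : Fin n → ℕ}
    {h w : Lp 𝕜 2 (volume.restrict X)} (hw : IsWeakDeriv X α h w)
    {ρ : EuclideanSpace ℝ (Fin n) → ℝ} (hρ : ContDiff ℝ ∞ ρ) (hc : HasCompactSupport ρ)
    {x : EuclideanSpace ℝ (Fin n)} (hx : ∀ t, x - t ∈ tsupport ρ → t ∈ X) :
    partialDeriv α (mollify volume ρ (X.indicator h)) x =
      mollify volume ρ (X.indicator w) x := by
  have hloc : LocallyIntegrable (X.indicator h) volume :=
    (memLp_indicator_coe hX h).locallyIntegrable (by norm_num)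
  have hind : ∀ (v : Lp 𝕜 2 (volume.restrict X)) (ψ : EuclideanSpace ℝ (Fin n) → ℝ),
      ∫ t, ψ t • X.indicator v t = ∫ t in X, ψ t • v t := by
    intro v ψ
    rw [← integral_indicator hX.measurableSet]
    refine integral_congr_ae (Filter.Eventually.of_forall fun t => ?_)
    by_cases ht : t ∈ X <;> simp [ht]
  have hsupp : tsupport (fun t => ρ (x - t)) ⊆ (fun t => x - t) ⁻¹' tsupport ρ :=
    tsupport_comp_subset_preimage ρ (f := fun t => x - t) (by fun_prop)
  have hφc : HasCompactSupport fun t => ρ (x - t) :=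
    hc.comp_homeomorph (Homeomorph.subLeft x)
  have hφ : ContDiff ℝ ∞ fun t => ρ (x - t) := hρ.comp (contDiff_const.sub contDiff_id)
  have h1 := hw _ hφ hφc fun t ht => hx t (hsupp ht)
  unfold partialDeriv at h1 ⊢
  simp_rw [iteratedFDeriv_comp_const_sub_apply hρ] at h1
  rw [← integral_smul] at h1
  -- The sign from differentiating the reflected mollifier t ↦ ρ(x - t) cancels the sign in the
  -- definition of the weak derivative.
  have hsq : ∀ (a c : ℝ) (z : 𝕜), a ^ 2 = 1 → a • (a • c) • z = c • z := fun a c z ha => by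
    rw [smul_assoc, smul_smul, ← sq, ha, one_smul]
  simp_rw [hsq _ _ _ (by rw [← pow_mul, mul_comm, pow_mul]; norm_num :
    ((-1 : ℝ) ^ (∑ i, α i)) ^ 2 = 1)] at h1
  unfold mollify
  rw [iteratedFDeriv_convolution_right_apply volume hloc hρ hc]
  exact (hind h _).trans ((hind w _).trans h1).symm

/-- The extension of u by zero is mollified at a scale below the distance from K to the complement
of X. Derivatives are only bounded on K, not approximated up to the boundary, so no regularity of X
is needed. -/
theorem Sobolev.exists_contDiff_approx (hX : IsOpen X) {s : ℕ} (u : Sobolev 𝕜 s X)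
    {K : Set (EuclideanSpace ℝ (Fin n))} (hK : IsCompact K) (hKX : K ⊆ X)
    {η : ENNReal} (hη : 0 < η) :
    ∃ G : EuclideanSpace ℝ (Fin n) → 𝕜, ContDiff ℝ ∞ G ∧
      ∫⁻ x in X, ‖G x - sobolevFn u x‖ₑ ^ 2 ≤ η ∧
      ∀ α : MultiIndex n s, ∫⁻ x in K, ‖partialDeriv α.toFun G x‖ₑ ^ 2 ≤ ‖u.1 α‖ₑ ^ 2 := by
  set W : EuclideanSpace ℝ (Fin n) → 𝕜 := X.indicator (sobolevFn u) with hWdef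
  have hWm := memLp_indicator_coe hX (sobolevFn u)
  have hsm : ∀ v : Lp 𝕜 2 (volume.restrict X), StronglyMeasurable (X.indicator v) := fun v =>
    (Lp.stronglyMeasurable v).indicator hX.measurableSet
  have hloc : LocallyIntegrable W volume := hWm.locallyIntegrable (by norm_num)
  obtain ⟨δ₁, hδ₁, h1⟩ := exists_lintegral_sq_translate_sub_le volume hWm hη
  obtain ⟨δ₂, hδ₂, h2⟩ := hK.exists_cthickening_subset_open hX hKX
  set δ := min (δ₁ / 2) δ₂
  have hδ : 0 < δ := by positivity
  let b : ContDiffBump (0 : EuclideanSpace ℝ (Fin n)) := ⟨δ / 2, δ, by positivity, by linarith⟩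
  set ρ := b.normed volume
  have hρ : ContDiff ℝ ∞ ρ := b.contDiff_normed (n := ⊤)
  have hc : HasCompactSupport ρ := b.hasCompactSupport_normed
  have hρ0 : ∀ t, 0 ≤ ρ t := b.nonneg_normed
  have hρ1 : ∫ t, ρ t = 1 := b.integral_normed
  have hρ1' : ∫⁻ t, ENNReal.ofReal (ρ t) = 1 := by
    rw [← ofReal_integral_eq_lintegral_ofReal b.integrable_normed
      (Filter.Eventually.of_forall hρ0), hρ1, ENNReal.ofReal_one]
  refine ⟨mollify volume ρ W, hc.contDiff_convolution_right (n := ⊤) _ hloc hρ, ?_, fun α => ?_⟩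
  · calc ∫⁻ x in X, ‖mollify volume ρ W x - sobolevFn u x‖ₑ ^ 2
        = ∫⁻ x in X, ‖mollify volume ρ W x - W x‖ₑ ^ 2 :=
          setLIntegral_congr_fun hX.measurableSet fun x hx => by simp [hWdef, hx]
      _ ≤ ∫⁻ x, ‖mollify volume ρ W x - W x‖ₑ ^ 2 := setLIntegral_le_lintegral _ _
      _ ≤ η := by
          refine lintegral_sq_mollify_sub_le volume hρ0 hρ.continuous hc hρ1 (hsm _) hloc
            fun t ht => h1 t ?_
          have : t ∈ Metric.ball 0 δ := by
            rw [← b.support_normed_eq (μ := volume)]; exact ht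
          rw [mem_ball_zero_iff] at this
          have := min_le_left (δ₁ / 2) δ₂
          linarith
  · calc ∫⁻ x in K, ‖partialDeriv α.toFun (mollify volume ρ W) x‖ₑ ^ 2
        = ∫⁻ x in K, ‖mollify volume ρ (X.indicator (u.1 α)) x‖ₑ ^ 2 := by
          refine setLIntegral_congr_fun hK.measurableSet fun x hx => ?_
          refine congrArg (fun z => ‖z‖ₑ ^ 2) (partialDeriv_mollify_eq hX
            (h := sobolevFn u) (u.2 α) hρ hc fun t ht => ?_)
          rw [b.tsupport_normed_eq, mem_closedBall_zero_iff] at ht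
          refine h2 (Metric.mem_cthickening_of_dist_le t x _ _ hx ?_)
          rw [dist_comm, dist_eq_norm]
          exact ht.trans (min_le_right _ _)
      _ ≤ ∫⁻ x, ‖mollify volume ρ (X.indicator (u.1 α)) x‖ₑ ^ 2 := setLIntegral_le_lintegral _ _
      _ ≤ ∫⁻ x, ‖X.indicator (u.1 α) x‖ₑ ^ 2 :=
          lintegral_sq_mollify_le volume hρ0 hρ.continuous hρ1' (hsm _)
      _ = _ := by
          rw [← eLpNorm_two_sq, eLpNorm_indicator_eq_eLpNorm_restrict hX.measurableSet,
            ← Lp.enorm_def]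

end SobolevMollification

/-- A functional which is bounded in terms of a linear map into a Hilbert space is represented by a
vector of that Hilbert space. -/
theorem exists_inner_eq_of_bound {T H : Type*} [AddCommGroup T] [Module ℝ T]
    [NormedAddCommGroup H] [InnerProductSpace ℝ H] [CompleteSpace H] (j : T →ₗ[ℝ] H)
    (l : T →ₗ[ℝ] ℝ) {C : ℝ} (hC : 0 ≤ C) (h : ∀ t, |l t| ≤ C * ‖j t‖) :
    ∃ w : H, ‖w‖ ≤ C ∧ ∀ t, inner ℝ w (j t) = l t := by
  have hker : LinearMap.ker j ≤ LinearMap.ker l := fun t ht => by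
    have := h t
    rw [LinearMap.mem_ker.1 ht, norm_zero, mul_zero] at this
    exact LinearMap.mem_ker.2 (abs_nonpos_iff.1 this)
  let g : LinearMap.range j →ₗ[ℝ] ℝ :=
    ((LinearMap.ker j).liftQ l hker).comp j.quotKerEquivRange.symm.toLinearMap
  have hg : ∀ t, g ⟨j t, LinearMap.mem_range_self j t⟩ = l t := fun t => by
    have : j.quotKerEquivRange ((LinearMap.ker j).mkQ t) = ⟨j t, LinearMap.mem_range_self j t⟩ :=
      Subtype.ext (j.quotKerEquivRange_apply_mk t)
    change (LinearMap.ker j).liftQ l hker (j.quotKerEquivRange.symm _) = _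
    rw [← this, LinearEquiv.symm_apply_apply]
    rfl
  have hgb : ∀ z, ‖g z‖ ≤ C * ‖z‖ := by
    rintro ⟨_, t, rfl⟩
    rw [hg]
    exact h t
  obtain ⟨G, hG, hGn⟩ := exists_extension_norm_eq (LinearMap.range j) (g.mkContinuous C hgb)
  refine ⟨(InnerProductSpace.toDual ℝ H).symm G, ?_, fun t => ?_⟩
  · rw [LinearIsometryEquiv.norm_map, hGn]
    exact LinearMap.mkContinuous_norm_le _ hC _
  · rw [InnerProductSpace.toDual_symm_apply]
    exact (hG ⟨j t, LinearMap.mem_range_self j t⟩).trans (hg t)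

/-! ### Weak derivatives from bounded functionals -/

section Duality
variable {n : ℕ} {𝕜 : Type*} [RCLike 𝕜] {X : Set (EuclideanSpace ℝ (Fin n))}

/-- The smooth functions with compact support in `X`. -/
def testFunctions (X : Set (EuclideanSpace ℝ (Fin n))) :
    Submodule ℝ (EuclideanSpace ℝ (Fin n) → ℝ) where
  carrier := {φ | ContDiff ℝ ∞ φ ∧ HasCompactSupport φ ∧ tsupport φ ⊆ X}
  zero_mem' := ⟨contDiff_const, HasCompactSupport.zero, by
    rw [tsupport_eq_empty_iff.2 rfl]; exact empty_subset _⟩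
  add_mem' := fun ⟨h1, h2, h3⟩ ⟨h4, h5, h6⟩ =>
    ⟨h1.add h4, h2.add h5, (tsupport_add _ _).trans (union_subset h3 h6)⟩
  smul_mem' := fun c φ ⟨h1, h2, h3⟩ =>
    ⟨contDiff_const.smul h1, h2.smul_left (f := fun _ => c),
      (tsupport_smul_subset_right (fun _ => c) φ).trans h3⟩

theorem partialDeriv_add {φ ψ : EuclideanSpace ℝ (Fin n) → ℝ} (hφ : ContDiff ℝ ∞ φ)
    (hψ : ContDiff ℝ ∞ ψ) (α : Fin n → ℕ) (x : EuclideanSpace ℝ (Fin n)) :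
    partialDeriv α (φ + ψ) x = partialDeriv α φ x + partialDeriv α ψ x := by
  unfold partialDeriv
  rw [iteratedFDeriv_add_apply (hφ.contDiffAt.of_le (by exact_mod_cast le_top))
    (hψ.contDiffAt.of_le (by exact_mod_cast le_top))]
  rfl

theorem partialDeriv_smul {φ : EuclideanSpace ℝ (Fin n) → ℝ} (hφ : ContDiff ℝ ∞ φ) (c : ℝ)
    (α : Fin n → ℕ) (x : EuclideanSpace ℝ (Fin n)) :
    partialDeriv α (c • φ) x = c • partialDeriv α φ x := by
  unfold partialDeriv
  rw [iteratedFDeriv_const_smul_apply (hφ.contDiffAt.of_le (by exact_mod_cast le_top))]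
  rfl

/-- The functional `φ ↦ ∫_X (∂^α φ) h` on test functions. -/
noncomputable def testPairing (α : Fin n → ℕ) (h : Lp 𝕜 2 (volume.restrict X)) :
    testFunctions X →ₗ[ℝ] 𝕜 where
  toFun φ := ∫ x in X, partialDeriv α φ.1 x • h x
  map_add' φ ψ := by
    have hi : ∀ φ : testFunctions X, Integrable (fun x => partialDeriv α φ.1 x • h x)
        (volume.restrict X) := fun φ => integrable_test_smul (continuous_partialDeriv φ.2.1 α)
      (hasCompactSupport_partialDeriv φ.2.2.1 α) h
    rw [← integral_add (hi φ) (hi ψ)]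
    refine integral_congr_ae (Filter.Eventually.of_forall fun x => ?_)
    simp only
    rw [← add_smul, ← partialDeriv_add φ.2.1 ψ.2.1]
    rfl
  map_smul' c φ := by
    rw [RingHom.id_apply, ← integral_smul]
    refine integral_congr_ae (Filter.Eventually.of_forall fun x => ?_)
    simp only
    rw [← smul_assoc, ← partialDeriv_smul φ.2.1]
    rfl

theorem testFunctions.memLp (φ : testFunctions X) : MemLp φ.1 2 (volume.restrict X) :=
  (φ.2.1.continuous.memLp_of_hasCompactSupport (μ := volume) φ.2.2.1).restrict X

/-- The inclusion of the test functions in `L²(X)`. -/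
noncomputable def testFunctions.toLp : testFunctions X →ₗ[ℝ] Lp ℝ 2 (volume.restrict X) where
  toFun φ := (testFunctions.memLp φ).toLp φ.1
  map_add' _ _ := rfl
  map_smul' _ _ := rfl

theorem inner_testFunctions_toLp (w : Lp ℝ 2 (volume.restrict X)) (φ : testFunctions X) :
    inner ℝ w (testFunctions.toLp φ) = ∫ x in X, φ.1 x * w x := by
  rw [L2.inner_def]
  refine integral_congr_ae ?_
  filter_upwards [(testFunctions.memLp φ).coeFn_toLp] with x hx
  change inner ℝ (w x) ((testFunctions.memLp φ).toLp φ.1 x) = _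
  rw [hx]
  rfl

theorem integral_test_ofReal (w : Lp ℝ 2 (volume.restrict X))
    (φ : EuclideanSpace ℝ (Fin n) → ℝ) :
    ∫ x in X, φ x • ((RCLike.ofRealCLM (K := 𝕜)).compLp w) x = ((∫ x in X, φ x * w x : ℝ) : 𝕜) := by
  rw [← integral_ofReal]
  refine integral_congr_ae ?_
  filter_upwards [(RCLike.ofRealCLM (K := 𝕜)).coeFn_compLp w] with x hx
  rw [hx, RCLike.ofRealCLM_apply, RCLike.real_smul_eq_coe_mul, RCLike.ofReal_mul]

/-- Riesz representation is applied to the real and the imaginary part of the functional separately,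
since the test functions are real; this is the origin of the factor 2. The sign of the weak
derivative is built into the functional. -/
theorem exists_isWeakDeriv_of_bound (α : Fin n → ℕ) (h : Lp 𝕜 2 (volume.restrict X)) {C : ℝ}
    (hC : 0 ≤ C) (hb : ∀ φ : testFunctions X, ‖testPairing α h φ‖ ≤ C * ‖testFunctions.toLp φ‖) :
    ∃ w : Lp 𝕜 2 (volume.restrict X), IsWeakDeriv X α h w ∧ ‖w‖ ≤ 2 * C := by
  set c : ℝ := (-1) ^ ∑ i, α i with hc
  have hcn : |c| = 1 := by simp [hc]
  have hl : ∀ L : 𝕜 →ₗ[ℝ] ℝ, (∀ z, |L z| ≤ ‖z‖) → ∃ w : Lp ℝ 2 (volume.restrict X), ‖w‖ ≤ C ∧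
      ∀ φ, inner ℝ w (testFunctions.toLp φ) = c • L (testPairing α h φ) := fun L hL =>
    exists_inner_eq_of_bound testFunctions.toLp (c • L.comp (testPairing α h)) hC fun φ => by
      simp only [LinearMap.smul_apply, LinearMap.comp_apply, smul_eq_mul, abs_mul, hcn, one_mul]
      exact (hL _).trans (hb φ)
  obtain ⟨w₁, hw₁, h₁⟩ := hl RCLike.reLm RCLike.abs_re_le_norm
  obtain ⟨w₂, hw₂, h₂⟩ := hl RCLike.imLm RCLike.abs_im_le_norm
  have hn : ∀ w : Lp ℝ 2 (volume.restrict X), ‖(RCLike.ofRealCLM (K := 𝕜)).compLp w‖ ≤ ‖w‖ :=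
    fun w => ((RCLike.ofRealCLM (K := 𝕜)).norm_compLp_le w).trans (by simp)
  refine ⟨(RCLike.ofRealCLM (K := 𝕜)).compLp w₁ +
    (RCLike.I : 𝕜) • (RCLike.ofRealCLM (K := 𝕜)).compLp w₂, fun φ hφ hφc hφX => ?_, ?_⟩
  · rw [integral_test_add hφ.continuous hφc, integral_test_smul, integral_test_ofReal,
      integral_test_ofReal]
    have e₁ := h₁ ⟨φ, hφ, hφc, hφX⟩
    have e₂ := h₂ ⟨φ, hφ, hφc, hφX⟩
    rw [inner_testFunctions_toLp] at e₁ e₂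
    rw [e₁, e₂]
    change _ = c • testPairing α h ⟨φ, hφ, hφc, hφX⟩
    generalize testPairing α h ⟨φ, hφ, hφc, hφX⟩ = z
    conv_rhs => rw [← RCLike.re_add_im z]
    simp only [RCLike.reLm_coe, RCLike.imLm_coe, smul_eq_mul, RCLike.ofReal_mul,
      RCLike.real_smul_eq_coe_mul (K := 𝕜)]
    ring
  · refine (norm_add_le _ _).trans ?_
    rw [norm_smul]
    have hI : ‖(RCLike.I : 𝕜)‖ ≤ 1 := by
      rcases RCLike.I_eq_zero_or_im_I_eq_one (K := 𝕜) with h | h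
      · simp [h]
      · exact (RCLike.norm_I_of_ne_zero fun h0 => by simp [h0] at h).le
    have := mul_le_mul hI (hn w₂) (norm_nonneg _) zero_le_one
    linarith [hn w₁]

/-- A function whose distributional derivatives up to order `s` are bounded functionals on the test
functions with the norm of `L²(X)` belongs to `H^s(X)`. -/
theorem exists_sobolev_of_bound (hX : IsOpen X) {s : ℕ} (h : Lp 𝕜 2 (volume.restrict X)) {C : ℝ}
    (hC : 0 ≤ C) (hb : ∀ (α : MultiIndex n s) (φ : testFunctions X),
      ‖testPairing α.toFun h φ‖ ≤ C * ‖testFunctions.toLp φ‖) :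
    ∃ v : Sobolev 𝕜 s X, sobolevFn v = h ∧ ‖v‖ ≤ Fintype.card (MultiIndex n s) * (2 * C) := by
  choose w hw hwn using fun α : MultiIndex n s => exists_isWeakDeriv_of_bound α.toFun h hC (hb α)
  -- The choice of w gives for α = 0 some weak derivative of order zero, which has to be identified
  -- with h, because the component of index 0 is the stored function.
  have h0 : w (MultiIndex.zero n s) = h := by
    rw [← sub_eq_zero, Lp.eq_zero_iff_ae_eq_zero]
    have key := hX.ae_eq_zero_of_integral_contDiff_smul_eq_zero
      (f := fun x => w (MultiIndex.zero n s) x - h x) (μ := volume.restrict X)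
      (((Lp.memLp (w (MultiIndex.zero n s))).sub (Lp.memLp h)).locallyIntegrable
        (by norm_num) |>.locallyIntegrableOn X)
      (fun φ h1 h2 h3 => by
        have e := hw (MultiIndex.zero n s) φ h1 h2 h3
        have hz : ∀ x, partialDeriv (MultiIndex.zero n s).toFun φ x = φ x := fun x => by
          unfold partialDeriv
          have : ∑ i, (MultiIndex.zero n s).toFun i = 0 := by
            simp [MultiIndex.toFun, MultiIndex.zero]
          generalize hv : (fun k => EuclideanSpace.single
            (finSigmaFinEquiv (n := (MultiIndex.zero n s).toFun).symm k).1 (1 : ℝ)) = v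
          clear hv
          revert v
          rw [this]
          intro v
          exact iteratedFDeriv_zero_apply v
        have hs : ∑ i, (MultiIndex.zero n s).toFun i = 0 := by
          simp [MultiIndex.toFun, MultiIndex.zero]
        simp only [hz, hs, pow_zero, one_smul] at e
        simp only [smul_sub]
        rw [integral_sub (integrable_test_smul h1.continuous h2 _)
          (integrable_test_smul h1.continuous h2 _), e, sub_self])
    filter_upwards [key, ae_restrict_mem hX.measurableSet,
      Lp.coeFn_sub (w (MultiIndex.zero n s)) h] with x hx hxX hxs
    rw [hxs, Pi.sub_apply, hx hxX, Pi.zero_apply]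
  let v : PiLp 2 (fun _ : MultiIndex n s => Lp 𝕜 2 (volume.restrict X)) := WithLp.toLp 2 w
  have hv : v ∈ sobolevSubmodule 𝕜 s X := fun α => by
    change IsWeakDeriv X α.toFun (w (MultiIndex.zero n s)) (w α)
    rw [h0]
    exact hw α
  refine ⟨⟨v, hv⟩, h0, ?_⟩
  change ‖v‖ ≤ _
  rw [PiLp.norm_eq_of_L2]
  refine Real.sqrt_le_iff.2 ⟨by positivity, ?_⟩
  calc ∑ α, ‖v α‖ ^ 2 ≤ ∑ _α : MultiIndex n s, (2 * C) ^ 2 :=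
        Finset.sum_le_sum fun α _ => pow_le_pow_left₀ (norm_nonneg _) (hwn α) 2
    _ = Fintype.card (MultiIndex n s) * (2 * C) ^ 2 := by simp
    _ ≤ (Fintype.card (MultiIndex n s) : ℝ) ^ 2 * (2 * C) ^ 2 := by
        refine mul_le_mul_of_nonneg_right ?_ (sq_nonneg _)
        exact_mod_cast Nat.le_self_pow two_ne_zero _
    _ = _ := by ring

end Duality

/-! ### From estimates for smooth functions to Sobolev functions -/

theorem enorm_integral_smul_le_eLpNorm_mul {α V : Type*} [MeasurableSpace α]
    [NormedAddCommGroup V] [NormedSpace ℝ V] (μ : Measure α) {ψ : α → ℝ} {g : α → V}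
    (hψ : AEStronglyMeasurable ψ μ) (hg : AEStronglyMeasurable g μ) :
    ‖∫ x, ψ x • g x ∂μ‖ₑ ≤ eLpNorm ψ 2 μ * eLpNorm g 2 μ := by
  refine (enorm_integral_le_lintegral_enorm _).trans ?_
  rw [← eLpNorm_one_eq_lintegral_enorm]
  exact eLpNorm_smul_le_mul_eLpNorm (p := 2) (q := 2) (r := 1) hg hψ

section Transfer
variable {n : ℕ} {𝕜 : Type*} [RCLike 𝕜] {X : Set (EuclideanSpace ℝ (Fin n))}

theorem Sobolev.enorm_sq_eq {s : ℕ} (u : Sobolev 𝕜 s X) :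
    ‖u‖ₑ ^ 2 = ∑ α : MultiIndex n s, ‖u.1 α‖ₑ ^ 2 := by
  have h : ‖u‖ ^ 2 = ∑ α : MultiIndex n s, ‖u.1 α‖ ^ 2 := PiLp.norm_sq_eq_of_L2 _ u.1
  simp_rw [← ofReal_norm, ← ENNReal.ofReal_pow (norm_nonneg _)]
  rw [h, ENNReal.ofReal_sum_of_nonneg fun _ _ => by positivity]

/-- Let `T` be a linear transformation of functions which is bounded on `L²(X)` and which, for
smooth `G`, satisfies the bound `‖D^k (T G)‖_{L²(K)} ≤ A ‖G‖_{H^{s+1}(K')}` for `k ≤ s`, on all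
compact sets `K` and for a suitable compact set `K'`. Then `T` maps `H^{s+1}(X)` to `H^s(X)`, with
norm at most a constant times `A`. -/
structure TransferBound (𝕜 : Type*) [RCLike 𝕜] (s : ℕ) (X : Set (EuclideanSpace ℝ (Fin n)))
    (T : (EuclideanSpace ℝ (Fin n) → 𝕜) → EuclideanSpace ℝ (Fin n) → 𝕜) (A : ENNReal) : Prop where
  map_sub : ∀ U V, T (U - V) = T U - T V
  eLpNorm_le : ∃ B : ENNReal, B ≠ ⊤ ∧ ∀ U, StronglyMeasurable U →
    AEStronglyMeasurable (T U) (volume.restrict X) ∧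
      eLpNorm (T U) 2 (volume.restrict X) ≤ B * eLpNorm U 2 (volume.restrict X)
  contDiffAt : ∀ G, ContDiff ℝ ∞ G → ∀ x ∈ X, ContDiffAt ℝ s (T G) x
  lintegral_le : ∀ K ⊆ X, IsCompact K → ∃ K' ⊆ X, IsCompact K' ∧ ∀ G, ContDiff ℝ ∞ G →
    ∀ k ≤ s, ∫⁻ x in K, ‖iteratedFDeriv ℝ k (T G) x‖ₑ ^ 2 ≤
      A ^ 2 * ∫⁻ x in K', jetSq (s + 1) G x

/-- With φ fixed, u is replaced by a smooth G close to it in L²(X). For G the derivatives are moved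
to T G by integration by parts, where the bound by A applies on the support of φ. The error is at
most ‖∂^α φ‖ B η, which vanishes with η, so the L² constant B of T does not appear in the result. -/
theorem TransferBound.exists_enorm_testPairing_le (𝕜 : Type*) [RCLike 𝕜] (n s : ℕ) :
    ∃ C : ENNReal, C ≠ ⊤ ∧
    ∀ {X : Set (EuclideanSpace ℝ (Fin n))}, IsOpen X →
    ∀ {T : (EuclideanSpace ℝ (Fin n) → 𝕜) → EuclideanSpace ℝ (Fin n) → 𝕜} {A : ENNReal},
    TransferBound 𝕜 s X T A →
    ∀ (u : Sobolev 𝕜 (s + 1) X) (h : Lp 𝕜 2 (volume.restrict X)),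
    h =ᵐ[volume.restrict X] T (sobolevFn u) → ∀ (α : MultiIndex n s) (φ : testFunctions X),
    ‖testPairing α.toFun h φ‖ₑ ≤ C * A * ‖u‖ₑ * ‖testFunctions.toLp φ‖ₑ := by
  obtain ⟨C₀, hC₀, hjet⟩ := exists_jetSq_le_sum_partialDeriv n (s + 1)
  refine ⟨C₀ + 1, by finiteness, fun {X} hX {T A} hT u h hh α φ => ?_⟩
  obtain ⟨B, hB, hTB⟩ := hT.eLpNorm_le
  have hKc : IsCompact (tsupport φ.1) := φ.2.2.1
  obtain ⟨K', hK'X, hK', hK⟩ := hT.lintegral_le _ φ.2.2.2 hKc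
  set ψ := partialDeriv α.toFun φ.1 with hψ
  have hψc : Continuous ψ := continuous_partialDeriv φ.2.1 _
  have hψs : HasCompactSupport ψ := hasCompactSupport_partialDeriv φ.2.2.1 _
  set D := eLpNorm ψ 2 (volume.restrict X) with hD
  have hDt : D ≠ ⊤ :=
    ((hψc.memLp_of_hasCompactSupport (μ := volume) hψs).restrict X).eLpNorm_ne_top
  have hN : ∑ i, α.toFun i ≤ s := α.2
  have hφn : ‖testFunctions.toLp φ‖ₑ = eLpNorm φ.1 2 (volume.restrict X) := by
    rw [Lp.enorm_def]
    exact eLpNorm_congr_ae (testFunctions.memLp φ).coeFn_toLp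
  have main : ∀ η : ENNReal, 0 < η → ‖testPairing α.toFun h φ‖ₑ ≤
      (C₀ + 1) * A * ‖u‖ₑ * ‖testFunctions.toLp φ‖ₑ + D * (B * η) := by
    intro η hη
    obtain ⟨G, hG, hGu, hGd⟩ := u.exists_contDiff_approx hX hK' hK'X (ENNReal.pow_pos hη 2)
    have hGm : StronglyMeasurable ((sobolevFn u : EuclideanSpace ℝ (Fin n) → 𝕜) - G) :=
      (Lp.stronglyMeasurable _).sub hG.continuous.stronglyMeasurable
    have hTG : ∀ x ∈ X, ContDiffAt ℝ (∑ i, α.toFun i : ℕ) (T G) x := fun x hx =>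
      (hT.contDiffAt G hG x hx).of_le (by exact_mod_cast hN)
    have hsψ : tsupport ψ ⊆ X := by
      refine (closure_minimal (fun x hx => ?_) (isClosed_tsupport _)).trans φ.2.2.2
      by_contra h0
      have : iteratedFDeriv ℝ (∑ i, α.toFun i) φ.1 x = 0 :=
        image_eq_zero_of_notMem_tsupport fun h1 => h0 (tsupport_iteratedFDeriv_subset _ h1)
      exact hx (by simp [hψ, partialDeriv, this])
    have hi1 : Integrable (fun x => ψ x • h x) (volume.restrict X) :=
      integrable_test_smul hψc hψs h
    have hi2 : Integrable (fun x => ψ x • T G x) (volume.restrict X) :=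
      (integrable_smul_of_tsupport_subset volume hψc hψs hsψ fun x hx =>
        (hTG x hx).continuousAt).integrableOn
    have e1 : testPairing α.toFun h φ =
        (∫ x in X, ψ x • T G x) + ∫ x in X, ψ x • T (sobolevFn u - G) x := by
      rw [← sub_eq_iff_eq_add']
      change (∫ x in X, ψ x • h x) - _ = _
      rw [← integral_sub hi1 hi2]
      refine integral_congr_ae ?_
      filter_upwards [hh] with x hx
      rw [hT.map_sub, hx, Pi.sub_apply, smul_sub]
    have b2 : ‖∫ x in X, ψ x • T (sobolevFn u - G) x‖ₑ ≤ D * (B * η) := by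
      refine (enorm_integral_smul_le_eLpNorm_mul _ hψc.aestronglyMeasurable (hTB _ hGm).1).trans ?_
      refine mul_le_mul_right ((hTB _ hGm).2.trans (mul_le_mul_right ?_ _)) _
      rw [← ENNReal.pow_le_pow_left_iff two_ne_zero, eLpNorm_two_sq]
      refine le_trans (le_of_eq (lintegral_congr fun x => ?_)) hGu
      rw [Pi.sub_apply, ← enorm_neg, neg_sub]
    have e3 : ‖∫ x in X, ψ x • T G x‖ₑ =
        ‖∫ x in tsupport φ.1, φ.1 x • partialDeriv α.toFun (T G) x‖ₑ := by
      rw [setIntegral_eq_integral_of_forall_compl_eq_zero fun x hx => by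
          rw [image_eq_zero_of_notMem_tsupport fun h0 => hx (hsψ h0), zero_smul],
        setIntegral_eq_integral_of_forall_compl_eq_zero fun x hx => by
          rw [image_eq_zero_of_notMem_tsupport hx, zero_smul]]
      have := integral_smul_iteratedFDeriv_eq volume (∑ i, α.toFun i)
        (fun k => EuclideanSpace.single (finSigmaFinEquiv.symm k).1 (1 : ℝ))
        φ.2.1 φ.2.2.1 φ.2.2.2 hTG
      unfold partialDeriv
      rw [this, enorm_smul, enorm_pow]
      simp [hψ, partialDeriv]
    have b3 : ‖∫ x in X, ψ x • T G x‖ₑ ≤ (C₀ + 1) * A * ‖u‖ₑ * ‖testFunctions.toLp φ‖ₑ := by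
      have hcont : ContinuousOn (partialDeriv α.toFun (T G)) (tsupport φ.1) := fun x hx =>
        (((ContinuousMultilinearMap.apply ℝ (fun _ => EuclideanSpace ℝ (Fin n)) 𝕜
          _).continuous.continuousAt.comp
            ((hTG x (φ.2.2.2 hx)).continuousAt_iteratedFDeriv le_rfl)).continuousWithinAt)
      rw [e3, mul_comm _ ‖testFunctions.toLp φ‖ₑ, hφn]
      refine (enorm_integral_smul_le_eLpNorm_mul _ φ.2.1.continuous.aestronglyMeasurable
        (hcont.aestronglyMeasurable (isClosed_tsupport _).measurableSet)).trans ?_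
      refine mul_le_mul' (eLpNorm_mono_measure _ (Measure.restrict_mono φ.2.2.2 le_rfl)) ?_
      rw [← ENNReal.pow_le_pow_left_iff two_ne_zero, eLpNorm_two_sq]
      calc ∫⁻ x in tsupport φ.1, ‖partialDeriv α.toFun (T G) x‖ₑ ^ 2
          ≤ ∫⁻ x in tsupport φ.1, ‖iteratedFDeriv ℝ (∑ i, α.toFun i) (T G) x‖ₑ ^ 2 :=
            lintegral_mono fun x => ENNReal.pow_le_pow_left
              (enorm_le_iff_norm_le.2 (norm_partialDeriv_le _ _ _))
        _ ≤ A ^ 2 * ∫⁻ x in K', jetSq (s + 1) G x := hK G hG _ hN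
        _ ≤ A ^ 2 * (C₀ * ∑ β : MultiIndex n (s + 1),
              ∫⁻ x in K', ‖partialDeriv β.toFun G x‖ₑ ^ 2) := by
            refine mul_le_mul_right ?_ _
            have hm : ∀ β : MultiIndex n (s + 1),
                Measurable fun x => ‖partialDeriv β.toFun G x‖ₑ ^ 2 := fun β => by
              have : Continuous (partialDeriv β.toFun G) :=
                (ContinuousMultilinearMap.apply ℝ (fun _ => EuclideanSpace ℝ (Fin n)) 𝕜
                  _).continuous.comp (hG.continuous_iteratedFDeriv (by exact_mod_cast le_top))
              exact this.enorm.measurable.pow_const 2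
            rw [← lintegral_finsetSum _ fun β _ => hm β, ← lintegral_const_mul' _ _ hC₀]
            exact lintegral_mono fun x => hjet (hG.contDiffAt.of_le (by exact_mod_cast le_top))
        _ ≤ A ^ 2 * (C₀ * ‖u‖ₑ ^ 2) := by
            rw [u.enorm_sq_eq]
            gcongr with β _
            exact hGd β
        _ ≤ ((C₀ + 1) * A * ‖u‖ₑ) ^ 2 := by
            have h1 : C₀ ≤ (C₀ + 1) ^ 2 := by
              rw [sq]
              exact le_self_add.trans (le_mul_of_one_le_right zero_le le_add_self)
            calc A ^ 2 * (C₀ * ‖u‖ₑ ^ 2) ≤ A ^ 2 * ((C₀ + 1) ^ 2 * ‖u‖ₑ ^ 2) := by gcongr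
              _ = _ := by ring
    rw [e1]
    exact (enorm_add_le _ _).trans (add_le_add b3 b2)
  -- The error D B η is at most ε for η = ε / (D B + 1); the summand 1 excludes a zero denominator.
  refine ENNReal.le_of_forall_pos_le_add fun ε hε _ => ?_
  have hDB : D * B + 1 ≠ ⊤ := by finiteness
  have hpos : (0 : ENNReal) < ε / (D * B + 1) :=
    ENNReal.div_pos (by exact_mod_cast hε.ne') hDB
  refine (main _ hpos).trans (add_le_add le_rfl ?_)
  rw [← mul_assoc, ← mul_div_assoc]
  refine ENNReal.div_le_of_le_mul ?_
  rw [mul_comm (ε : ENNReal)]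
  exact mul_le_mul_left le_self_add _

theorem TransferBound.exists_sobolev (𝕜 : Type*) [RCLike 𝕜] (n s : ℕ) :
    ∃ C : ℝ, 0 ≤ C ∧
    ∀ {X : Set (EuclideanSpace ℝ (Fin n))}, IsOpen X →
    ∀ {T : (EuclideanSpace ℝ (Fin n) → 𝕜) → EuclideanSpace ℝ (Fin n) → 𝕜} {A : ℝ},
    0 ≤ A → TransferBound 𝕜 s X T (ENNReal.ofReal A) →
    ∀ u : Sobolev 𝕜 (s + 1) X, ∃ v : Sobolev 𝕜 s X,
    sobolevFn v =ᵐ[volume.restrict X] T (sobolevFn u) ∧ ‖v‖ ≤ C * A * ‖u‖ := by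
  obtain ⟨C, hC, h⟩ := TransferBound.exists_enorm_testPairing_le 𝕜 n s
  refine ⟨Fintype.card (MultiIndex n s) * (2 * C.toReal), by positivity,
    fun {X} hX {T A} hA hT u => ?_⟩
  obtain ⟨B, hB, hTB⟩ := hT.eLpNorm_le
  obtain ⟨hm, hle⟩ := hTB _ (Lp.stronglyMeasurable (sobolevFn u))
  have hT2 : MemLp (T (sobolevFn u)) 2 (volume.restrict X) :=
    ⟨hm, hle.trans_lt (ENNReal.mul_lt_top hB.lt_top (Lp.memLp (sobolevFn u)).eLpNorm_lt_top)⟩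
  obtain ⟨v, hv, hvn⟩ := exists_sobolev_of_bound (s := s) hX hT2.toLp
    (C := C.toReal * A * ‖u‖) (by positivity) fun α φ => by
      have := ENNReal.toReal_mono (by finiteness) (h hX hT u _ hT2.coeFn_toLp α φ)
      simpa [ENNReal.toReal_mul, hA] using this
  exact ⟨v, hv ▸ hT2.coeFn_toLp, hvn.trans (le_of_eq (by ring))⟩

end Transfer

universe u

/-! ### Derivatives of compositions and their differences in quadratic mean -/

section Comp
variable {E : Type} [NormedAddCommGroup E] [NormedSpace ℝ E]
  [MeasurableSpace E] [BorelSpace E] {μ : Measure E} {X : Set E} {m r₁ : ℝ} {N : ENNReal}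

omit [NormedSpace ℝ E] in
theorem CompBound.lintegral_comp_le_image (hN : CompBound μ X m r₁ N) {F : E → E}
    (hF : ContinuousOn F X)
    (hanti : ∀ x ∈ X, ∀ y ∈ X, ‖y - x‖ < r₁ → m * ‖y - x‖ ≤ ‖F y - F x‖)
    {K : Set E} (hKX : K ⊆ X) (hK : IsCompact K) {U : E → ENNReal} (hU : Measurable U) :
    ∫⁻ x in K, U (F x) ∂μ ≤ N * ∫⁻ y in F '' K, U y ∂μ := by
  have hFK : MeasurableSet (F '' K) := (hK.image_of_continuousOn (hF.mono hKX)).measurableSet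
  rw [← lintegral_indicator hFK]
  refine le_trans (le_of_eq (setLIntegral_congr_fun hK.measurableSet fun x hx => ?_))
    (hN F K hKX hK.measurableSet (hF.mono hKX) (fun x hx y hy => hanti x (hKX hx) y (hKX hy)) _
      (hU.indicator hFK))
  simp only [indicator_of_mem (mem_image_of_mem F hx)]

variable {V : Type u} [NormedAddCommGroup V] [NormedSpace ℝ V]

omit [MeasurableSpace E] [BorelSpace E] in
theorem jetSq_mono {a b : ℕ} (hab : a ≤ b) (G : E → V) (x : E) : jetSq a G x ≤ jetSq b G x :=
  Finset.sum_le_sum_of_subset (Finset.range_mono (by omega))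

theorem measurable_jetSq {s : ℕ} {G : E → V} (hG : ContDiff ℝ ∞ G) : Measurable (jetSq s G) :=
  Finset.measurable_sum _ fun i _ =>
    ((hG.continuous_iteratedFDeriv (m := i) (by exact_mod_cast le_top)).enorm.measurable).pow_const 2

/-- The derivatives of `G ∘ F` on a compact set, in terms of the derivatives of `G`. -/
theorem CompBound.lintegral_iteratedFDeriv_comp_le (hXo : IsOpen X) (hN : CompBound μ X m r₁ N)
    {s : ℕ} {F : E → E} (hF : ContDiffOn ℝ s F X)
    (hanti : ∀ x ∈ X, ∀ y ∈ X, ‖y - x‖ < r₁ → m * ‖y - x‖ ≤ ‖F y - F x‖) {B : ℝ} (hB : 1 ≤ B)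
    (hFB : ∀ x ∈ X, ∀ i, 1 ≤ i → i ≤ s → ‖iteratedFDeriv ℝ i F x‖ ≤ B)
    {K : Set E} (hKX : K ⊆ X) (hK : IsCompact K) {G : E → V} (hG : ContDiff ℝ ∞ G) {k : ℕ}
    (hk : k ≤ s) : ∫⁻ x in K, ‖iteratedFDeriv ℝ k (fun y => G (F y)) x‖ₑ ^ 2 ∂μ ≤
      ENNReal.ofReal (s.factorial * B ^ s) ^ 2 * (N * ∫⁻ y in F '' K, jetSq (s + 1) G y ∂μ) := by
  calc ∫⁻ x in K, ‖iteratedFDeriv ℝ k (fun y => G (F y)) x‖ₑ ^ 2 ∂μ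
      ≤ ∫⁻ x in K, ENNReal.ofReal (s.factorial * B ^ s) ^ 2 * jetSq (s + 1) G (F x) ∂μ := by
        refine setLIntegral_mono' hK.measurableSet fun x hx => ?_
        have hb := norm_iteratedFDeriv_comp_le_of_isOpen hXo (k := k)
          (hF.of_le (by exact_mod_cast hk)) hG (hKX hx) hB
          (C := √(∑ i ∈ Finset.range (k + 1), ‖iteratedFDeriv ℝ i G (F x)‖ ^ 2))
          (fun i hi => Real.le_sqrt_of_sq_le (Finset.single_le_sum
            (f := fun i => ‖iteratedFDeriv ℝ i G (F x)‖ ^ 2) (fun _ _ => by positivity)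
            (Finset.mem_range.2 (by omega))))
          (fun i h1 h2 => hFB x (hKX hx) i h1 (h2.trans hk))
        have hb2 : ‖iteratedFDeriv ℝ k (fun y => G (F y)) x‖ ≤ (s.factorial * B ^ s) *
            √(∑ i ∈ Finset.range (k + 1), ‖iteratedFDeriv ℝ i G (F x)‖ ^ 2) := by
          refine hb.trans ?_
          rw [mul_right_comm]
          gcongr
        rw [← ofReal_norm]
        refine (ENNReal.pow_le_pow_left (ENNReal.ofReal_le_ofReal hb2)).trans ?_
        rw [ENNReal.ofReal_mul (by positivity), mul_pow]
        refine mul_le_mul_right ?_ _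
        have : ENNReal.ofReal √(∑ i ∈ Finset.range (k + 1), ‖iteratedFDeriv ℝ i G (F x)‖ ^ 2) ^ 2 =
            jetSq k G (F x) := by
          rw [← ENNReal.ofReal_pow (Real.sqrt_nonneg _),
            Real.sq_sqrt (Finset.sum_nonneg fun _ _ => by positivity),
            ENNReal.ofReal_sum_of_nonneg fun _ _ => by positivity]
          simp_rw [ENNReal.ofReal_pow (norm_nonneg _), ofReal_norm]
          rfl
        rw [this]
        exact jetSq_mono (by omega) _ _
    _ = ENNReal.ofReal (s.factorial * B ^ s) ^ 2 * ∫⁻ x in K, jetSq (s + 1) G (F x) ∂μ :=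
        lintegral_const_mul' _ _ (by finiteness)
    _ ≤ _ := mul_le_mul_right (hN.lintegral_comp_le_image hF.continuousOn hanti hKX hK
        (measurable_jetSq hG)) _

variable [FiniteDimensional ℝ E] [μ.IsAddHaarMeasure]

/-- The derivatives of `G ∘ f' - G ∘ f` on a compact set, given bounds for the products of
derivatives of `f' - f` with derivatives of `G`. -/
theorem UniformCone.exists_lintegral_iteratedFDeriv_comp_sub_comp_le (μ : Measure E)
    [μ.IsAddHaarMeasure] {r κ : ℝ}
    (hX : UniformCone X r κ) (hXo : IsOpen X) (hXb : Bornology.IsBounded X) (hm : 0 < m)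
    (hr₁ : 0 < r₁) (s : ℕ) {B : ℝ} (hB : 1 ≤ B) {D : ENNReal} (hD : D ≠ ⊤) :
    ∃ C : ENNReal, C ≠ ⊤ ∧ ∀ f f' : E → E, ContDiffOn ℝ s f X → ContDiffOn ℝ s f' X →
      MapsTo f X X → MapsTo f' X X →
      (∀ x ∈ X, ∀ i, 1 ≤ i → i ≤ s → ‖iteratedFDeriv ℝ i f x‖ ≤ B) →
      (∀ x ∈ X, ∀ i, 1 ≤ i → i ≤ s → ‖iteratedFDeriv ℝ i f' x‖ ≤ B) →
      (∀ x ∈ X, ∀ y ∈ X, ‖y - x‖ < r₁ → m * ‖y - x‖ ≤ ‖f y - f x‖) →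
      (∀ x ∈ X, ∀ y ∈ X, ‖y - x‖ < r₁ →
        ‖(f' y - f y) - (f' x - f x)‖ ≤ m / 2 * ‖y - x‖) →
      (∀ x ∈ X, ‖f' x - f x‖ ≤ κ * r / 2) →
      ∀ Q : ℝ, (∀ x ∈ X, ‖f' x - f x‖ ≤ Q) →
      (∀ i j, 1 ≤ i → i ≤ s → j ≤ s → i + j ≤ s + 1 → ∀ K ⊆ X, IsCompact K →
        ∃ K' ⊆ X, IsCompact K' ∧ ∀ {V : Type u} [NormedAddCommGroup V] [NormedSpace ℝ V]
          [CompleteSpace V] {G : E → V}, ContDiff ℝ ∞ G →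
          ∫⁻ x in K, ‖iteratedFDeriv ℝ i G (f' x)‖ₑ ^ 2 *
            ‖iteratedFDeriv ℝ j (fun y => f' y - f y) x‖ₑ ^ 2 ∂μ ≤
            D * ENNReal.ofReal Q ^ 2 * ∫⁻ y in K', jetSq (s + 1) G y ∂μ) →
      ∀ K ⊆ X, IsCompact K → ∃ K' ⊆ X, IsCompact K' ∧
      ∀ {V : Type u} [NormedAddCommGroup V] [NormedSpace ℝ V] [CompleteSpace V] {G : E → V},
        ContDiff ℝ ∞ G → ∀ k ≤ s,
        ∫⁻ x in K, ‖iteratedFDeriv ℝ k (fun y => G (f' y) - G (f y)) x‖ₑ ^ 2 ∂μ ≤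
          C * ENNReal.ofReal Q ^ 2 * ∫⁻ y in K', jetSq (s + 1) G y ∂μ := by
  classical
  obtain ⟨C₁, hC₁, h₁⟩ := hX.exists_lintegral_comp_sub_comp_le μ hXb hm hr₁
  choose c hc0 hc using fun k : ℕ =>
    exists_norm_iteratedFDeriv_comp_sub_comp_le.{u} (E := E) k hB
  set c' := ∑ k ∈ Finset.range (s + 1), c k with hc'
  have hc'k : ∀ k ≤ s, c k ≤ c' := fun k hk => Finset.single_le_sum (f := c)
    (fun i _ => hc0 i) (Finset.mem_range.2 (by omega))
  set t : Finset (ℕ × ℕ) := (Finset.range (s + 1) ×ˢ Finset.range (s + 1)).filter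
    fun p => 1 ≤ p.1 ∧ p.1 + p.2 ≤ s + 1 with ht
  have htm : ∀ p, p ∈ t ↔ 1 ≤ p.1 ∧ p.1 ≤ s ∧ p.2 ≤ s ∧ p.1 + p.2 ≤ s + 1 := fun p => by
    simp only [ht, Finset.mem_filter, Finset.mem_product, Finset.mem_range]
    omega
  refine ⟨ENNReal.ofReal c' ^ 2 * ((s + 1 : ℕ) * C₁ + t.card * D), by finiteness, ?_⟩
  intro f f' hf hf' hfm hfm' hfB hfB' hanti hclose hsmall Q hQ hprod K hKX hK
  -- Q is any upper bound and may exceed κ r / 2, the largest displacement allowed by the cones. The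
  -- minimum of the two bounds is admissible.
  obtain ⟨K₁, hK₁X, hK₁, hdiff⟩ := h₁ f f' hf.continuousOn hf'.continuousOn hfm hfm' hanti hclose
    (min Q (κ * r / 2)) (min_le_right _ _) (fun x hx => le_min (hQ x hx) (hsmall x hx)) K hKX hK
  -- The empty set for pairs outside t only makes the choice of a compact set total.
  have hex : ∀ p : ℕ × ℕ, ∃ K' ⊆ X, IsCompact K' ∧ (p ∈ t → ∀ {V : Type u}
      [NormedAddCommGroup V] [NormedSpace ℝ V] [CompleteSpace V] {G : E → V}, ContDiff ℝ ∞ G →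
          ∫⁻ x in K, ‖iteratedFDeriv ℝ p.1 G (f' x)‖ₑ ^ 2 *
            ‖iteratedFDeriv ℝ p.2 (fun y => f' y - f y) x‖ₑ ^ 2 ∂μ ≤
            D * ENNReal.ofReal Q ^ 2 * ∫⁻ y in K', jetSq (s + 1) G y ∂μ) := fun p => by
    by_cases hp : p ∈ t
    · obtain ⟨h1, h2, h3, h4⟩ := (htm p).1 hp
      obtain ⟨K', hK'X, hK', h⟩ := hprod p.1 p.2 h1 h2 h3 h4 K hKX hK
      exact ⟨K', hK'X, hK', fun _ => h⟩
    · exact ⟨∅, empty_subset _, isCompact_empty, fun h => absurd h hp⟩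
  choose K₂ hK₂X hK₂ hmul using hex
  refine ⟨K₁ ∪ ⋃ p ∈ t, K₂ p, union_subset hK₁X (iUnion₂_subset fun p _ => hK₂X p),
    hK₁.union (t.isCompact_biUnion fun p _ => hK₂ p), fun {V} _ _ _ {G} hG k hk => ?_⟩
  set J := ∫⁻ y in K₁ ∪ ⋃ p ∈ t, K₂ p, jetSq (s + 1) G y ∂μ with hJ
  have hGi : ∀ i : ℕ, ContDiff ℝ ∞ (iteratedFDeriv ℝ i G) := fun i =>
    hG.iteratedFDeriv_right (m := ∞) (by exact_mod_cast le_top)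
  have hv : ContDiffOn ℝ s (fun y => f' y - f y) X := hf'.sub hf
  let a : ℕ → E → ENNReal := fun i x =>
    ‖iteratedFDeriv ℝ i G (f' x) - iteratedFDeriv ℝ i G (f x)‖ₑ ^ 2
  let b : ℕ × ℕ → E → ENNReal := fun p x => ‖iteratedFDeriv ℝ p.1 G (f' x)‖ₑ ^ 2 *
    ‖iteratedFDeriv ℝ p.2 (fun y => f' y - f y) x‖ₑ ^ 2
  have ham : ∀ i, AEMeasurable (a i) (μ.restrict K) := fun i => by
    have h : ContinuousOn (fun x => iteratedFDeriv ℝ i G (f' x) - iteratedFDeriv ℝ i G (f x)) K :=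
      ((hGi i).continuous.comp_continuousOn (hf'.continuousOn.mono hKX)).sub
        ((hGi i).continuous.comp_continuousOn (hf.continuousOn.mono hKX))
    exact (h.enorm.aemeasurable hK.measurableSet).pow_const 2
  have hbm : ∀ p ∈ t, AEMeasurable (b p) (μ.restrict K) := fun p hp => by
    have h1 : ContinuousOn (fun x => iteratedFDeriv ℝ p.1 G (f' x)) K :=
      (hGi p.1).continuous.comp_continuousOn (hf'.continuousOn.mono hKX)
    have h2 : ContinuousOn (iteratedFDeriv ℝ p.2 fun y => f' y - f y) K := fun x hx =>
      ((hv.contDiffAt (hXo.mem_nhds (hKX hx))).continuousAt_iteratedFDeriv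
        (by exact_mod_cast ((htm p).1 hp).2.2.1)).continuousWithinAt
    exact ((h1.enorm.aemeasurable hK.measurableSet).pow_const 2).mul
      ((h2.enorm.aemeasurable hK.measurableSet).pow_const 2)
  have hpt : ∀ x ∈ K, ‖iteratedFDeriv ℝ k (fun y => G (f' y) - G (f y)) x‖ₑ ^ 2 ≤
      ENNReal.ofReal c' ^ 2 * (∑ i ∈ Finset.range (s + 1), a i x + ∑ p ∈ t, b p x) := by
    intro x hx
    have hxX := hKX hx
    set S₁ := ∑ i ∈ Finset.range (s + 1),
      ‖iteratedFDeriv ℝ i G (f' x) - iteratedFDeriv ℝ i G (f x)‖ ^ 2 with hS₁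
    set S₂ := ∑ p ∈ t, (‖iteratedFDeriv ℝ p.1 G (f' x)‖ *
      ‖iteratedFDeriv ℝ p.2 (fun y => f' y - f y) x‖) ^ 2 with hS₂
    have hS₁0 : 0 ≤ S₁ := Finset.sum_nonneg fun _ _ => by positivity
    have hS₂0 : 0 ≤ S₂ := Finset.sum_nonneg fun _ _ => by positivity
    -- The root of the sum of all squares dominates each increment and each product, and its square
    -- can be integrated term by term.
    have h := hc k hG hXo (hf.of_le (by exact_mod_cast hk)) (hf'.of_le (by exact_mod_cast hk)) hxX
      (fun i h1 h2 => hfB x hxX i h1 (h2.trans hk)) (fun i h1 h2 => hfB' x hxX i h1 (h2.trans hk))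
      (T := √(S₁ + S₂))
      (fun i hi => Real.le_sqrt_of_sq_le ((Finset.single_le_sum (f := fun i =>
        ‖iteratedFDeriv ℝ i G (f' x) - iteratedFDeriv ℝ i G (f x)‖ ^ 2)
        (fun _ _ => by positivity) (Finset.mem_range.2 (by omega))).trans
        (le_add_of_nonneg_right hS₂0)))
      (fun i j h1 h2 h3 h4 => Real.le_sqrt_of_sq_le ((Finset.single_le_sum (f := fun p : ℕ × ℕ =>
        (‖iteratedFDeriv ℝ p.1 G (f' x)‖ *
          ‖iteratedFDeriv ℝ p.2 (fun y => f' y - f y) x‖) ^ 2)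
        (fun _ _ => by positivity) ((htm (i, j)).2 ⟨h1, by omega, by omega, by simp only; omega⟩)).trans
        (le_add_of_nonneg_left hS₁0)))
    have h' : ‖iteratedFDeriv ℝ k (fun y => G (f' y) - G (f y)) x‖ ≤ c' * √(S₁ + S₂) :=
      h.trans (mul_le_mul_of_nonneg_right (hc'k k hk) (Real.sqrt_nonneg _))
    rw [← ofReal_norm]
    refine (ENNReal.pow_le_pow_left (ENNReal.ofReal_le_ofReal h')).trans (le_of_eq ?_)
    rw [ENNReal.ofReal_mul ((hc0 k).trans (hc'k k hk)), mul_pow,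
      ← ENNReal.ofReal_pow (Real.sqrt_nonneg _), Real.sq_sqrt (add_nonneg hS₁0 hS₂0),
      ENNReal.ofReal_add hS₁0 hS₂0, hS₁, hS₂, ENNReal.ofReal_sum_of_nonneg fun i _ => sq_nonneg _,
      ENNReal.ofReal_sum_of_nonneg fun p _ => sq_nonneg _]
    refine congrArg _ (congrArg₂ _ (Finset.sum_congr rfl fun i _ => ?_)
      (Finset.sum_congr rfl fun p _ => ?_))
    · simp only [a]
      rw [ENNReal.ofReal_pow (norm_nonneg _), ofReal_norm]
    · simp only [b]
      rw [ENNReal.ofReal_pow (by positivity), ENNReal.ofReal_mul (norm_nonneg _), ofReal_norm,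
        ofReal_norm, mul_pow]
  calc ∫⁻ x in K, ‖iteratedFDeriv ℝ k (fun y => G (f' y) - G (f y)) x‖ₑ ^ 2 ∂μ
      ≤ ∫⁻ x in K, ENNReal.ofReal c' ^ 2 *
          (∑ i ∈ Finset.range (s + 1), a i x + ∑ p ∈ t, b p x) ∂μ :=
        setLIntegral_mono' hK.measurableSet hpt
    _ = ENNReal.ofReal c' ^ 2 * (∑ i ∈ Finset.range (s + 1), (∫⁻ x in K, a i x ∂μ) +
          ∑ p ∈ t, ∫⁻ x in K, b p x ∂μ) := by
        rw [lintegral_const_mul' _ _ (by finiteness),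
          lintegral_add_left' (Finset.aemeasurable_fun_sum _ fun i _ => ham i),
          lintegral_finsetSum' _ fun i _ => ham i, lintegral_finsetSum' _ hbm]
    _ ≤ ENNReal.ofReal c' ^ 2 * (∑ _i ∈ Finset.range (s + 1), C₁ * ENNReal.ofReal Q ^ 2 * J +
          ∑ _p ∈ t, D * ENNReal.ofReal Q ^ 2 * J) := by
        refine mul_le_mul_right (add_le_add (Finset.sum_le_sum fun i hi => ?_)
          (Finset.sum_le_sum fun p hp => ?_)) _
        -- The increment of the derivative of order i ≤ s is paid for by the derivative of order i +
        -- 1. This is the loss of one order from H^{s+1} to H^s.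
        · refine (hdiff ((hGi i).of_le (by exact_mod_cast le_top))).trans (mul_le_mul' ?_ ?_)
          · gcongr
            exact min_le_left _ _
          · refine (lintegral_mono fun y => ?_).trans
              (lintegral_mono_set (subset_union_left (t := ⋃ p ∈ t, K₂ p)))
            rw [← ofReal_norm, norm_fderiv_iteratedFDeriv, ofReal_norm]
            exact enorm_iteratedFDeriv_sq_le_jetSq
              (by have := Finset.mem_range.1 hi; omega) G y
        · refine (hmul p hp hG).trans (mul_le_mul_right (lintegral_mono_set ?_) _)
          exact (subset_biUnion_of_mem (u := fun p => K₂ p) hp).trans subset_union_right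
    _ = _ := by
        rw [Finset.sum_const, Finset.sum_const, Finset.card_range, nsmul_eq_mul, nsmul_eq_mul]
        ring

end Comp

/-! ### The norms of C_b^k and of vector-valued H^s -/

section CbNorm
variable {n k : ℕ} {X : Set (EuclideanSpace ℝ (Fin n))}

theorem Cb.norm_iteratedFDeriv_le (f : Cb k X) {j : ℕ} (hj : j ≤ k) {x : EuclideanSpace ℝ (Fin n)}
    (hx : x ∈ X) : ‖iteratedFDeriv ℝ j f x‖ ≤ ‖f‖ :=
  ((Cb.jet f ⟨j, Nat.lt_succ_iff.2 hj⟩).norm_coe_le_norm ⟨x, hx⟩).trans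
    (norm_le_pi_norm (Cb.jet f) ⟨j, Nat.lt_succ_iff.2 hj⟩)

theorem Cb.norm_apply_le (f : Cb k X) {x : EuclideanSpace ℝ (Fin n)} (hx : x ∈ X) :
    ‖f x‖ ≤ ‖f‖ := by
  simpa using f.norm_iteratedFDeriv_le (Nat.zero_le k) hx

theorem Cb.norm_lower_le (f : Cb (k + 1) X) : ‖f.lower‖ ≤ ‖f‖ := by
  change ‖Cb.jet f.lower‖ ≤ ‖f‖
  refine (pi_norm_le_iff_of_nonneg (norm_nonneg f)).2 fun j => ?_
  refine (BoundedContinuousFunction.norm_le (norm_nonneg f)).2 fun x => ?_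
  exact f.norm_iteratedFDeriv_le (by have := j.2; omega) x.2

theorem Cb.contDiffOn (f : Cb k X) : ContDiffOn ℝ k f X := fun x hx =>
  (f.2.1 x hx).contDiffWithinAt

variable {r κ : ℝ}

theorem Cb.norm_fderiv_le (f : Cb (k + 1) X) {x : EuclideanSpace ℝ (Fin n)} (hx : x ∈ X) :
    ‖fderiv ℝ f x‖ ≤ ‖f‖ := by
  rw [← norm_iteratedFDeriv_one]
  exact f.norm_iteratedFDeriv_le (by omega) hx

theorem Cb.differentiableAt (f : Cb (k + 1) X) {x : EuclideanSpace ℝ (Fin n)} (hx : x ∈ X) :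
    DifferentiableAt ℝ f x :=
  (f.2.1 x hx).differentiableAt (by simp)

/-- A map of class `C_b^2` on a set with the cone property has a uniformly continuous derivative. -/
theorem UniformCone.uniformContinuousOn_fderiv (hX : UniformCone X r κ) (f : Cb (k + 2) X) :
    UniformContinuousOn (fderiv ℝ f) X := by
  have hκ := hX.κ_pos
  have hr := hX.r_pos
  rw [Metric.uniformContinuousOn_iff_le]
  intro ε hε
  have h1 : 0 < ‖f‖ * (3 / κ) + 1 := by positivity
  refine ⟨min (κ * r) (ε / (‖f‖ * (3 / κ) + 1)), by positivity, fun x hx y hy hxy => ?_⟩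
  rw [dist_comm, dist_eq_norm] at hxy ⊢
  have h := hX.norm_sub_le (φ := fderiv ℝ f) (fun z hz =>
    ((f.2.1 z hz).fderiv_right (m := 1) (by exact_mod_cast (by omega : 1 + 1 ≤ k + 2))).differentiableAt
      (by simp)) hx hy (hxy.trans (min_le_left _ _)) (ε := ‖f‖) fun z hz _ => by
        rw [← norm_iteratedFDeriv_one, norm_iteratedFDeriv_fderiv]
        exact f.norm_iteratedFDeriv_le (by omega) hz
  have h2 := (le_div_iff₀ h1).1 (hxy.trans (min_le_right _ _))
  nlinarith [norm_nonneg (y - x)]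

/-- A perturbation of this size changes increments by at most half of the anti-Lipschitz constant m,
the factor 3/κ being that of the mean value inequality on X. -/
theorem UniformCone.norm_sub_sub_le (hX : UniformCone X r κ) (v : Cb (k + 1) X) {m : ℝ}
    (hv : ‖v‖ ≤ m * κ / 6) {x y : EuclideanSpace ℝ (Fin n)} (hx : x ∈ X) (hy : y ∈ X)
    (hxy : ‖y - x‖ ≤ κ * r) : ‖v y - v x‖ ≤ m / 2 * ‖y - x‖ := by
  have hκ := hX.κ_pos
  refine (hX.norm_sub_le (φ := v) (fun z hz => v.differentiableAt hz) hx hy hxy (ε := ‖v‖)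
    fun z hz _ => v.norm_fderiv_le hz).trans (mul_le_mul_of_nonneg_right ?_ (norm_nonneg _))
  calc ‖v‖ * (3 / κ) ≤ m * κ / 6 * (3 / κ) := by gcongr
    _ = m / 2 := by field_simp; ring

/-- `vectorSobolevNorm` is made of Bochner integrals, which are 0 for functions that are not
integrable. Integrability holds because X and the derivatives are bounded. -/
theorem exists_lintegral_jetSq_le_vectorSobolevNorm (n s : ℕ) : ∃ C : ENNReal, C ≠ ⊤ ∧
    ∀ {X : Set (EuclideanSpace ℝ (Fin n))}, IsOpen X → Bornology.IsBounded X → ∀ v : Cb (s + 1) X,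
      ∫⁻ x in X, jetSq s v x ≤ C * ENNReal.ofReal (vectorSobolevNorm s X v) ^ 2 := by
  obtain ⟨C, hC, h⟩ := exists_jetSq_le_sum_partialDeriv n s
  refine ⟨C, hC, fun {X} hX hXb v => ?_⟩
  have hd : ∀ α : MultiIndex n s, ContinuousOn (partialDeriv α.toFun v) X := fun α x hx =>
    (((ContinuousMultilinearMap.apply ℝ (fun _ => EuclideanSpace ℝ (Fin n))
      (EuclideanSpace ℝ (Fin n)) _).continuous.continuousAt.comp
        ((v.2.1 x hx).continuousAt_iteratedFDeriv
          (by exact_mod_cast α.2.trans (Nat.le_succ s)))).continuousWithinAt)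
  have hint : ∀ α : MultiIndex n s,
      IntegrableOn (fun x => ‖partialDeriv α.toFun v x‖ ^ 2) X volume := fun α => by
    have : IsFiniteMeasure (volume.restrict X) := ⟨by simpa using hXb.measure_lt_top⟩
    refine Integrable.of_bound (((hd α).norm.pow 2).aestronglyMeasurable hX.measurableSet)
      (‖v‖ ^ 2) ?_
    filter_upwards [ae_restrict_mem hX.measurableSet] with x hx
    rw [norm_pow, norm_norm]
    gcongr
    exact (norm_partialDeriv_le _ _ _).trans
      (v.norm_iteratedFDeriv_le (α.2.trans (Nat.le_succ s)) hx)
  have hN : ENNReal.ofReal (vectorSobolevNorm s X v) ^ 2 =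
      ∑ α : MultiIndex n s, ∫⁻ x in X, ‖partialDeriv α.toFun v x‖ₑ ^ 2 := by
    unfold vectorSobolevNorm
    rw [← ENNReal.ofReal_pow (Real.sqrt_nonneg _), Real.sq_sqrt
      (Finset.sum_nonneg fun α _ => integral_nonneg fun x => sq_nonneg _),
      ENNReal.ofReal_sum_of_nonneg fun α _ => integral_nonneg fun x => sq_nonneg _]
    refine Finset.sum_congr rfl fun α _ => ?_
    rw [ofReal_integral_eq_lintegral_ofReal (hint α)
      (Filter.Eventually.of_forall fun x => sq_nonneg _)]
    simp_rw [ENNReal.ofReal_pow (norm_nonneg _), ofReal_norm]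
  rw [hN, ← lintegral_finsetSum' _ fun α _ =>
    ((hd α).enorm.aemeasurable hX.measurableSet).pow_const 2, ← lintegral_const_mul' _ _ hC]
  exact setLIntegral_mono' hX.measurableSet fun x hx =>
    h ((v.2.1 x hx).of_le (by exact_mod_cast Nat.le_succ s))

end CbNorm

/-! ### Composition on L² and on classes modulo null sets -/

section L2
variable {E : Type} [NormedAddCommGroup E] [MeasurableSpace E] [BorelSpace E] {μ : Measure E}
  {X : Set E} {m r₁ : ℝ} {N : ENNReal}

omit [BorelSpace E] in
theorem CompBound.lintegral_comp_le (hN : CompBound μ X m r₁ N) (hX : MeasurableSet X) {F : E → E}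
    (hF : ContinuousOn F X) (hFX : MapsTo F X X)
    (hanti : ∀ x ∈ X, ∀ y ∈ X, ‖y - x‖ < r₁ → m * ‖y - x‖ ≤ ‖F y - F x‖)
    {U : E → ENNReal} (hU : Measurable U) :
    ∫⁻ x in X, U (F x) ∂μ ≤ N * ∫⁻ x in X, U x ∂μ := by
  rw [← lintegral_indicator hX U]
  refine le_trans (le_of_eq (setLIntegral_congr_fun hX fun x hx => ?_))
    (hN F X le_rfl hX hF hanti _ (hU.indicator hX))
  simp only [indicator_of_mem (hFX hx)]

/-- Preimages of null sets are null sets, by the composition bound for the indicator of a measurable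
null set containing the points where g and h differ. Hence g ∘ f is well defined on classes. -/
theorem CompBound.ae_eq_comp (hN : CompBound μ X m r₁ N) (hX : MeasurableSet X) {F : E → E}
    (hF : ContinuousOn F X) (hFX : MapsTo F X X)
    (hanti : ∀ x ∈ X, ∀ y ∈ X, ‖y - x‖ < r₁ → m * ‖y - x‖ ≤ ‖F y - F x‖)
    {β : Type*} {g h : E → β} (hgh : g =ᵐ[μ.restrict X] h) :
    g ∘ F =ᵐ[μ.restrict X] h ∘ F := by
  set S := toMeasurable (μ.restrict X) {x | g x ≠ h x} with hS
  have hSm : MeasurableSet S := measurableSet_toMeasurable _ _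
  have hS0 : μ.restrict X S = 0 := by rw [hS, measure_toMeasurable]; exact hgh
  have h0 := hN.lintegral_comp_le hX hF hFX hanti
    ((measurable_const (a := (1 : ENNReal))).indicator hSm)
  have hm : AEMeasurable (fun x => S.indicator (fun _ => (1 : ENNReal)) (F x)) (μ.restrict X) :=
    (measurable_const.indicator hSm).comp_aemeasurable (hF.aemeasurable hX)
  rw [lintegral_indicator_const hSm, one_mul, hS0, mul_zero, nonpos_iff_eq_zero,
    lintegral_eq_zero_iff' hm] at h0
  filter_upwards [h0] with x hx
  by_contra hne
  have : F x ∈ S := subset_toMeasurable _ _ hne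
  simp [this] at hx

theorem CompBound.eLpNorm_comp_le (hN : CompBound μ X m r₁ N) (hX : MeasurableSet X) {F : E → E}
    (hF : ContinuousOn F X) (hFX : MapsTo F X X)
    (hanti : ∀ x ∈ X, ∀ y ∈ X, ‖y - x‖ < r₁ → m * ‖y - x‖ ≤ ‖F y - F x‖)
    {V : Type*} [NormedAddCommGroup V] {U : E → V} (hU : StronglyMeasurable U) :
    AEStronglyMeasurable (fun x => U (F x)) (μ.restrict X) ∧
      eLpNorm (fun x => U (F x)) 2 (μ.restrict X) ≤ (N + 1) * eLpNorm U 2 (μ.restrict X) := by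
  refine ⟨hU.aestronglyMeasurable.comp_aemeasurable (hF.aemeasurable hX), ?_⟩
  rw [← ENNReal.pow_le_pow_left_iff two_ne_zero, mul_pow, eLpNorm_two_sq, eLpNorm_two_sq]
  refine (hN.lintegral_comp_le hX hF hFX hanti (hU.enorm.pow_const 2)).trans
    (mul_le_mul_left ?_ _)
  rw [sq]
  exact le_self_add.trans (le_mul_of_one_le_right zero_le le_add_self)

end L2

/-! ### The Koopman operator -/

section Koopman
variable {n s : ℕ} {𝕜 : Type u} [RCLike 𝕜] {X : Set (EuclideanSpace ℝ (Fin n))} {r κ m r₁ : ℝ}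
  {N : ENNReal}

/-- A transformation with the bounds of `TransferBound` is realised by a bounded operator. -/
theorem TransferBound.exists_continuousLinearMap (hX : IsOpen X)
    {T : (EuclideanSpace ℝ (Fin n) → 𝕜) → EuclideanSpace ℝ (Fin n) → 𝕜} {A : ℝ} (hA : 0 ≤ A)
    (hT : TransferBound 𝕜 s X T (ENNReal.ofReal A))
    (hadd : ∀ U V, T (U + V) = T U + T V) (hsmul : ∀ (c : 𝕜) U, T (c • U) = c • T U)
    (hae : ∀ U V, U =ᵐ[volume.restrict X] V → T U =ᵐ[volume.restrict X] T V) :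
    ∃ K : Sobolev 𝕜 (s + 1) X →L[𝕜] Sobolev 𝕜 s X,
      ∀ u, sobolevFn (K u) =ᵐ[volume.restrict X] T (sobolevFn u) := by
  obtain ⟨C, -, h⟩ := TransferBound.exists_sobolev 𝕜 n s
  choose K hK hKn using h hX hA hT
  -- The images are merely chosen, but they are determined by their underlying functions, and
  -- linearity follows from that.
  have hunique : ∀ (u : Sobolev 𝕜 (s + 1) X) (v : Sobolev 𝕜 s X),
      sobolevFn v =ᵐ[volume.restrict X] T (sobolevFn u) → K u = v := fun u v hv =>
    sobolev_ext hX (Lp.ext ((hK u).trans hv.symm))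
  let L : Sobolev 𝕜 (s + 1) X →ₗ[𝕜] Sobolev 𝕜 s X :=
    { toFun := K
      map_add' := fun u v => hunique _ _ <| by
        have h1 : sobolevFn (K u + K v) = sobolevFn (K u) + sobolevFn (K v) := rfl
        have h2 : sobolevFn (u + v) = sobolevFn u + sobolevFn v := rfl
        rw [h1, h2]
        refine (Lp.coeFn_add _ _).trans (((hK u).add (hK v)).trans ?_)
        rw [← hadd]
        exact hae _ _ (Lp.coeFn_add _ _).symm
      map_smul' := fun c u => hunique _ _ <| by
        have h1 : sobolevFn (c • K u) = c • sobolevFn (K u) := rfl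
        have h2 : sobolevFn (c • u) = c • sobolevFn u := rfl
        rw [RingHom.id_apply, h1, h2]
        refine (Lp.coeFn_smul _ _).trans (((hK u).const_smul c).trans ?_)
        rw [← hsmul]
        exact hae _ _ (Lp.coeFn_smul _ _).symm }
  exact ⟨L.mkContinuous (C * A) hKn, hK⟩

theorem CompBound.transferBound_comp (hXo : IsOpen X) (hN : CompBound volume X m r₁ N)
    (hNt : N ≠ ⊤) (f : Cb (s + 1) X) (hfX : MapsTo f X X)
    (hanti : ∀ x ∈ X, ∀ y ∈ X, ‖y - x‖ < r₁ → m * ‖y - x‖ ≤ ‖f y - f x‖) :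
    ∃ A : ℝ, 0 ≤ A ∧ TransferBound 𝕜 s X (fun U x => U (f x)) (ENNReal.ofReal A) := by
  have hf : ContDiffOn ℝ s f X := f.contDiffOn.of_le (by exact_mod_cast Nat.le_succ s)
  set c : ℝ := s.factorial * (‖f‖ + 1) ^ s with hc
  have hc0 : 0 ≤ c := by positivity
  refine ⟨c * (N.toReal + 1), by positivity, fun U V => rfl, ?_, ?_, ?_⟩
  · exact ⟨N + 1, by finiteness, fun U hU =>
      hN.eLpNorm_comp_le hXo.measurableSet hf.continuousOn hfX hanti hU⟩
  · intro G hG x hx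
    exact (hG.of_le (by exact_mod_cast le_top)).contDiffAt.comp x
      ((f.2.1 x hx).of_le (by exact_mod_cast Nat.le_succ s))
  · intro K hKX hK
    refine ⟨f '' K, (image_mono hKX).trans hfX.image_subset,
      hK.image_of_continuousOn (hf.continuousOn.mono hKX), fun G hG k hk => ?_⟩
    refine (hN.lintegral_iteratedFDeriv_comp_le hXo hf hanti (B := ‖f‖ + 1)
      (by linarith [norm_nonneg f]) (fun x hx i _ hi =>
        (f.norm_iteratedFDeriv_le (by omega) hx).trans (by linarith)) hKX hK hG hk).trans ?_
    rw [ENNReal.ofReal_mul hc0, mul_pow, mul_assoc]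
    refine mul_le_mul_right (mul_le_mul_left ?_ _) _
    rw [ENNReal.ofReal_add ENNReal.toReal_nonneg zero_le_one, ENNReal.ofReal_toReal hNt,
      ENNReal.ofReal_one, sq]
    exact le_self_add.trans (le_mul_of_one_le_right zero_le le_add_self)

theorem CompBound.exists_isKoopman (hXo : IsOpen X) (hN : CompBound volume X m r₁ N)
    (hNt : N ≠ ⊤) (f : Cb (s + 1) X) (hfX : MapsTo f X X)
    (hanti : ∀ x ∈ X, ∀ y ∈ X, ‖y - x‖ < r₁ → m * ‖y - x‖ ≤ ‖f y - f x‖) :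
    ∃ K : Sobolev 𝕜 (s + 1) X →L[𝕜] Sobolev 𝕜 s X, IsKoopman f K := by
  obtain ⟨A, hA, hT⟩ := hN.transferBound_comp (𝕜 := 𝕜) hXo hNt f hfX hanti
  have hae : ∀ U V : EuclideanSpace ℝ (Fin n) → 𝕜, U =ᵐ[volume.restrict X] V →
      (fun x => U (f x)) =ᵐ[volume.restrict X] fun x => V (f x) := fun U V h =>
    hN.ae_eq_comp hXo.measurableSet f.contDiffOn.continuousOn hfX hanti h
  obtain ⟨K, hK⟩ := hT.exists_continuousLinearMap hXo hA (fun _ _ => rfl) (fun _ _ => rfl) hae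
  exact ⟨K, fun u g hg => (hK u).trans (hae _ _ hg)⟩

/-- The difference of the two operators is itself realised by the transformation U ↦ U ∘ f' - U ∘ f,
so a bound for the latter on smooth functions gives the operator norm, whatever the construction of
the operators. -/
theorem IsKoopman.norm_sub_le_of_transferBound (𝕜 : Type u) [RCLike 𝕜] (n s : ℕ) :
    ∃ C : ℝ, 0 ≤ C ∧ ∀ {X : Set (EuclideanSpace ℝ (Fin n))}, IsOpen X →
    ∀ {f f' : EuclideanSpace ℝ (Fin n) → EuclideanSpace ℝ (Fin n)}
      {K K' : Sobolev 𝕜 (s + 1) X →L[𝕜] Sobolev 𝕜 s X}, IsKoopman f K → IsKoopman f' K' →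
      ∀ {A : ℝ}, 0 ≤ A →
      TransferBound 𝕜 s X (fun U x => U (f' x) - U (f x)) (ENNReal.ofReal A) →
      ‖K' - K‖ ≤ C * A := by
  obtain ⟨C, hC, h⟩ := TransferBound.exists_sobolev 𝕜 n s
  refine ⟨C, hC, fun {X} hX {f f' K K'} hK hK' {A} hA hT => ?_⟩
  refine ContinuousLinearMap.opNorm_le_bound _ (by positivity) fun u => ?_
  obtain ⟨v, hv, hvn⟩ := h hX hA hT u
  have : (K' - K) u = v := by
    refine sobolev_ext hX (Lp.ext ?_)
    have h1 : sobolevFn ((K' - K) u) = sobolevFn (K' u) - sobolevFn (K u) := rfl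
    rw [h1]
    refine (Lp.coeFn_sub _ _).trans ?_
    filter_upwards [hv, hK u _ Filter.EventuallyEq.rfl, hK' u _ Filter.EventuallyEq.rfl]
      with x h1 h2 h3
    rw [h1, Pi.sub_apply, h2, h3]
    rfl
  rwa [this]

end Koopman

/-! ### First-order bounds for perturbed maps -/

section Perturbation
variable {n s : ℕ} {𝕜 : Type u} [RCLike 𝕜] {X : Set (EuclideanSpace ℝ (Fin n))} {r κ m r₁ : ℝ}

theorem antilipschitz_of_sub_le {E : Type*} [NormedAddCommGroup E] {X : Set E} {m r₁ : ℝ}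
    {f f' : E → E} (hanti : ∀ x ∈ X, ∀ y ∈ X, ‖y - x‖ < r₁ → m * ‖y - x‖ ≤ ‖f y - f x‖)
    (hclose : ∀ x ∈ X, ∀ y ∈ X, ‖y - x‖ < r₁ →
      ‖(f' y - f y) - (f' x - f x)‖ ≤ m / 2 * ‖y - x‖) :
    ∀ x ∈ X, ∀ y ∈ X, ‖y - x‖ < r₁ → m / 2 * ‖y - x‖ ≤ ‖f' y - f' x‖ := fun x hx y hy hxy => by
  have h1 := hanti x hx y hy hxy
  have h2 := hclose x hx y hy hxy
  have h3 : f y - f x = (f' y - f' x) - ((f' y - f y) - (f' x - f x)) := by abel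
  have h4 := norm_sub_le (f' y - f' x) ((f' y - f y) - (f' x - f x))
  rw [← h3] at h4
  linarith

/-- The common part of both first-order bounds. They differ only in the choice of Q and in the proof
of the product estimate, which is therefore a hypothesis. -/
theorem UniformCone.exists_transferBound_sub (hX : UniformCone X r κ) (hXo : IsOpen X)
    (hXb : Bornology.IsBounded X) (hm : 0 < m) (hr₁ : 0 < r₁) (hr₁κ : r₁ ≤ κ * r)
    (f : Cb (s + 1) X) (hfX : MapsTo f X X)
    (hanti : ∀ x ∈ X, ∀ y ∈ X, ‖y - x‖ < r₁ → m * ‖y - x‖ ≤ ‖f y - f x‖)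
    {D : ENNReal} (hD : D ≠ ⊤) :
    ∃ C : ℝ, 0 ≤ C ∧ ∀ f' : Cb (s + 1) X, MapsTo f' X X → ‖f' - f‖ ≤ m * κ / 6 →
      ‖f' - f‖ ≤ κ * r / 2 → ‖f' - f‖ ≤ 1 → ∀ Q : ℝ, (∀ x ∈ X, ‖f' x - f x‖ ≤ Q) →
      (∀ i j, 1 ≤ i → i ≤ s → j ≤ s → i + j ≤ s + 1 → ∀ K ⊆ X, IsCompact K →
        ∃ K' ⊆ X, IsCompact K' ∧ ∀ {V : Type u} [NormedAddCommGroup V] [NormedSpace ℝ V]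
          [CompleteSpace V] {G : EuclideanSpace ℝ (Fin n) → V}, ContDiff ℝ ∞ G →
          ∫⁻ x in K, ‖iteratedFDeriv ℝ i G (f' x)‖ₑ ^ 2 *
            ‖iteratedFDeriv ℝ j (fun y => f' y - f y) x‖ₑ ^ 2 ≤
            D * ENNReal.ofReal Q ^ 2 * ∫⁻ y in K', jetSq (s + 1) G y) →
      TransferBound 𝕜 s X (fun U x => U (f' x) - U (f x)) (ENNReal.ofReal (C * Q)) := by
  obtain ⟨N, hNt, hN⟩ := exists_compBound volume hXb (half_pos hm) hr₁
  obtain ⟨C, hC, h⟩ := hX.exists_lintegral_iteratedFDeriv_comp_sub_comp_le.{u} volume hXo hXb hm hr₁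
    s (B := ‖f‖ + 1) (by linarith [norm_nonneg f]) hD
  have hf : ContDiffOn ℝ s f X := f.contDiffOn.of_le (by exact_mod_cast Nat.le_succ s)
  refine ⟨C.toReal + 1, by positivity, fun f' hfX' h1 h2 h3 Q hQ hprod => ?_⟩
  have hf' : ContDiffOn ℝ s f' X := f'.contDiffOn.of_le (by exact_mod_cast Nat.le_succ s)
  have hclose : ∀ x ∈ X, ∀ y ∈ X, ‖y - x‖ < r₁ →
      ‖(f' y - f y) - (f' x - f x)‖ ≤ m / 2 * ‖y - x‖ := fun x hx y hy hxy =>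
    hX.norm_sub_sub_le (f' - f) h1 hx hy (hxy.le.trans hr₁κ)
  have hanti' := antilipschitz_of_sub_le hanti hclose
  have hanti2 : ∀ x ∈ X, ∀ y ∈ X, ‖y - x‖ < r₁ → m / 2 * ‖y - x‖ ≤ ‖f y - f x‖ :=
    fun x hx y hy hxy => le_trans (by nlinarith [norm_nonneg (y - x)]) (hanti x hx y hy hxy)
  have hn : ‖f'‖ ≤ ‖f‖ + 1 := by
    have := norm_add_le f (f' - f)
    rw [add_sub_cancel] at this
    linarith
  refine ⟨fun U V => ?_, ⟨(N + 1) + (N + 1), by finiteness, fun U hU => ?_⟩, fun G hG x hx => ?_,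
    fun K hKX hK => ?_⟩
  · ext1 x
    simp only [Pi.sub_apply]
    abel
  · obtain ⟨m1, e1⟩ := hN.eLpNorm_comp_le hXo.measurableSet hf.continuousOn hfX hanti2 hU
    obtain ⟨m2, e2⟩ := hN.eLpNorm_comp_le hXo.measurableSet hf'.continuousOn hfX' hanti' hU
    refine ⟨m2.sub m1, (eLpNorm_sub_le m2 m1 (by norm_num)).trans ?_⟩
    rw [add_mul]
    exact add_le_add e2 e1
  · have hc : ∀ g : Cb (s + 1) X, ContDiffAt ℝ s (fun x => G (g x)) x := fun g =>
      (hG.of_le (by exact_mod_cast le_top)).contDiffAt.comp x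
        ((g.2.1 x hx).of_le (by exact_mod_cast Nat.le_succ s))
    exact (hc f').sub (hc f)
  · obtain ⟨K', hK'X, hK', hb⟩ := h f f' hf hf' hfX hfX'
      (fun x hx i _ hi => (f.norm_iteratedFDeriv_le (by omega) hx).trans (by linarith))
      (fun x hx i _ hi => (f'.norm_iteratedFDeriv_le (by omega) hx).trans hn) hanti hclose
      (fun x hx => ((f' - f).norm_apply_le hx).trans h2) Q hQ hprod K hKX hK
    refine ⟨K', hK'X, hK', fun G hG k hk => (hb hG k hk).trans ?_⟩
    refine mul_le_mul_left ?_ _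
    rw [ENNReal.ofReal_mul (by positivity), mul_pow]
    refine mul_le_mul_left ?_ _
    rw [ENNReal.ofReal_add ENNReal.toReal_nonneg zero_le_one, ENNReal.ofReal_toReal hC,
      ENNReal.ofReal_one, sq]
    exact le_self_add.trans (le_mul_of_one_le_right zero_le le_add_self)

/-- The transformation `G ↦ G ∘ f' - G ∘ f` in terms of the norm of `f' - f` in `C_b^s`. -/
theorem UniformCone.exists_transferBound_sub_lower (hX : UniformCone X r κ) (hXo : IsOpen X)
    (hXb : Bornology.IsBounded X) (hm : 0 < m) (hr₁ : 0 < r₁) (hr₁κ : r₁ ≤ κ * r)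
    (f : Cb (s + 1) X) (hfX : MapsTo f X X)
    (hanti : ∀ x ∈ X, ∀ y ∈ X, ‖y - x‖ < r₁ → m * ‖y - x‖ ≤ ‖f y - f x‖) :
    ∃ C : ℝ, 0 ≤ C ∧ ∀ f' : Cb (s + 1) X, MapsTo f' X X → ‖f' - f‖ ≤ m * κ / 6 →
      ‖f' - f‖ ≤ κ * r / 2 → ‖f' - f‖ ≤ 1 →
      TransferBound 𝕜 s X (fun U x => U (f' x) - U (f x))
        (ENNReal.ofReal (C * ‖Cb.lower (f' - f)‖)) := by
  obtain ⟨N, hNt, hN⟩ := exists_compBound volume hXb (half_pos hm) hr₁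
  obtain ⟨C, hC, h⟩ := hX.exists_transferBound_sub (𝕜 := 𝕜) hXo hXb hm hr₁ hr₁κ f hfX hanti hNt
  refine ⟨C, hC, fun f' hfX' h1 h2 h3 => h f' hfX' h1 h2 h3 _
    (fun x hx => (Cb.lower (f' - f)).norm_apply_le hx) fun i j _ hi hj _ K hKX hK => ?_⟩
  have hf' : ContinuousOn f' X := f'.contDiffOn.continuousOn
  have hanti' := antilipschitz_of_sub_le hanti fun x hx y hy hxy =>
    hX.norm_sub_sub_le (f' - f) h1 hx hy (hxy.le.trans hr₁κ)
  refine ⟨f' '' K, (image_mono hKX).trans hfX'.image_subset,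
    hK.image_of_continuousOn (hf'.mono hKX), fun {V} _ _ _ {G} hG => ?_⟩
  set Q := ‖Cb.lower (f' - f)‖
  calc ∫⁻ x in K, ‖iteratedFDeriv ℝ i G (f' x)‖ₑ ^ 2 *
        ‖iteratedFDeriv ℝ j (fun y => f' y - f y) x‖ₑ ^ 2
      ≤ ∫⁻ x in K, ENNReal.ofReal Q ^ 2 * jetSq (s + 1) G (f' x) := by
        refine setLIntegral_mono' hK.measurableSet fun x hx => ?_
        rw [mul_comm]
        refine mul_le_mul' (ENNReal.pow_le_pow_left ?_)
          (enorm_iteratedFDeriv_sq_le_jetSq (by omega) G _)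
        rw [← ofReal_norm]
        exact ENNReal.ofReal_le_ofReal ((Cb.lower (f' - f)).norm_iteratedFDeriv_le hj (hKX hx))
    _ = ENNReal.ofReal Q ^ 2 * ∫⁻ x in K, jetSq (s + 1) G (f' x) :=
        lintegral_const_mul' _ _ (by finiteness)
    _ ≤ ENNReal.ofReal Q ^ 2 * (N * ∫⁻ y in f' '' K, jetSq (s + 1) G y) :=
        mul_le_mul_right (hN.lintegral_comp_le_image hf' hanti' hKX hK (measurable_jetSq hG)) _
    _ = _ := by ring

/-- The transformation `G ↦ G ∘ f' - G ∘ f` in terms of the norm of `f' - f` in `H^s`, for `s`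
above half the dimension. -/
theorem UniformCone.exists_transferBound_sub_vectorSobolevNorm (hX : UniformCone X r κ)
    (hXo : IsOpen X) (hXb : Bornology.IsBounded X) (hm : 0 < m) (hr₁ : 0 < r₁)
    (hr₁κ : r₁ ≤ κ * r) (f : Cb (s + 1) X) (hfX : MapsTo f X X)
    (hanti : ∀ x ∈ X, ∀ y ∈ X, ‖y - x‖ < r₁ → m * ‖y - x‖ ≤ ‖f y - f x‖) (hs : n < 2 * s) :
    ∃ C : ℝ, 0 ≤ C ∧ ∀ f' : Cb (s + 1) X, MapsTo f' X X → ‖f' - f‖ ≤ m * κ / 6 →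
      ‖f' - f‖ ≤ κ * r / 2 → ‖f' - f‖ ≤ 1 →
      TransferBound 𝕜 s X (fun U x => U (f' x) - U (f x))
        (ENNReal.ofReal (C * vectorSobolevNorm s X (f' - f))) := by
  have hs' : Module.finrank ℝ (EuclideanSpace ℝ (Fin n)) < 2 * s := by simpa using hs
  obtain ⟨C₀, hC₀, hjet⟩ := exists_lintegral_jetSq_le_vectorSobolevNorm n s
  obtain ⟨C₁, hC₁, hsup⟩ := hX.exists_enorm_sq_le_lintegral_jetSq volume hXo hs'
  -- The constants are made total in i and j, with the value 0 for the pairs that do not occur, in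
  -- order to be summed to a single one.
  have hex : ∀ i j : ℕ, ∃ C : ENNReal, C ≠ ⊤ ∧ (1 ≤ i → i ≤ s → j ≤ s → i + j ≤ s + 1 →
      ∀ F : EuclideanSpace ℝ (Fin n) → EuclideanSpace ℝ (Fin n), ContinuousOn F X → MapsTo F X X →
      (∀ x ∈ X, ∀ y ∈ X, ‖y - x‖ < r₁ → m / 2 * ‖y - x‖ ≤ ‖F y - F x‖) →
      ∀ K ⊆ X, IsCompact K → ∃ K' ⊆ X, IsCompact K' ∧
      ∀ {V : Type u} [NormedAddCommGroup V] [NormedSpace ℝ V] [CompleteSpace V]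
        {G : EuclideanSpace ℝ (Fin n) → V}
        {v : EuclideanSpace ℝ (Fin n) → EuclideanSpace ℝ (Fin n)},
        ContDiff ℝ ∞ G → ContDiffOn ℝ s v X →
        ∫⁻ x in K, ‖iteratedFDeriv ℝ i G (F x)‖ₑ ^ 2 * ‖iteratedFDeriv ℝ j v x‖ₑ ^ 2 ≤
          C * ((∫⁻ y in K', jetSq (s + 1) G y) * ∫⁻ x in X, jetSq s v x)) := fun i j => by
    by_cases hc : 1 ≤ i ∧ i ≤ s ∧ j ≤ s ∧ i + j ≤ s + 1
    · obtain ⟨C, hC, h⟩ := hX.exists_lintegral_iteratedFDeriv_comp_mul_le volume hXo hXb hs'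
        (half_pos hm) hr₁ hc.1 hc.2.1 hc.2.2.1 hc.2.2.2
      refine ⟨C, hC, fun _ _ _ _ F h1 h2 h3 K h4 h5 => ?_⟩
      obtain ⟨K', h6, h7, h8⟩ := h F h1 h2 h3 K h4 h5
      exact ⟨K', h6, h7, fun hG hv => h8 hG hv⟩
    · exact ⟨0, by simp, fun h1 h2 h3 h4 => absurd ⟨h1, h2, h3, h4⟩ hc⟩
  choose c hct hc using hex
  set c' := ∑ i ∈ Finset.range (s + 1), ∑ j ∈ Finset.range (s + 1), c i j
  have hc't : c' ≠ ⊤ := ENNReal.sum_ne_top.2 fun i _ => ENNReal.sum_ne_top.2 fun j _ => hct i j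
  have hcle : ∀ i ≤ s, ∀ j ≤ s, c i j ≤ c' := fun i hi j hj =>
    (Finset.single_le_sum (f := fun j => c i j) (fun _ _ => zero_le)
      (Finset.mem_range.2 (by omega))).trans
      (Finset.single_le_sum (f := fun i => ∑ j ∈ Finset.range (s + 1), c i j)
        (fun _ _ => zero_le) (Finset.mem_range.2 (by omega)))
  obtain ⟨C, hC, h⟩ := hX.exists_transferBound_sub (𝕜 := 𝕜) hXo hXb hm hr₁ hr₁κ f hfX hanti
    (D := c' * C₀) (by finiteness)
  -- By the Sobolev embedding q times the H^s norm bounds the supremum of ‖f' - f‖, so Q = q w is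
  -- admissible. Adding 1 replaces the square root of C₁ C₀ by a simpler upper bound and gives q ≥
  -- 1, so that Q also dominates w in the products.
  set q := (C₁ * C₀).toReal + 1
  have hq0 : 0 ≤ q := by positivity
  have hq1 : 1 ≤ q := le_add_of_nonneg_left ENNReal.toReal_nonneg
  refine ⟨C * q, by positivity, fun f' hfX' h1 h2 h3 => ?_⟩
  set w := vectorSobolevNorm s X (f' - f)
  have hw0 : 0 ≤ w := Real.sqrt_nonneg _
  rw [mul_assoc]
  have hv : ContDiffOn ℝ s (fun y => f' y - f y) X :=
    (f' - f).contDiffOn.of_le (by exact_mod_cast Nat.le_succ s)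
  have hjw : ∫⁻ x in X, jetSq s (fun y => f' y - f y) x ≤ C₀ * ENNReal.ofReal w ^ 2 :=
    hjet hXo hXb (f' - f)
  have hf' : ContinuousOn f' X := f'.contDiffOn.continuousOn
  have hanti' := antilipschitz_of_sub_le hanti fun x hx y hy hxy =>
    hX.norm_sub_sub_le (f' - f) h1 hx hy (hxy.le.trans hr₁κ)
  refine h f' hfX' h1 h2 h3 (q * w) (fun x hx => ?_) fun i j h1i hi hj hij K hKX hK => ?_
  · have e : ‖f' x - f x‖ₑ ^ 2 ≤ ENNReal.ofReal (q * w) ^ 2 := by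
      refine ((hsup hv x hx).trans (mul_le_mul_right hjw _)).trans ?_
      rw [← mul_assoc, ENNReal.ofReal_mul hq0, mul_pow]
      refine mul_le_mul_left ?_ _
      rw [ENNReal.ofReal_add ENNReal.toReal_nonneg zero_le_one,
        ENNReal.ofReal_toReal (by finiteness), ENNReal.ofReal_one, sq]
      exact le_self_add.trans (le_mul_of_one_le_right zero_le le_add_self)
    rw [ENNReal.pow_le_pow_left_iff two_ne_zero, ← ofReal_norm,
      ENNReal.ofReal_le_ofReal_iff (by positivity)] at e
    exact e
  · obtain ⟨K', hK'X, hK', hb⟩ := hc i j h1i hi hj hij f' hf' hfX' hanti' K hKX hK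
    refine ⟨K', hK'X, hK', fun {V} _ _ _ {G} hG => (hb hG hv).trans ?_⟩
    have e : ENNReal.ofReal w ≤ ENNReal.ofReal (q * w) :=
      ENNReal.ofReal_le_ofReal (le_mul_of_one_le_left hw0 hq1)
    calc c i j * ((∫⁻ y in K', jetSq (s + 1) G y) *
          ∫⁻ x in X, jetSq s (fun y => f' y - f y) x)
        ≤ c' * ((∫⁻ y in K', jetSq (s + 1) G y) * (C₀ * ENNReal.ofReal (q * w) ^ 2)) := by
          refine mul_le_mul' (hcle i hi j hj) (mul_le_mul_right (hjw.trans ?_) _)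
          exact mul_le_mul_right (ENNReal.pow_le_pow_left e) _
      _ = _ := by ring

end Perturbation

end Koopmanizing

/-! ### The main theorem -/

open Koopmanizing in
theorem mainTheorem7 {𝕜 : Type*} [RCLike 𝕜] (n s : ℕ)
    (X : Set (EuclideanSpace ℝ (Fin n))) (hX : IsBoundedLipschitzDomain X)
    (F : Set (Cb (s + 1) X))
    (hmaps : ∀ f ∈ F, Set.MapsTo f X X)
    (hdet : ∀ f ∈ F, ∃ c : ℝ, 0 < c ∧ ∀ x ∈ X, c ≤ |(fderiv ℝ f x).det|)
    (hunif : s = 0 → ∀ f ∈ F, UniformContinuousOn (fderiv ℝ f) X) :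
    ∃ M : F → (Sobolev 𝕜 (s + 1) X →L[𝕜] Sobolev 𝕜 s X),
      (∀ f : F, IsKoopman f.1 (M f)) ∧
      Continuous M ∧
      (∀ f : F, ∃ C δ : ℝ, 0 < δ ∧ ∀ f' : F, ‖f'.1 - f.1‖ < δ →
        ‖M f' - M f‖ ≤ C * ‖Cb.lower (f'.1 - f.1)‖) ∧
      (n < 2 * s → ∀ f : F, ∃ C δ : ℝ, 0 < δ ∧ ∀ f' : F, ‖f'.1 - f.1‖ < δ →
        ‖M f' - M f‖ ≤ C * vectorSobolevNorm s X (f'.1 - f.1)) := by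
  have hXo := hX.isOpen
  have hXb := hX.isBounded
  obtain ⟨r, κ, hcone⟩ := hX.exists_uniformCone
  have hκ := hcone.κ_pos
  have hr := hcone.r_pos
  have hu : ∀ f ∈ F, UniformContinuousOn (fderiv ℝ f) X := by
    rcases s with _ | s
    · exact hunif rfl
    · exact fun f _ => hcone.uniformContinuousOn_fderiv f
  have hanti : ∀ f ∈ F, ∃ m r₁ : ℝ, 0 < m ∧ 0 < r₁ ∧ r₁ ≤ κ * r ∧
      ∀ x ∈ X, ∀ y ∈ X, ‖y - x‖ < r₁ → m * ‖y - x‖ ≤ ‖f y - f x‖ := fun f hf => by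
    obtain ⟨c, hc, hcd⟩ := hdet f hf
    obtain ⟨m, r₁, hm, hr₁, h⟩ := hcone.exists_antilipschitz
      (fun z hz => f.differentiableAt hz) hc hcd (fun z hz => f.norm_fderiv_le hz) (hu f hf)
    -- The scale is lowered to κ r, where the mean value inequality on X also applies to f' - f.
    exact ⟨m, min r₁ (κ * r), hm, by positivity, min_le_right _ _, fun x hx y hy hxy =>
      h x hx y hy (hxy.trans_le (min_le_left _ _))⟩
  have hex : ∀ f : F, ∃ K : Sobolev 𝕜 (s + 1) X →L[𝕜] Sobolev 𝕜 s X, IsKoopman f.1 K := fun f => by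
    obtain ⟨m, r₁, hm, hr₁, -, h⟩ := hanti f.1 f.2
    obtain ⟨N, hNt, hN⟩ := exists_compBound volume hXb hm hr₁
    exact hN.exists_isKoopman hXo hNt f.1 (hmaps f.1 f.2) h
  choose M hM using hex
  obtain ⟨C₀, hC₀, hsub⟩ := IsKoopman.norm_sub_le_of_transferBound 𝕜 n s
  -- The radius δ has three purposes: m κ / 6 preserves half of the anti-Lipschitz constant, κ r / 2
  -- keeps the paths from f(x) to f'(x) inside the cones, and 1 bounds the derivatives of f' by
  -- those of f.
  have hδ : ∀ {m : ℝ}, 0 < m → 0 < min (m * κ / 6) (min (κ * r / 2) 1) := fun hm => by positivity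
  have hlt : ∀ {m a : ℝ}, a < min (m * κ / 6) (min (κ * r / 2) 1) →
      a ≤ m * κ / 6 ∧ a ≤ κ * r / 2 ∧ a ≤ 1 := fun h =>
    ⟨h.le.trans (min_le_left _ _), h.le.trans ((min_le_right _ _).trans (min_le_left _ _)),
      h.le.trans ((min_le_right _ _).trans (min_le_right _ _))⟩
  have hfirst : ∀ f : F, ∃ C δ : ℝ, 0 < δ ∧ ∀ f' : F, ‖f'.1 - f.1‖ < δ →
      ‖M f' - M f‖ ≤ C * ‖Cb.lower (f'.1 - f.1)‖ := fun f => by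
    obtain ⟨m, r₁, hm, hr₁, hr₁κ, h⟩ := hanti f.1 f.2
    obtain ⟨C, hC, hT⟩ := hcone.exists_transferBound_sub_lower (𝕜 := 𝕜) hXo hXb hm hr₁ hr₁κ f.1
      (hmaps f.1 f.2) h
    refine ⟨C₀ * C, _, hδ hm, fun f' hf' => ?_⟩
    obtain ⟨h1, h2, h3⟩ := hlt hf'
    rw [mul_assoc]
    exact hsub hXo (hM f) (hM f') (by positivity) (hT f'.1 (hmaps f'.1 f'.2) h1 h2 h3)
  refine ⟨M, hM, ?_, hfirst, fun hs f => ?_⟩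
  -- The first-order bound is stronger than continuity, as the C_b^s norm of f' - f is at most its
  -- C_b^{s+1} norm. The absolute value is taken since C is not known to be nonnegative here.
  · rw [continuous_iff_continuousAt]
    intro f
    obtain ⟨C, δ, hδ0, h⟩ := hfirst f
    have hd : Filter.Tendsto (fun f' : F => ‖f'.1 - f.1‖) (nhds f) (nhds 0) := by
      have : Continuous fun f' : F => ‖f'.1 - f.1‖ :=
        (continuous_subtype_val.sub continuous_const).norm
      simpa using this.tendsto f
    refine tendsto_iff_norm_sub_tendsto_zero.2 (squeeze_zero_norm' ?_
      (by simpa using hd.const_mul |C|))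
    filter_upwards [hd.eventually_lt_const hδ0] with f' hf'
    rw [norm_norm]
    exact (h f' hf').trans (mul_le_mul (le_abs_self C) (Cb.norm_lower_le _) (norm_nonneg _)
      (abs_nonneg C))
  · obtain ⟨m, r₁, hm, hr₁, hr₁κ, h⟩ := hanti f.1 f.2
    obtain ⟨C, hC, hT⟩ := hcone.exists_transferBound_sub_vectorSobolevNorm (𝕜 := 𝕜) hXo hXb hm hr₁
      hr₁κ f.1 (hmaps f.1 f.2) h hs
    refine ⟨C₀ * C, _, hδ hm, fun f' hf' => ?_⟩
    obtain ⟨h1, h2, h3⟩ := hlt hf'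
    rw [mul_assoc]
    exact hsub hXo (hM f) (hM f')
      (mul_nonneg hC (Real.sqrt_nonneg _)) (hT f'.1 (hmaps f'.1 f'.2) h1 h2 h3)
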